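/- **Setting.** Let $1\le d\le D$ and let $S_1,S_2\subset\mathbb R^D$ be two (nonempty) connected, compact, $C^2$ embedded submanifolds without boundary, both of dimension $d$, with $S_1\cap S_2\ne\emptyset$. Write $T_S(s)$ for the tangent space of $S$ at $s$. Assume: - *Positive incidence angle:* $\theta(S_1,S_2):=\inf_{s\in S_1\cap S_2}\theta_{\min}(T_{S_1}(s),T_{S_2}(s))>0$, where $\theta_{\min}(T_1,T_2)$ is the smallest nonzero principal angle between $T_1$ and $T_2$ (and is $0$ if $T_1=T_2$). - *The intersection has positive reach:* there is $\rho>0$ such that each point at distance less than $\rho$ from $S_1\cap S_2$ has a unique nearest point in $S_1\cap S_2$; and the tangent cone of $S_1\cap S_2$ (limits of $t_k(s_k-s)$ with $t_k\ge 0$, $s_k\in S_1\cap S_2$, $s_k\to s$) at each $s\in S_1\cap S_2$ is $T_{S_1}(s)\cap T_{S_2}(s)$. Data points are $x_i=s_i+z_i$, $i=1,\dots,n$ ($n\ge1$), where the pairs $(s_i,z_i)$ are independent, $s_i$ is uniformly distributed on $S_1\cup S_2$ (with respect to $d$-dimensional Hausdorff measure), and $\|z_i\|\le\tau$ almost surely.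 Let $I_k=\{i:s_i\in S_k\}$ be the clusters. For parameters $r,\varepsilon,\eta>0$, let $C_i$ be the sample covariance matrix (normalised by the number of points) of the data points $x_j$, $j\in\{1,\dots,n\}$, with $\|x_j-x_i\|\le r$; matrix norms are spectral norms. - *Algorithm 2 (comparing covariances).* Join $i\neq j$ by an edge when $\|x_i-x_j\|\le\varepsilon$ and $\|C_i-C_j\|\le\eta r^2$. Remove $x_i$ whenever there is $x_j$ with $\|x_j-x_i\|\le r$ and $\|C_j-C_i\|>\eta r^2$. The groups are the connected components of the graph on the surviving points; each removed point then joins the group of the closest surviving point (ties broken arbitrarily). - *Algorithm 3 (comparing projections).* Let $Q_i$ be the orthogonal projection onto the span of the eigenvectors of $C_i$ with eigenvalue exceeding $\sqrt\eta\,\|C_i\|$. Join $i\ne j$ by an edge when $\|x_i-x_j\|\le\varepsilon$ and $\|Q_i-Q_j\|\le\eta$. The groups are the connected components of this graph. **Theorem.** There is a constant $C_0>0$, depending only on $S_1$ and $S_2$, such that for every $C\ge C_0$ and all $n\ge1$, $r,\varepsilon,\eta>0$, $\tau\ge0$ with $$\tau\le r\eta/C,\qquad r\le\varepsilon/C,\qquad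 \varepsilon\le\eta/C,\qquad \eta\le1/C,$$ the following holds with probability at least $1-Cn\exp(-nr^d\eta^2/C)$: - Algorithm 2 returns exactly two groups (however ties are broken), and whenever $i\in I_1$, $j\in I_2$ are grouped together, $x_i$ or $x_j$ is within distance $Cr$ of $S_1\cap S_2$. - Algorithm 3 returns at least two groups, and whenever $i\in I_1$, $j\in I_2$ are grouped together, $x_i$ or $x_j$ is within distance $Cr$ of $S_1\cap S_2$. -/

import Mathlib

open MeasureTheory ProbabilityTheory Module
open scoped RealInnerProductSpace

/-! ## Geometry of surfaces in a Euclidean space -/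

section Geometry

/-- A nonempty, connected, compact `d`-dimensional `C²` embedded submanifold without boundary:
around each of its points, a `C²` diffeomorphism between open subsets of the ambient space
flattens `S` to a `d`-dimensional linear subspace. -/
structure IsClosedSurface {D : ℕ} (d : ℕ) (S : Set (EuclideanSpace ℝ (Fin D))) : Prop where
  isConnected : IsConnected S
  isCompact : IsCompact S
  exists_flattening : ∀ s ∈ S,
    ∃ (φ : OpenPartialHomeomorph (EuclideanSpace ℝ (Fin D)) (EuclideanSpace ℝ (Fin D)))
      (L : Submodule ℝ (EuclideanSpace ℝ (Fin D))),
      s ∈ φ.source ∧ ContDiffOn ℝ 2 φ φ.source ∧ ContDiffOn ℝ 2 φ.symm φ.target ∧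
      finrank ℝ L = d ∧ ∀ y ∈ φ.source, y ∈ S ↔ φ y ∈ L

variable {E : Type*} [NormedAddCommGroup E] [InnerProductSpace ℝ E]

/-- The reach of `S`: the supremum of the `ρ > 0` such that every point at distance less than `ρ`
from `S` has a unique nearest point in `S`. -/
noncomputable def reach (S : Set E) : ENNReal :=
  ⨆ (ρ : ℝ) (_ : 0 < ρ ∧
    ∀ x, Metric.infDist x S < ρ → ∃! s, s ∈ S ∧ dist x s = Metric.infDist x S), ENNReal.ofReal ρ

/-- The tangent subspace of `S` at `s`, as a linear subspace: the span of the (one-sided) tangent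
cone. When `S` is a submanifold the cone is already this subspace. -/
noncomputable def tangentSubspace (S : Set E) (s : E) : Submodule ℝ E :=
  Submodule.span ℝ (posTangentConeAt S s)

variable [FiniteDimensional ℝ E]

/-- The principal angles between two subspaces: the `θ ∈ [0, π/2]` such that `cos θ` is a singular
value of the orthogonal projection from `T₁` to `T₂`, witnessed by a pair of unit singular
vectors. -/
def principalAngles (T₁ T₂ : Submodule ℝ E) : Set ℝ :=
  {θ | θ ∈ Set.Icc 0 (Real.pi / 2) ∧ ∃ u ∈ T₁, ∃ v ∈ T₂, ‖u‖ = 1 ∧ ‖v‖ = 1 ∧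
    T₂.starProjection u = Real.cos θ • v ∧ T₁.starProjection v = Real.cos θ • u}

/-- The smallest nonzero principal angle. If there is none (the subspaces are nested, which for
subspaces of the same dimension means that they coincide) the value is `0 = sInf ∅`. -/
noncomputable def minAngle (T₁ T₂ : Submodule ℝ E) : ℝ :=
  sInf {θ | θ ∈ principalAngles T₁ T₂ ∧ θ ≠ 0}

/-- The incidence angle of two surfaces: the infimum, over the points where they meet, of the
smallest nonzero principal angle between their tangent subspaces. -/
noncomputable def incidenceAngle (S₁ S₂ : Set E) : ℝ :=
  ⨅ s : ↥(S₁ ∩ S₂), minAngle (tangentSubspace S₁ s) (tangentSubspace S₂ s)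

end Geometry

/-! ## The two algorithms, run on data points `x 0, …, x (n - 1)` -/

section Algorithms

variable {E : Type*} [NormedAddCommGroup E] [InnerProductSpace ℝ E] {n : ℕ}

open Classical in
/-- The indices of the data points within distance `r` of `x i`. -/
noncomputable def neighbors (x : Fin n → E) (r : ℝ) (i : Fin n) : Finset (Fin n) :=
  {j | ‖x i - x j‖ ≤ r}

/-- The mean of the data points indexed by `J`. -/
noncomputable def sampleMean (x : Fin n → E) (J : Finset (Fin n)) : E :=
  (J.card : ℝ)⁻¹ • ∑ j ∈ J, x j

/-- The sample covariance of the data points within distance `r` of `x i`, as an operator. Its norm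
is the spectral norm. -/
noncomputable def localCov (x : Fin n → E) (r : ℝ) (i : Fin n) : E →L[ℝ] E :=
  ((neighbors x r i).card : ℝ)⁻¹ • ∑ j ∈ neighbors x r i,
    InnerProductSpace.rankOne ℝ (x j - sampleMean x (neighbors x r i))
      (x j - sampleMean x (neighbors x r i))

/-- Comparing covariances: the graph joining points within distance `ε` whose local covariances are
within `η * r ^ 2`. -/
def covGraph (x : Fin n → E) (r ε η : ℝ) : SimpleGraph (Fin n) where
  Adj i j := i ≠ j ∧ ‖x i - x j‖ ≤ ε ∧ ‖localCov x r i - localCov x r j‖ ≤ η * r ^ 2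
  symm := ⟨fun i j h => ⟨h.1.symm, by rw [norm_sub_rev]; exact h.2.1,
    by rw [norm_sub_rev]; exact h.2.2⟩⟩
  loopless := ⟨fun _ h => h.1 rfl⟩

/-- The points that are not removed: those with no data point within distance `r` whose local
covariance is more than `η * r ^ 2` away. -/
def survivors (x : Fin n → E) (r η : ℝ) : Set (Fin n) :=
  {i | ¬ ∃ j, ‖x j - x i‖ ≤ r ∧ η * r ^ 2 < ‖localCov x r j - localCov x r i‖}

/-- `R` is the grouping returned by the algorithm comparing local covariances: the survivors are
grouped into the connected components of the graph restricted to them, and each removed point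
joins the group of a closest survivor (`p i` is `i` for a survivor, and otherwise a closest
survivor; ties may be broken in any way). -/
def IsCovOutput (x : Fin n → E) (r ε η : ℝ) (R : Setoid (Fin n)) : Prop :=
  ∃ p : Fin n → survivors x r η,
    (∀ i ∈ survivors x r η, (p i : Fin n) = i) ∧
    (∀ i ∉ survivors x r η, ∀ k ∈ survivors x r η, ‖x i - x (p i)‖ ≤ ‖x i - x k‖) ∧
    ∀ i j, R i j ↔ ((covGraph x r ε η).induce (survivors x r η)).Reachable (p i) (p j)

variable [FiniteDimensional ℝ E]

/-- The orthogonal projection onto the span of the eigenvectors of the local covariance at `x i`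
with eigenvalue exceeding `√η` times its spectral norm. -/
noncomputable def localProj (x : Fin n → E) (r η : ℝ) (i : Fin n) : E →L[ℝ] E :=
  (⨆ (β : ℝ) (_ : √η * ‖localCov x r i‖ < β),
    End.eigenspace (localCov x r i : E →ₗ[ℝ] E) β).starProjection

/-- Comparing projections: the graph joining points within distance `ε` whose local projections are
within `η` in spectral norm. -/
def projGraph (x : Fin n → E) (r ε η : ℝ) : SimpleGraph (Fin n) where
  Adj i j := i ≠ j ∧ ‖x i - x j‖ ≤ ε ∧ ‖localProj x r η i - localProj x r η j‖ ≤ η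
  symm := ⟨fun i j h => ⟨h.1.symm, by rw [norm_sub_rev]; exact h.2.1,
    by rw [norm_sub_rev]; exact h.2.2⟩⟩
  loopless := ⟨fun _ h => h.1 rfl⟩

/-- The grouping returned by the algorithm comparing local projections: the connected components. -/
def projOutput (x : Fin n → E) (r ε η : ℝ) : Setoid (Fin n) :=
  (projGraph x r ε η).reachableSetoid

/-- The number of groups of a grouping. -/
noncomputable def numGroups (R : Setoid (Fin n)) : ℕ := Nat.card (Quotient R)

/-- Two points from different clusters (`s i` is the surface point behind the data point `x i`) are
not grouped together unless one of them is within distance `δ` of the intersection. -/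
def SeparatesClusters (S₁ S₂ : Set E) (s x : Fin n → E) (δ : ℝ) (R : Setoid (Fin n)) : Prop :=
  ∀ i j, s i ∈ S₁ → s j ∈ S₂ → R i j →
    Metric.infDist (x i) (S₁ ∩ S₂) ≤ δ ∨ Metric.infDist (x j) (S₁ ∩ S₂) ≤ δ

end Algorithms

/-! ## The sampling model -/

/-- The data points are `s i + z i`, where the pairs `(s i, z i)` are independent, `s i` is uniform
on `S₁ ∪ S₂` (for the `d`-dimensional Hausdorff measure), and the noise satisfies `‖z i‖ ≤ τ`. -/
structure IsNoisySample {D n : ℕ} {Ω : Type*} [MeasurableSpace Ω] (P : Measure Ω) (d : ℕ)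
    (S₁ S₂ : Set (EuclideanSpace ℝ (Fin D))) (τ : ℝ)
    (s z : Fin n → Ω → EuclideanSpace ℝ (Fin D)) : Prop where
  measurable_surface : ∀ i, Measurable (s i)
  measurable_noise : ∀ i, Measurable (z i)
  indep : iIndepFun (fun i ω => (s i ω, z i ω)) P
  uniform : ∀ i, P.map (s i) = ProbabilityTheory.cond (Measure.hausdorffMeasure (d : ℝ)) (S₁ ∪ S₂)
  noise_le : ∀ i, ∀ᵐ ω ∂P, ‖z i ω‖ ≤ τ

/-!
The two surfaces, their tangent spaces and the reach of the intersection enter only through one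
quantitative picture, `Crossing`: both surfaces leave their tangent spaces quadratically and project
onto neighbourhoods in them (`IsClosedSurface.exists_hasUniformTangents`), away from the
intersection they separate at least linearly (`exists_infDist_inter_le`, from positive reach and the
hypothesis on tangent cones), and at a common point each tangent space has a unit vector at distance
at least `K⁻¹` from the other. Linear separation is a compactness argument: if it failed, a limit of
directions from the intersection would be tangent to both surfaces, hence to the intersection, while
positive reach makes it normal to the intersection (Federer's `le_dist_of_reach`).

Probability enters only through `RegularSample`: the sample is dense at scale `r`, and the second
moments `∑ (α + ⟪x j - p, u⟫) ^ 2` of the neighbours of each data point that come from one surface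
agree, up to one common factor and a relative error `O(η)`, with those of a flat disc in the tangent
space (`discMoment`). For surfaces these are exact up to `O(r)` (`exists_population_bounds`), and
empirical moments concentrate by Bernstein's inequality with deviation `η`, applied to finitely many
test functions around the points of a net of mesh `O(η * r)` (`Crossing.exists_regularSample`). This
costs a factor polynomial in `1 / (η * r)`, which is absorbed by the factor `n` and the constant in
the exponent (`net_card_mul_exp_le`).

The rest is deterministic and takes place at scale `r = 1`. A data point whose neighbours all come
from one surface has local covariance within `O(η)` of `c • P`, with `P` the projection to the
tangent space (`RegularSample.norm_localCov_sub_le`). The main point is `exists_mixed_bound`: a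
point which has neighbours from both surfaces also has a neighbour whose covariance differs from its
own by a constant, so the algorithm comparing covariances removes it. This rests on an explicit
comparison of two positions (`RegularSample.gap`): a point at position `a` in one tangent space, at
least `t` away from the other, and a point at the projection of `a` to the other. In a direction `v`
normal to the first space, the variance at the second point is larger, since it sees a larger disc
of the second surface and the weights of the two surfaces are better balanced (`variance_gap`).

Hence the surviving points are unmixed. Survivors on the same surface within distance `ε` are
adjacent, as the tangent space turns by at most `O(κ * ε)`, and they are `O(r)`-dense in the surface
(near the intersection this uses the points obtained by moving transversally to the other surface),
so by connectedness they form one group. Survivors on different surfaces within distance `ε` are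
near a crossing point, and the angle there forces their covariances apart. For the algorithm
comparing projections, the leading eigenspace always contains nearly the tangent space and is
`d`-dimensional at unmixed points; adjacent points have leading eigenspaces of the same dimension,
and two `d`-dimensional ones at nearby points of different surfaces cannot be close. So a group
containing an unmixed point never leaves its surface. All points far from the intersection are
unmixed, which gives both separation statements.
-/

/-! ### Orthogonal projections and spectral subspaces -/

section Projections

variable {E : Type*} [NormedAddCommGroup E] [InnerProductSpace ℝ E] [FiniteDimensional ℝ E]

theorem norm_sub_starProjection_le (T : Submodule ℝ E) (x : E) {w : E} (hw : w ∈ T) :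
    ‖x - T.starProjection x‖ ≤ ‖x - w‖ := by
  rw [T.starProjection_minimal x]
  exact ciInf_le ⟨0, fun _ ⟨_, h⟩ => h ▸ norm_nonneg _⟩ (⟨w, hw⟩ : T)

theorem norm_sub_starProjection_le_norm (T : Submodule ℝ E) (x : E) :
    ‖x - T.starProjection x‖ ≤ ‖x‖ := by
  simpa using norm_sub_starProjection_le T x T.zero_mem

theorem norm_sq_eq_norm_sq_starProjection_add (T : Submodule ℝ E) (x : E) :
    ‖x‖ ^ 2 = ‖T.starProjection x‖ ^ 2 + ‖x - T.starProjection x‖ ^ 2 := by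
  have h : ⟪T.starProjection x, x - T.starProjection x⟫ = 0 := by
    rw [real_inner_comm]
    exact T.starProjection_inner_eq_zero _ _ (T.starProjection_apply_mem x)
  have := norm_add_sq_real (T.starProjection x) (x - T.starProjection x)
  rw [h, add_sub_cancel] at this
  linarith

theorem inner_starProjection_of_mem {T : Submodule ℝ E} (x : E) {w : E} (hw : w ∈ T) :
    ⟪T.starProjection x, w⟫ = ⟪x, w⟫ := by
  have := T.starProjection_inner_eq_zero x w hw
  rw [inner_sub_left] at this
  linarith

theorem inner_starProjection_self (T : Submodule ℝ E) (x : E) :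
    ⟪T.starProjection x, x⟫ = ‖T.starProjection x‖ ^ 2 := by
  rw [real_inner_comm, ← inner_starProjection_of_mem x (T.starProjection_apply_mem x),
    real_inner_self_eq_norm_sq]

theorem starProjection_of_mem {T : Submodule ℝ E} {x : E} (hx : x ∈ T) :
    T.starProjection x = x :=
  Submodule.starProjection_eq_self_iff.2 hx

/-- Two subspaces each of which is `ε`-close to the other have `2ε`-close projections: split
`P - P'` as `(1 - P') P - P' (1 - P)` and note that `P' (1 - P)` is the adjoint of
`(1 - P) P'`. -/
theorem norm_starProjection_sub_starProjection_le {U V : Submodule ℝ E} {ε : ℝ} (hε : 0 ≤ ε)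
    (hU : ∀ v ∈ U, ‖v - V.starProjection v‖ ≤ ε * ‖v‖)
    (hV : ∀ v ∈ V, ‖v - U.starProjection v‖ ≤ ε * ‖v‖) :
    ‖U.starProjection - V.starProjection‖ ≤ 2 * ε := by
  refine ContinuousLinearMap.opNorm_le_bound _ (by positivity) fun x => ?_
  have h1 : ‖U.starProjection x - V.starProjection (U.starProjection x)‖ ≤ ε * ‖x‖ :=
    (hU _ (U.starProjection_apply_mem x)).trans
      (mul_le_mul_of_nonneg_left (U.norm_starProjection_apply_le x) hε)
  have h2 : ‖V.starProjection (x - U.starProjection x)‖ ≤ ε * ‖x‖ := by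
    set y := V.starProjection (x - U.starProjection x) with hy
    have hyV : y ∈ V := V.starProjection_apply_mem _
    have e1 : ‖y‖ ^ 2 = ⟪x - U.starProjection x, y - U.starProjection y⟫ := by
      rw [inner_sub_right, U.starProjection_inner_eq_zero _ _ (U.starProjection_apply_mem y),
        sub_zero, ← inner_starProjection_of_mem _ hyV, ← hy, real_inner_self_eq_norm_sq]
    have e2 : ‖y‖ ^ 2 ≤ ‖x‖ * (ε * ‖y‖) := by
      rw [e1]
      exact (real_inner_le_norm _ _).trans (mul_le_mul (norm_sub_starProjection_le_norm U x)
        (hV y hyV) (norm_nonneg _) (norm_nonneg _))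
    rcases (norm_nonneg y).eq_or_lt with h0 | h0
    · rw [← h0]; positivity
    · nlinarith
  have : (U.starProjection - V.starProjection) x =
      (U.starProjection x - V.starProjection (U.starProjection x)) -
        V.starProjection (x - U.starProjection x) := by
    simp [map_sub]
  rw [this]
  linarith [norm_sub_le (U.starProjection x - V.starProjection (U.starProjection x))
    (V.starProjection (x - U.starProjection x))]

theorem exists_unit_mem_starProjection_eq_zero {U V : Submodule ℝ E}
    (h : finrank ℝ V < finrank ℝ U) : ∃ x ∈ U, ‖x‖ = 1 ∧ V.starProjection x = 0 := by
  obtain ⟨x, hx, hx0⟩ : ∃ x : U, V.orthogonalProjectionOnto (x : E) = 0 ∧ x ≠ 0 := by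
    by_contra! hcon
    have hinj : Function.Injective ((V.orthogonalProjectionOnto : E →ₗ[ℝ] V) ∘ₗ U.subtype) := by
      rw [← LinearMap.ker_eq_bot, LinearMap.ker_eq_bot']
      exact fun m hm => hcon m hm
    exact absurd (LinearMap.finrank_le_finrank_of_injective hinj) (not_le.2 h)
  have hx0' : ‖(x : E)‖ ≠ 0 := by simpa using hx0
  refine ⟨‖(x : E)‖⁻¹ • (x : E), U.smul_mem _ x.2, ?_, ?_⟩
  · rw [norm_smul, norm_inv, norm_norm, inv_mul_cancel₀ hx0']
  · rw [map_smul, Submodule.starProjection_apply, hx]; simp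

theorem finrank_le_of_norm_starProjection_sub_lt {U V : Submodule ℝ E}
    (h : ‖U.starProjection - V.starProjection‖ < 1) : finrank ℝ U ≤ finrank ℝ V := by
  by_contra! hlt
  obtain ⟨x, hxU, hx1, hxV⟩ := exists_unit_mem_starProjection_eq_zero hlt
  have := (U.starProjection - V.starProjection).le_opNorm x
  rw [sub_apply, hxV, sub_zero, starProjection_of_mem hxU, hx1, mul_one] at this
  linarith

theorem finrank_eq_of_norm_starProjection_sub_lt {U V : Submodule ℝ E}
    (h : ‖U.starProjection - V.starProjection‖ < 1) : finrank ℝ U = finrank ℝ V :=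
  (finrank_le_of_norm_starProjection_sub_lt h).antisymm
    (finrank_le_of_norm_starProjection_sub_lt (by rwa [norm_sub_rev]))

theorem norm_le_of_abs_inner_self_le {A : E →L[ℝ] E} (hA : (A : E →ₗ[ℝ] E).IsSymmetric) {ε : ℝ}
    (h : ∀ u, ‖u‖ = 1 → |⟪A u, u⟫| ≤ ε) (hε : 0 ≤ ε) : ‖A‖ ≤ ε := by
  rw [A.norm_eq_iSup_rayleighQuotient hA]
  refine ciSup_le fun x => ?_
  rcases eq_or_ne x 0 with rfl | hx
  · simpa using hε
  have hx' : ‖x‖ ≠ 0 := by simpa using hx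
  have := h (‖x‖⁻¹ • x) (by rw [norm_smul, norm_inv, norm_norm, inv_mul_cancel₀ hx'])
  rw [map_smul, inner_smul_left, inner_smul_right] at this
  rw [ContinuousLinearMap.rayleighQuotient, ContinuousLinearMap.reApplyInnerSelf_apply]
  have e : RCLike.re ⟪A x, x⟫ / ‖x‖ ^ 2 = (starRingEnd ℝ) ‖x‖⁻¹ * (‖x‖⁻¹ * ⟪A x, x⟫) := by
    simp only [conj_trivial, RCLike.re_to_real]
    field_simp
  rw [e]
  exact this

/-- The span of the eigenvectors of `A` with eigenvalue exceeding `t`. The projection to it is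
`localProj`, when `A` is a local covariance and `t` is the threshold of the algorithm. -/
noncomputable def spectralSubspace (A : E →L[ℝ] E) (t : ℝ) : Submodule ℝ E :=
  ⨆ (β : ℝ) (_ : t < β), End.eigenspace (A : E →ₗ[ℝ] E) β

theorem inner_self_le_of_starProjection_spectralSubspace_eq_zero {A : E →L[ℝ] E}
    (hA : (A : E →ₗ[ℝ] E).IsSymmetric) {t : ℝ} {x : E}
    (hx : (spectralSubspace A t).starProjection x = 0) : ⟪A x, x⟫ ≤ t * ‖x‖ ^ 2 := by
  have hx' : x ∈ (spectralSubspace A t)ᗮ := by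
    rwa [Submodule.starProjection_apply_eq_zero_iff] at hx
  set b := hA.eigenvectorBasis rfl
  have hval : ∀ i, A (b i) = hA.eigenvalues rfl i • b i :=
    fun i => hA.apply_eigenvectorBasis rfl i
  have e1 : ⟪A x, x⟫ = ∑ i, hA.eigenvalues rfl i * ⟪b i, x⟫ ^ 2 := by
    rw [← b.sum_inner_mul_inner (A x) x]
    refine Finset.sum_congr rfl fun i _ => ?_
    have : ⟪A x, b i⟫ = ⟪x, A (b i)⟫ := hA x (b i)
    rw [this, hval, inner_smul_right, real_inner_comm x]
    ring
  rw [e1, ← b.sum_sq_inner_right x, Finset.mul_sum]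
  refine Finset.sum_le_sum fun i _ => ?_
  rcases le_or_gt (hA.eigenvalues rfl i) t with h | h
  · exact mul_le_mul_of_nonneg_right h (sq_nonneg _)
  · have hb : b i ∈ spectralSubspace A t :=
      (le_iSup₂ (f := fun (β : ℝ) (_ : t < β) => End.eigenspace (A : E →ₗ[ℝ] E) β) _ h)
        (End.mem_eigenspace_iff.2 (hval i))
    have : ⟪b i, x⟫ = 0 := hx' _ hb
    simp [this]

theorem le_inner_self_of_mem_spectralSubspace {A : E →L[ℝ] E}
    (hA : (A : E →ₗ[ℝ] E).IsSymmetric) {t : ℝ} {x : E}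
    (hx : x ∈ spectralSubspace A t) : t * ‖x‖ ^ 2 ≤ ⟪A x, x⟫ := by
  set b := hA.eigenvectorBasis rfl
  have hval : ∀ i, A (b i) = hA.eigenvalues rfl i • b i :=
    fun i => hA.apply_eigenvectorBasis rfl i
  have e1 : ⟪A x, x⟫ = ∑ i, hA.eigenvalues rfl i * ⟪b i, x⟫ ^ 2 := by
    rw [← b.sum_inner_mul_inner (A x) x]
    refine Finset.sum_congr rfl fun i _ => ?_
    have : ⟪A x, b i⟫ = ⟪x, A (b i)⟫ := hA x (b i)
    rw [this, hval, inner_smul_right, real_inner_comm x]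
    ring
  rw [e1, ← b.sum_sq_inner_right x, Finset.mul_sum]
  refine Finset.sum_le_sum fun i _ => ?_
  rcases lt_or_ge t (hA.eigenvalues rfl i) with h | h
  · exact mul_le_mul_of_nonneg_right h.le (sq_nonneg _)
  · have hle : spectralSubspace A t ≤ (ℝ ∙ b i)ᗮ := by
      refine iSup₂_le fun β hβ y hy => ?_
      rw [Submodule.mem_orthogonal_singleton_iff_inner_right]
      have hy' : A y = β • y := End.mem_eigenspace_iff.1 hy
      have : ⟪A (b i), y⟫ = ⟪b i, A y⟫ := hA (b i) y
      rw [hval, hy', inner_smul_left, inner_smul_right] at this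
      have h3 : (β - hA.eigenvalues rfl i) * ⟪b i, y⟫ = 0 := by
        simp only [conj_trivial] at this
        linarith
      rcases mul_eq_zero.1 h3 with h4 | h4
      · linarith
      · exact h4
    have : ⟪b i, x⟫ = 0 := (Submodule.mem_orthogonal_singleton_iff_inner_right).1 (hle hx)
    simp [this]

end Projections

/-! ### Uniform second-order control of a compact surface -/

section UniformTangents

open Set Filter Metric Topology

section General

variable {E : Type*} [NormedAddCommGroup E] [InnerProductSpace ℝ E] [FiniteDimensional ℝ E]

/-- A compact set `S` with a field of `d`-dimensional subspaces `T` that is tangent to it, with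
one constant `K` for all the bounds: `S` leaves `s + T s` at most quadratically, `T` is
Lipschitz, and near `s` the set `S` projects onto a neighbourhood of `s` in `s + T s` whose size is
at least `K⁻¹`. The first two bounds hold for all pairs of points, which costs nothing since they
are trivial at distances bounded below. -/
structure HasUniformTangents (d : ℕ) (S : Set E) (T : E → Submodule ℝ E) (K : ℝ) : Prop where
  isCompact : IsCompact S
  nonempty : S.Nonempty
  one_le : 1 ≤ K
  finrank_eq : ∀ s ∈ S, finrank ℝ (T s) = d
  near : ∀ s ∈ S, ∀ y ∈ S, ‖(y - s) - (T s).starProjection (y - s)‖ ≤ K * ‖y - s‖ ^ 2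
  lipschitz : ∀ s ∈ S, ∀ y ∈ S,
    ‖(T s).starProjection - (T y).starProjection‖ ≤ K * ‖s - y‖
  lift : ∀ s ∈ S, ∀ w ∈ T s, K * ‖w‖ ≤ 1 →
    ∃ y ∈ S, (T s).starProjection (y - s) = w ∧ ‖y - s‖ ≤ 2 * ‖w‖

theorem HasUniformTangents.mono {d : ℕ} {S : Set E} {T : E → Submodule ℝ E} {K K' : ℝ}
    (h : HasUniformTangents d S T K) (hK : K ≤ K') : HasUniformTangents d S T K' where
  isCompact := h.isCompact
  nonempty := h.nonempty
  one_le := h.one_le.trans hK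
  finrank_eq := h.finrank_eq
  near s hs y hy := (h.near s hs y hy).trans (by gcongr)
  lipschitz s hs y hy := (h.lipschitz s hs y hy).trans (by gcongr)
  lift s hs w hw hKw := h.lift s hs w hw ((by gcongr : K * ‖w‖ ≤ K' * ‖w‖).trans hKw)

/-- A set that leaves `s + T` at most quadratically has its tangent cone at `s` inside `T`. -/
theorem mem_of_mem_posTangentConeAt {S : Set E} {s : E} {T : Submodule ℝ E} {K : ℝ}
    (hnear : ∀ᶠ h in 𝓝 (0 : E), s + h ∈ S → ‖h - T.starProjection h‖ ≤ K * ‖h‖ ^ 2)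
    {u : E} (hu : u ∈ posTangentConeAt S s) : u ∈ T := by
  obtain ⟨α, l, hl, c, h, h0, hS, hc⟩ := exists_fun_of_mem_tangentConeAt hu
  have e1 : Tendsto (fun n => ‖c n • h n - T.starProjection (c n • h n)‖) l
      (𝓝 ‖u - T.starProjection u‖) :=
    (hc.sub ((T.starProjection.continuous.tendsto _).comp hc)).norm
  have e2 : Tendsto (fun n => K * (‖c n • h n‖ * ‖h n‖)) l (𝓝 (K * (‖u‖ * ‖(0 : E)‖))) :=
    (hc.norm.mul h0.norm).const_mul K
  have e3 : ‖u - T.starProjection u‖ ≤ K * (‖u‖ * ‖(0 : E)‖) := by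
    refine le_of_tendsto_of_tendsto e1 e2 ?_
    filter_upwards [hS, h0.eventually hnear] with n hn hn2
    have := hn2 hn
    have hcn : T.starProjection (c n • h n) = c n • T.starProjection (h n) := by
      rw [NNReal.smul_def, map_smul]; rfl
    rw [hcn, ← smul_sub, NNReal.smul_def, NNReal.smul_def, norm_smul, norm_smul]
    calc ‖(c n : ℝ)‖ * ‖h n - T.starProjection (h n)‖ ≤ ‖(c n : ℝ)‖ * (K * ‖h n‖ ^ 2) := by gcongr
      _ = _ := by ring
  rw [norm_zero, mul_zero, mul_zero] at e3
  have : u - T.starProjection u = 0 := norm_le_zero_iff.1 e3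
  rw [sub_eq_zero.1 this]
  exact T.starProjection_apply_mem u

/-- Velocities of a parametrization into `S` are tangent to `S`. -/
theorem HasStrictFDerivAt.mem_posTangentConeAt {S : Set E} {L : Submodule ℝ E} {f : L → E}
    {A : L →L[ℝ] E} (hf : HasStrictFDerivAt f A 0) (hS : ∀ᶠ l in 𝓝 0, f l ∈ S) (l : L) :
    A l ∈ posTangentConeAt S (f 0) := by
  have hcurve : HasDerivAt (fun t : ℝ => f (t • l)) (A l) 0 := by
    have h1 : HasDerivAt (fun t : ℝ => t • l) l 0 := by simpa using (hasDerivAt_id (0 : ℝ)).smul_const l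
    have h2 : HasFDerivAt f A ((0 : ℝ) • l) := by simpa using hf.hasFDerivAt
    exact h2.comp_hasDerivAt (0 : ℝ) h1
  have ht : Tendsto (fun t : ℝ => t • l) (𝓝[>] 0) (𝓝 0) := by
    have : Tendsto (fun t : ℝ => t • l) (𝓝 0) (𝓝 ((0 : ℝ) • l)) :=
      (continuous_id.smul continuous_const).tendsto 0
    rw [zero_smul] at this
    exact this.mono_left nhdsWithin_le_nhds
  refine mem_tangentConeAt_of_seq (𝓝[>] (0 : ℝ)) (fun t => t⁻¹.toNNReal)
    (fun t => f (t • l) - f 0) ?_ ?_ ?_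
  · have := ((hf.hasFDerivAt.continuousAt.tendsto).comp ht).sub_const (f 0)
    simpa using this
  · filter_upwards [ht.eventually hS] with t h
    simpa using h
  · have := hcurve.tendsto_slope_zero_right
    refine this.congr' ?_
    filter_upwards [self_mem_nhdsWithin] with t h
    have h' : (0 : ℝ) ≤ t⁻¹ := inv_nonneg.2 (le_of_lt h)
    rw [NNReal.smul_def, Real.coe_toNNReal _ h', zero_add, zero_smul]

end General

section Flattening

variable {D d : ℕ} {S : Set (EuclideanSpace ℝ (Fin D))}

/-- Reading the flattening diffeomorphism around a point of a surface: near the point all the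
second-order bounds hold with one constant, and every nearby point of the surface is the centre of
a strictly differentiable parametrization whose derivative maps onto the tangent subspace. -/
theorem IsClosedSurface.exists_local_bounds (hS : IsClosedSurface d S)
    {s₀ : EuclideanSpace ℝ (Fin D)} (hs₀ : s₀ ∈ S) :
    ∃ U, IsOpen U ∧ s₀ ∈ U ∧ ∃ K : ℝ, 0 ≤ K ∧ ∀ s ∈ S, s ∈ U →
      finrank ℝ (tangentSubspace S s) = d ∧
      (∀ y ∈ S, y ∈ U →
        ‖(y - s) - (tangentSubspace S s).starProjection (y - s)‖ ≤ K * ‖y - s‖ ^ 2) ∧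
      (∀ y ∈ S, y ∈ U → ∀ v ∈ tangentSubspace S s,
        ‖v - (tangentSubspace S y).starProjection v‖ ≤ K * ‖s - y‖ * ‖v‖) ∧
      ∃ (L : Submodule ℝ (EuclideanSpace ℝ (Fin D))) (f : L → EuclideanSpace ℝ (Fin D))
        (A : L →L[ℝ] EuclideanSpace ℝ (Fin D)), f 0 = s ∧ HasStrictFDerivAt f A 0 ∧
        (∀ᶠ l in 𝓝 0, f l ∈ S) ∧ A.range = tangentSubspace S s := by
  obtain ⟨φ, L, hs₀φ, hφ, hψ, hL, hmem⟩ := hS.exists_flattening s₀ hs₀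
  have hφat : ∀ s ∈ φ.source, ContDiffAt ℝ 2 φ s := fun s hs =>
    hφ.contDiffAt (φ.open_source.mem_nhds hs)
  have hψat : ∀ a ∈ φ.target, ContDiffAt ℝ 2 φ.symm a := fun a ha =>
    hψ.contDiffAt (φ.open_target.mem_nhds ha)
  have ha₀ : φ s₀ ∈ φ.target := φ.map_source hs₀φ
  -- the derivative of the inverse flattening is Lipschitz near `φ s₀`, the flattening near `s₀`
  obtain ⟨K₁, t₁, ht₁, hK₁⟩ := ContDiffAt.exists_lipschitzOnWith
    ((hψat _ ha₀).fderiv_right (m := 1) (by norm_num))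
  obtain ⟨K₂, t₂, ht₂, hK₂⟩ := ContDiffAt.exists_lipschitzOnWith
    ((hφat _ hs₀φ).of_le (by norm_num : (1 : WithTop ℕ∞) ≤ 2))
  obtain ⟨ϱ, hϱ, hball⟩ := Metric.mem_nhds_iff.1 (inter_mem ht₁ (φ.open_target.mem_nhds ha₀))
  obtain ⟨U₂, hU₂sub, hU₂, hs₀U₂⟩ := _root_.mem_nhds_iff.1 ht₂
  set U := (φ.source ∩ φ ⁻¹' ball (φ s₀) ϱ) ∩ U₂ with hU
  have hUo : IsOpen U := (φ.isOpen_inter_preimage isOpen_ball).inter hU₂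
  have hs₀U : s₀ ∈ U := by
    rw [hU]
    exact ⟨⟨hs₀φ, by simpa using hϱ⟩, hs₀U₂⟩
  set B := fun a => fderiv ℝ φ.symm a with hB
  have hψd : ∀ a ∈ φ.target, HasStrictFDerivAt φ.symm (B a) a := fun a ha =>
    (hψat a ha).hasStrictFDerivAt (by norm_num)
  have hφd : ∀ s ∈ φ.source, HasStrictFDerivAt φ (fderiv ℝ φ s) s := fun s hs =>
    (hφat s hs).hasStrictFDerivAt (by norm_num)
  have hφB : ∀ s ∈ φ.source, ∀ l, fderiv ℝ φ s (B (φ s) l) = l := by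
    intro s hs l
    have h1 : HasFDerivAt φ (fderiv ℝ φ s) (φ.symm (φ s)) := by
      rw [φ.left_inv hs]; exact (hφd s hs).hasFDerivAt
    have h2 := h1.comp (φ s) (hψd _ (φ.map_source hs)).hasFDerivAt
    have h3 : HasFDerivAt (φ ∘ φ.symm) (ContinuousLinearMap.id ℝ _) (φ s) := by
      refine (hasFDerivAt_id (φ s)).congr_of_eventuallyEq ?_
      filter_upwards [φ.open_target.mem_nhds (φ.map_source hs)] with a ha
      exact φ.right_inv ha
    exact congrArg (fun A => A l) (h2.unique h3)
  have hφbd : ∀ s ∈ U, ∀ v, ‖fderiv ℝ φ s v‖ ≤ K₂ * ‖v‖ := fun s hs v => by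
    have := norm_fderiv_le_of_lipschitzOn ℝ (hU₂.mem_nhds hs.2) (hK₂.mono hU₂sub)
    exact ((fderiv ℝ φ s).le_opNorm v).trans (by gcongr)
  -- first-order expansion of the inverse flattening
  have hexp : ∀ s ∈ U, ∀ y ∈ U,
      ‖(y - s) - B (φ s) (φ y - φ s)‖ ≤ K₁ * K₂ ^ 2 * ‖y - s‖ ^ 2 := by
    intro s hs y hy
    have hK₂' : ‖φ y - φ s‖ ≤ K₂ * ‖y - s‖ := by
      have := hK₂.dist_le_mul y (hU₂sub hy.2) s (hU₂sub hs.2)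
      rwa [dist_eq_norm, dist_eq_norm] at this
    have key := Convex.norm_image_sub_le_of_norm_hasFDerivWithin_le' (f := φ.symm) (f' := B)
      (φ := B (φ s)) (C := K₁ * ‖φ y - φ s‖) (x := φ s) (y := φ y)
      (s := ball (φ s₀) ϱ ∩ closedBall (φ s) ‖φ y - φ s‖)
      (fun a ha => (hψd a (hball ha.1).2).hasFDerivAt.hasFDerivWithinAt)
      (fun a ha => by
        have := hK₁.dist_le_mul a (hball ha.1).1 (φ s) (hball hs.1.2).1
        rw [dist_eq_norm] at this
        exact this.trans (mul_le_mul_of_nonneg_left ha.2 (by positivity)))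
      ((convex_ball _ _).inter (convex_closedBall _ _))
      ⟨hs.1.2, mem_closedBall_self (norm_nonneg _)⟩
      ⟨hy.1.2, by simp [mem_closedBall, dist_eq_norm]⟩
    rw [φ.left_inv hy.1.1, φ.left_inv hs.1.1] at key
    calc _ ≤ K₁ * ‖φ y - φ s‖ * ‖φ y - φ s‖ := key
      _ ≤ K₁ * (K₂ * ‖y - s‖) * (K₂ * ‖y - s‖) := by gcongr
      _ = _ := by ring
  set T := fun s => L.map (B (φ s) : _ →ₗ[ℝ] EuclideanSpace ℝ (Fin D)) with hT
  have hnear : ∀ s ∈ S, s ∈ U → ∀ y ∈ S, y ∈ U →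
      ‖(y - s) - (T s).starProjection (y - s)‖ ≤ K₁ * K₂ ^ 2 * ‖y - s‖ ^ 2 := by
    intro s hsS hs y hyS hy
    refine (norm_sub_starProjection_le (T s) (y - s) (w := B (φ s) (φ y - φ s)) ?_).trans
      (hexp s hs y hy)
    exact Submodule.mem_map_of_mem (L.sub_mem ((hmem y hy.1.1).1 hyS) ((hmem s hs.1.1).1 hsS))
  -- the parametrization `l ↦ φ.symm (φ s + l)` of the surface by `L`
  have hparam : ∀ s ∈ S, s ∈ U → ∃ f : L → EuclideanSpace ℝ (Fin D), f 0 = s ∧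
      HasStrictFDerivAt f ((B (φ s)).comp L.subtypeL) 0 ∧ ∀ᶠ l in 𝓝 0, f l ∈ S := by
    intro s hsS hs
    refine ⟨fun l => φ.symm (φ s + (l : EuclideanSpace ℝ (Fin D))), ?_, ?_, ?_⟩
    · simp [φ.left_inv hs.1.1]
    · have h1 : HasStrictFDerivAt (fun l : L => φ s + (l : EuclideanSpace ℝ (Fin D)))
          L.subtypeL 0 := by
        simpa using (L.subtypeL.hasStrictFDerivAt (x := 0)).const_add (φ s)
      have h2 : HasStrictFDerivAt φ.symm (B (φ s))
          (φ s + ((0 : L) : EuclideanSpace ℝ (Fin D))) := by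
        simpa using hψd _ (φ.map_source hs.1.1)
      exact h2.comp (0 : L) h1
    · have hcont : ContinuousAt (fun l : L => φ s + (l : EuclideanSpace ℝ (Fin D))) 0 := by
        fun_prop
      have : φ.target ∈ 𝓝 (φ s + ((0 : L) : EuclideanSpace ℝ (Fin D))) := by
        simpa using φ.open_target.mem_nhds (φ.map_source hs.1.1)
      filter_upwards [hcont this] with l hl
      rw [hmem _ (φ.map_target hl), φ.right_inv hl]
      exact L.add_mem ((hmem s hs.1.1).1 hsS) l.2
  have hrange : ∀ s, ((B (φ s)).comp L.subtypeL).range = T s := by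
    intro s
    ext v
    simp [hT, Submodule.mem_map]
  -- the span of the tangent cone is the image of `L` under the derivative
  have htan : ∀ s ∈ S, s ∈ U → tangentSubspace S s = T s := by
    intro s hsS hs
    apply le_antisymm
    · refine Submodule.span_le.2 fun u hu => ?_
      refine mem_of_mem_posTangentConeAt (K := K₁ * K₂ ^ 2) ?_ hu
      have hc : ContinuousAt (fun h => s + h) 0 := by fun_prop
      have : U ∈ 𝓝 (s + 0) := by simpa using hUo.mem_nhds hs
      filter_upwards [hc this] with h hh hhS
      simpa using hnear s hsS hs (s + h) hhS hh
    · obtain ⟨f, hf0, hf, hfS⟩ := hparam s hsS hs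
      rw [← hrange]
      rintro _ ⟨l, rfl⟩
      have := hf.mem_posTangentConeAt hfS l
      rw [hf0] at this
      exact Submodule.subset_span this
  have hfin : ∀ s ∈ U, finrank ℝ (T s) = d := by
    intro s hs
    rw [← hL]
    have hinj : Function.Injective (B (φ s) : EuclideanSpace ℝ (Fin D) →ₗ[ℝ] EuclideanSpace ℝ (Fin D)) := by
      intro l l' h
      have h' : B (φ s) l = B (φ s) l' := h
      have h1 := hφB s hs.1.1 l
      rw [h', hφB s hs.1.1 l'] at h1
      exact h1.symm
    exact (Submodule.equivMapOfInjective _ hinj L).finrank_eq.symm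
  have hlip : ∀ s ∈ U, ∀ y ∈ U, ∀ v ∈ T s,
      ‖v - (T y).starProjection v‖ ≤ K₁ * K₂ ^ 2 * ‖s - y‖ * ‖v‖ := by
    intro s hs y hy v hv
    obtain ⟨l, hl, rfl⟩ := Submodule.mem_map.1 hv
    have hl' : ‖l‖ ≤ K₂ * ‖B (φ s) l‖ := by
      have := hφbd s hs (B (φ s) l)
      rwa [hφB s hs.1.1 l] at this
    have h1 : ‖B (φ s) - B (φ y)‖ ≤ K₁ * (K₂ * ‖s - y‖) := by
      have h1 := hK₁.dist_le_mul (φ s) (hball hs.1.2).1 (φ y) (hball hy.1.2).1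
      have h2 := hK₂.dist_le_mul s (hU₂sub hs.2) y (hU₂sub hy.2)
      rw [dist_eq_norm (fderiv ℝ φ.symm (φ s))] at h1
      rw [dist_eq_norm s] at h2
      exact h1.trans (mul_le_mul_of_nonneg_left h2 (by positivity))
    have h3 : ‖B (φ s) l - B (φ y) l‖ ≤ ‖B (φ s) - B (φ y)‖ * ‖l‖ :=
      (B (φ s) - B (φ y)).le_opNorm l
    have h4 : B (φ y) l ∈ T y := Submodule.mem_map.2 ⟨l, hl, rfl⟩
    refine (norm_sub_starProjection_le (T y) _ h4).trans (h3.trans ?_)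
    calc ‖B (φ s) - B (φ y)‖ * ‖l‖ ≤ K₁ * (K₂ * ‖s - y‖) * (K₂ * ‖B (φ s) l‖) := by gcongr
      _ = K₁ * K₂ ^ 2 * ‖s - y‖ * ‖B (φ s) l‖ := by ring
  refine ⟨U, hUo, hs₀U, K₁ * K₂ ^ 2, mul_nonneg K₁.2 (pow_nonneg K₂.2 2), ?_⟩
  intro s hsS hs
  rw [htan s hsS hs]
  refine ⟨hfin s hs, fun y hyS hy => hnear s hsS hs y hyS hy, fun y hyS hy v hv => ?_, ?_⟩
  · rw [htan y hyS hy]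
    exact hlip s hs y hy v hv
  · obtain ⟨f, hf0, hf, hfS⟩ := hparam s hsS hs
    exact ⟨L, f, (B (φ s)).comp L.subtypeL, hf0, hf, hfS, hrange s⟩

end Flattening
end UniformTangents

section UniformTangentsExist

open Set Filter Metric Topology

variable {E : Type*} [NormedAddCommGroup E] [InnerProductSpace ℝ E] [FiniteDimensional ℝ E]

/-- Near `s` the set `S` projects onto a neighbourhood of `s` in `s + T s`: the part of a small ball
covered by the projection is closed by compactness, open by the inverse function theorem, and
balls are connected. -/
theorem exists_mem_starProjection_sub_eq {S : Set E} (hS : IsCompact S) {T : E → Submodule ℝ E}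
    {K : ℝ} (hK : 1 ≤ K) {s : E} (hs : s ∈ S)
    (hfin : ∀ y ∈ S, finrank ℝ (T s) = finrank ℝ (T y))
    (hnear : ∀ y ∈ S, ‖(y - s) - (T s).starProjection (y - s)‖ ≤ K * ‖y - s‖ ^ 2)
    (hlip : ∀ y ∈ S, ‖(T s).starProjection - (T y).starProjection‖ ≤ K * ‖s - y‖)
    (hparam : ∀ y ∈ S, ∃ (L : Submodule ℝ E) (f : L → E) (A : L →L[ℝ] E),
      f 0 = y ∧ HasStrictFDerivAt f A 0 ∧ (∀ᶠ l in 𝓝 0, f l ∈ S) ∧ A.range = T y)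
    {w : E} (hw : w ∈ T s) (hKw : 8 * K * ‖w‖ ≤ 1) :
    ∃ y ∈ S, (T s).starProjection (y - s) = w ∧ ‖y - s‖ ≤ 2 * ‖w‖ := by
  set ϱ : ℝ := 1 / (4 * K) with hϱ
  have hK0 : 0 < K := by linarith
  have hϱ0 : 0 < ϱ := by positivity
  have hKϱ : K * ϱ = 1 / 4 := by rw [hϱ]; field_simp
  set g : E → T s := fun y => (T s).orthogonalProjectionOnto (y - s) with hg
  have hgc : Continuous g := by fun_prop
  have hgn : ∀ y, ‖g y‖ = ‖(T s).starProjection (y - s)‖ := fun y => rfl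
  -- a point of `S` in the larger ball is controlled by its projection
  have hcontrol : ∀ y ∈ S, ‖y - s‖ ≤ 2 * ϱ → ‖y - s‖ ≤ 2 * ‖g y‖ := by
    intro y hy hys
    have h1 := hnear y hy
    have h2 : ‖y - s‖ ≤ ‖g y‖ + ‖(y - s) - (T s).starProjection (y - s)‖ := by
      rw [hgn]
      simpa using norm_add_le ((T s).starProjection (y - s))
        ((y - s) - (T s).starProjection (y - s))
    have h3 : K * ‖y - s‖ ^ 2 ≤ 1 / 2 * ‖y - s‖ := by
      have : K * ‖y - s‖ ≤ 1 / 2 := by nlinarith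
      nlinarith [norm_nonneg (y - s)]
    linarith
  set M : Set (T s) := g '' (S ∩ closedBall s (2 * ϱ)) with hM
  have hMc : IsClosed M := ((hS.inter_right isClosed_closedBall).image hgc).isClosed
  set u : Set (T s) := ball 0 ϱ ∩ M with hu
  -- near a point of `S` the projection, restricted to `S`, is open: its derivative maps the tangent
  -- space there onto `T s`, the two spaces being close and of the same dimension
  have huo : IsOpen u := by
    rw [isOpen_iff_mem_nhds]
    rintro _ ⟨hwϱ, y, ⟨hyS, hyb⟩, rfl⟩
    rw [mem_closedBall, dist_eq_norm] at hyb
    have hgϱ : ‖g y‖ < ϱ := by simpa using hwϱ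
    have hlt : ‖y - s‖ < 2 * ϱ := (hcontrol y hyS hyb).trans_lt (by linarith)
    obtain ⟨L, f, A, hf0, hf, hfS, hA⟩ := hparam y hyS
    have hd : HasStrictFDerivAt (fun l => g (f l))
        ((T s).orthogonalProjectionOnto.comp A) 0 :=
      ((T s).orthogonalProjectionOnto.hasStrictFDerivAt).comp (0 : L) (hf.sub_const s)
    have hsurj : ((T s).orthogonalProjectionOnto.comp A).range = ⊤ := by
      have hinj : Function.Injective
          ((T s).orthogonalProjectionOnto.toLinearMap ∘ₗ (T y).subtype) := by
        rw [← LinearMap.ker_eq_bot, LinearMap.ker_eq_bot']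
        intro m hm
        have hm' : (T s).starProjection (m : E) = 0 := by
          rw [Submodule.starProjection_apply]
          exact congrArg Subtype.val hm
        have h1 := ((T s).starProjection - (T y).starProjection).le_opNorm (m : E)
        rw [sub_apply, hm', starProjection_of_mem m.2, zero_sub, norm_neg] at h1
        have h2 : ‖(T s).starProjection - (T y).starProjection‖ ≤ 1 / 2 := by
          refine (hlip y hyS).trans ?_
          rw [norm_sub_rev]
          nlinarith
        have h3 : ‖(m : E)‖ = 0 := by nlinarith [norm_nonneg (m : E)]
        simpa using h3
      have hs2 := (LinearMap.injective_iff_surjective_of_finrank_eq_finrank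
        (hfin y hyS).symm).1 hinj
      rw [LinearMap.range_eq_top]
      intro v
      obtain ⟨m, hm⟩ := hs2 v
      obtain ⟨l, hl⟩ : (m : E) ∈ A.range := by rw [hA]; exact m.2
      exact ⟨l, by rw [← hm]; exact congrArg (T s).orthogonalProjectionOnto hl⟩
    have hmap := hd.map_nhds_eq_of_surj hsurj
    rw [hf0] at hmap
    have hnb : ∀ᶠ l in 𝓝 (0 : L), f l ∈ S ∧ ‖f l - s‖ ≤ 2 * ϱ := by
      refine hfS.and ?_
      have hc : ContinuousAt (fun l => ‖f l - s‖) 0 :=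
        (hf.hasFDerivAt.continuousAt.sub continuousAt_const).norm
      have : ∀ᶠ l in 𝓝 (0 : L), ‖f l - s‖ < 2 * ϱ :=
        hc.eventually_lt continuousAt_const (by simpa [hf0] using hlt)
      exact this.mono fun _ h => h.le
    refine inter_mem (isOpen_ball.mem_nhds hwϱ) ?_
    rw [← hmap, mem_map]
    filter_upwards [hnb] with l hl
    exact ⟨f l, ⟨hl.1, by simpa [dist_eq_norm] using hl.2⟩, rfl⟩
  have hsub : ball (0 : T s) ϱ ⊆ u := by
    refine (convex_ball (0 : T s) ϱ).isPreconnected.subset_of_closure_inter_subset huo ?_ ?_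
    · refine ⟨0, mem_ball_self hϱ0, mem_ball_self hϱ0, s, ⟨hs, mem_closedBall_self (by linarith)⟩, ?_⟩
      simp [hg]
    · rintro v ⟨hv, hvb⟩
      exact ⟨hvb, hMc.closure_subset_iff.2 inter_subset_right hv⟩
  have hwb : (⟨w, hw⟩ : T s) ∈ ball (0 : T s) ϱ := by
    have : ‖w‖ < ϱ := by
      by_contra! h
      have h1 : K * ϱ ≤ K * ‖w‖ := by gcongr
      nlinarith
    simpa using this
  obtain ⟨-, y, ⟨hyS, hyb⟩, hyw⟩ := hsub hwb
  rw [mem_closedBall, dist_eq_norm] at hyb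
  have hyw' : (T s).starProjection (y - s) = w := congrArg Subtype.val hyw
  refine ⟨y, hyS, hyw', ?_⟩
  have := hcontrol y hyS hyb
  rwa [hyw] at this

/-- By compactness the local bounds hold with one constant: a Lebesgue number of the cover decides
which pairs of points are close, and at larger distances the bounds are trivial. -/
theorem IsClosedSurface.exists_hasUniformTangents {D d : ℕ} {S : Set (EuclideanSpace ℝ (Fin D))}
    (hS : IsClosedSurface d S) : ∃ K, HasUniformTangents d S (tangentSubspace S) K := by
  choose! U hUo hU K hK0 hK using fun s₀ (hs₀ : s₀ ∈ S) => hS.exists_local_bounds hs₀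
  obtain ⟨t, htS, htcov⟩ := hS.isCompact.elim_nhds_subcover U
    (fun s hs => (hUo s hs).mem_nhds (hU s hs))
  obtain ⟨δ, hδ, hleb⟩ := lebesgue_number_lemma_of_metric (c := fun i : t => U i) hS.isCompact
    (fun i => hUo _ (htS i i.2)) (by simpa [iUnion_subtype] using htcov)
  set K₁ : ℝ := ∑ i ∈ t, K i with hK₁
  have hK₁le : ∀ i ∈ t, K i ≤ K₁ := fun i hi =>
    Finset.single_le_sum (fun j hj => hK0 j (htS j hj)) hi
  set T := tangentSubspace S with hT
  have hK₁0 : 0 ≤ K₁ := Finset.sum_nonneg fun j hj => hK0 j (htS j hj)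
  set K₂ : ℝ := 2 * K₁ + 2 / δ + 1 with hK₂
  have hd0 : 0 < 2 / δ := by positivity
  have hdδ : 2 / δ * δ = 2 := by field_simp
  have hfin : ∀ s ∈ S, finrank ℝ (T s) = d := by
    intro s hs
    obtain ⟨i, hi⟩ := hleb s hs
    exact (hK i (htS i i.2) s hs (hi (mem_ball_self hδ))).1
  have hnear : ∀ s ∈ S, ∀ y ∈ S,
      ‖(y - s) - (T s).starProjection (y - s)‖ ≤ K₂ * ‖y - s‖ ^ 2 := by
    intro s hs y hy
    rcases lt_or_ge ‖y - s‖ δ with h | h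
    · obtain ⟨i, hi⟩ := hleb s hs
      have := (hK i (htS i i.2) s hs (hi (mem_ball_self hδ))).2.1 y hy
        (hi (by simpa [dist_eq_norm] using h))
      refine this.trans (mul_le_mul_of_nonneg_right ?_ (sq_nonneg _))
      linarith [hK₁le i i.2]
    · refine (norm_sub_starProjection_le_norm _ _).trans ?_
      have h1 : 1 ≤ 2 / δ * ‖y - s‖ := by nlinarith
      have h2 : 1 ≤ K₂ * ‖y - s‖ := by nlinarith [norm_nonneg (y - s)]
      nlinarith [norm_nonneg (y - s)]
  have hone : ∀ s ∈ S, ∀ y ∈ S, ‖y - s‖ < δ → ∀ v ∈ T s,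
      ‖v - (T y).starProjection v‖ ≤ K₁ * ‖s - y‖ * ‖v‖ := by
    intro s hs y hy h v hv
    obtain ⟨i, hi⟩ := hleb s hs
    have := (hK i (htS i i.2) s hs (hi (mem_ball_self hδ))).2.2.1 y hy
        (hi (by simpa [dist_eq_norm] using h)) v hv
    refine this.trans ?_
    gcongr
    exact hK₁le i i.2
  have hlip : ∀ s ∈ S, ∀ y ∈ S,
      ‖(T s).starProjection - (T y).starProjection‖ ≤ K₂ * ‖s - y‖ := by
    intro s hs y hy
    rcases lt_or_ge ‖y - s‖ δ with h | h
    · have h2 : ‖s - y‖ < δ := by rwa [norm_sub_rev]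
      refine (norm_starProjection_sub_starProjection_le (ε := K₁ * ‖s - y‖) (by positivity)
        (hone s hs y hy h) (fun v hv => ?_)).trans ?_
      · rw [norm_sub_rev s y]
        exact hone y hy s hs h2 v hv
      · nlinarith [norm_nonneg (s - y)]
    · have h1 : ‖(T s).starProjection - (T y).starProjection‖ ≤ 1 + 1 :=
        (norm_sub_le _ _).trans (add_le_add (T s).starProjection_norm_le
          (T y).starProjection_norm_le)
      rw [norm_sub_rev] at h
      have h3 : 2 ≤ 2 / δ * ‖s - y‖ := by nlinarith
      nlinarith [norm_nonneg (s - y)]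
  have hK₂1 : 1 ≤ K₂ := by linarith
  refine ⟨8 * K₂, hS.isCompact, hS.isConnected.nonempty, by linarith, hfin,
    fun s hs y hy => (hnear s hs y hy).trans ?_, fun s hs y hy => (hlip s hs y hy).trans ?_,
    fun s hs w hw hKw => ?_⟩
  · gcongr; linarith
  · gcongr; linarith
  · refine exists_mem_starProjection_sub_eq hS.isCompact hK₂1 hs
      (fun y hy => by rw [hfin s hs, hfin y hy]) (hnear s hs) (hlip s hs) (fun y hy => ?_) hw hKw
    obtain ⟨i, hi⟩ := hleb y hy
    exact (hK i (htS i i.2) y hy (hi (mem_ball_self hδ))).2.2.2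

end UniformTangentsExist

/-! ### Positive reach, linear regularity of the intersection, and the incidence angle -/

section Reach

open Set Filter Metric Topology

variable {E : Type*} [NormedAddCommGroup E] [InnerProductSpace ℝ E] [FiniteDimensional ℝ E]

/-- Away from `A` and within its reach, the distance to `A` grows at unit rate in the direction
opposite to the nearest point, so a point where it is maximal under a penalty `l < 1` on the
distance to `x` lies on the boundary of the ball. -/
theorem exists_infDist_ge_of_reach {A : Set E} (hA : IsCompact A) (hne : A.Nonempty) {ρ : ℝ}
    (hρ : ∀ x, infDist x A < ρ → ∃! s, s ∈ A ∧ dist x s = infDist x A) {x : E} {h l : ℝ}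
    (hx : 0 < infDist x A) (hh : 0 ≤ h) (hxh : infDist x A + h < ρ) (hl0 : 0 ≤ l) (hl : l < 1) :
    ∃ z ∈ closedBall x h, infDist x A + l * h ≤ infDist z A := by
  have hcont : Continuous fun z => infDist z A - l * dist z x := by
    have := continuous_infDist_pt A
    fun_prop
  obtain ⟨z, hz, hmax⟩ := (isCompact_closedBall x h).exists_isMaxOn
    ⟨x, mem_closedBall_self hh⟩ hcont.continuousOn
  have hzx : infDist x A ≤ infDist z A - l * dist z x := by
    simpa using hmax (mem_closedBall_self hh)
  rcases (mem_closedBall.1 hz).lt_or_eq with hlt | heq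
  swap
  · exact ⟨z, hz, by rw [heq] at hzx; linarith⟩
  exfalso
  set d₀ := infDist z A with hd₀
  have hd₀pos : 0 < d₀ := by nlinarith [dist_nonneg (x := z) (y := x)]
  have hd₀ρ : d₀ < ρ := by
    have := infDist_le_infDist_add_dist (s := A) (x := z) (y := x)
    linarith
  obtain ⟨q, ⟨hqA, hqd⟩, hquniq⟩ := hρ z hd₀ρ
  rw [← hd₀, dist_eq_norm] at hqd
  set v := d₀⁻¹ • (z - q) with hv
  have hv1 : ‖v‖ = 1 := by
    rw [hv, norm_smul, hqd, norm_inv, Real.norm_of_nonneg hd₀pos.le, inv_mul_cancel₀ hd₀pos.ne']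
  -- if `z` were inside the ball, it could be moved away from its nearest point `q` along `v`; the
  -- nearest points of the moved points converge to `q`, which gives the growth rate
  have hε : 0 < h - dist z x := by linarith
  set σ : ℕ → ℝ := fun n => (h - dist z x) / (n + 1) with hσ
  have hσ0 : ∀ n, 0 < σ n := fun n => by positivity
  have hσle : ∀ n, σ n ≤ h - dist z x := fun n =>
    div_le_self hε.le (by linarith [(Nat.cast_nonneg n : (0 : ℝ) ≤ n)])
  have hσlim : Tendsto σ atTop (𝓝 0) := 
    tendsto_const_nhds.div_atTop
      (tendsto_atTop_add_const_right _ 1 tendsto_natCast_atTop_atTop)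
  choose a haA had using fun n => hA.exists_infDist_eq_dist hne (z + σ n • v)
  have hball : ∀ n, z + σ n • v ∈ closedBall x h := by
    intro n
    rw [mem_closedBall, dist_eq_norm]
    have h1 : ‖σ n • v‖ = σ n := by rw [norm_smul, hv1, mul_one, Real.norm_of_nonneg (hσ0 n).le]
    have h2 : z + σ n • v - x = (z - x) + σ n • v := by abel
    rw [h2]
    have := norm_add_le (z - x) (σ n • v)
    rw [h1, ← dist_eq_norm] at this
    linarith [hσle n]
  have hbound : ∀ n, infDist (z + σ n • v) A ≤ d₀ + l * σ n := by
    intro n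
    have h0 : infDist (z + σ n • v) A - l * dist (z + σ n • v) x ≤ d₀ - l * dist z x :=
      hmax (hball n)
    have h1 : dist (z + σ n • v) x ≤ dist z x + σ n := by
      have := dist_triangle (z + σ n • v) z x
      rw [dist_eq_norm (z + σ n • v) z, add_sub_cancel_left, norm_smul, hv1, mul_one,
        Real.norm_of_nonneg (hσ0 n).le] at this
      linarith
    nlinarith
  obtain ⟨b, hbA, ψ, hψ, hψlim⟩ := hA.tendsto_subseq haA
  have hσψ : Tendsto (fun n => σ (ψ n)) atTop (𝓝 0) := hσlim.comp hψ.tendsto_atTop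
  have hzlim : Tendsto (fun n => z + σ (ψ n) • v) atTop (𝓝 z) := by
    simpa using (hσψ.smul_const v).const_add z
  have hb : b = q := by
    apply hquniq
    refine ⟨hbA, ?_⟩
    have h1 : Tendsto (fun n => infDist (z + σ (ψ n) • v) A) atTop (𝓝 d₀) :=
      ((continuous_infDist_pt A).tendsto z).comp hzlim
    have h2 : Tendsto (fun n => dist (z + σ (ψ n) • v) (a (ψ n))) atTop (𝓝 (dist z b)) :=
      hzlim.dist hψlim
    exact tendsto_nhds_unique h2 (h1.congr fun n => had (ψ n))
  have hineq : ∀ n, 2 * ⟪v, z - a n⟫ ≤ 2 * l * d₀ + l ^ 2 * σ n := by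
    intro n
    have h1 : d₀ ≤ ‖z - a n‖ := by
      rw [← dist_eq_norm]; exact infDist_le_dist_of_mem (haA n)
    have h2 := hbound n
    rw [had n, dist_eq_norm] at h2
    have h3 : z + σ n • v - a n = (z - a n) + σ n • v := by abel
    rw [h3] at h2
    have h4 := norm_add_sq_real (z - a n) (σ n • v)
    rw [norm_smul, hv1, mul_one, inner_smul_right, Real.norm_of_nonneg (hσ0 n).le,
      real_inner_comm] at h4
    have h5 : ‖z - a n + σ n • v‖ ^ 2 ≤ (d₀ + l * σ n) ^ 2 := by gcongr
    have h6 : d₀ ^ 2 ≤ ‖z - a n‖ ^ 2 := by gcongr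
    have h7 : σ n * (2 * ⟪v, z - a n⟫) ≤ σ n * (2 * l * d₀ + l ^ 2 * σ n) := by
      nlinarith [sq_nonneg (σ n)]
    exact le_of_mul_le_mul_left h7 (hσ0 n)
  have hlim : 2 * ⟪v, z - b⟫ ≤ 2 * l * d₀ + l ^ 2 * 0 := by
    refine le_of_tendsto_of_tendsto' (f := fun n => 2 * ⟪v, z - a (ψ n)⟫)
      (g := fun n => 2 * l * d₀ + l ^ 2 * σ (ψ n)) (b := atTop) ?_ ?_ fun n => hineq (ψ n)
    · exact (tendsto_const_nhds.inner (hψlim.const_sub z)).const_mul 2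
    · exact (hσψ.const_mul _).const_add _
  rw [hb, hv, inner_smul_left, real_inner_self_eq_norm_sq, hqd] at hlim
  have : d₀⁻¹ * d₀ ^ 2 = d₀ := by field_simp
  simp only [conj_trivial] at hlim
  rw [this] at hlim
  nlinarith

/-- Federer: if `p` is a nearest point of `A` to `x`, it remains one along the ray from `p`
through `x`, as far as nearest points to `A` are unique. -/
theorem le_dist_of_reach {A : Set E} (hA : IsCompact A) {ρ : ℝ}
    (hρ : ∀ x, infDist x A < ρ → ∃! s, s ∈ A ∧ dist x s = infDist x A) {x p : E} (hp : p ∈ A)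
    (hxp : infDist x A = ‖x - p‖) (hx : x ≠ p) {t : ℝ} (hxt : ‖x - p‖ ≤ t) (htρ : t < ρ)
    {a : E} (ha : a ∈ A) : t ≤ ‖p + (t / ‖x - p‖) • (x - p) - a‖ := by
  have hne : A.Nonempty := ⟨p, hp⟩
  set δ := ‖x - p‖ with hδ
  have hδ0 : 0 < δ := by rw [hδ, norm_pos_iff, sub_ne_zero]; exact hx
  set h := t - δ with hh
  have hh0 : 0 ≤ h := by linarith
  obtain ⟨z, hz, hmax⟩ := (isCompact_closedBall x h).exists_isMaxOn
    ⟨x, mem_closedBall_self hh0⟩ (continuous_infDist_pt A).continuousOn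
  -- a farthest point of the ball of radius `h` around `x` gains the full `h`, and then the triangle
  -- inequality leaves only one position for it
  have hzge : δ + h ≤ infDist z A := by
    have hlim : Tendsto (fun l : ℝ => δ + l * h) (𝓝[<] 1) (𝓝 (δ + 1 * h)) := by
      have : Continuous fun l : ℝ => δ + l * h := by fun_prop
      exact (this.tendsto 1).mono_left nhdsWithin_le_nhds
    rw [one_mul] at hlim
    refine le_of_tendsto hlim ?_
    have hI : Ioo (0 : ℝ) 1 ∈ 𝓝[<] (1 : ℝ) := Ioo_mem_nhdsLT (by norm_num)
    filter_upwards [hI] with l hl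
    obtain ⟨y, hy, hyl⟩ := exists_infDist_ge_of_reach hA hne hρ (by rw [hxp]; exact hδ0) hh0
      (by rw [hxp]; linarith) hl.1.le hl.2
    rw [hxp] at hyl
    exact hyl.trans (hmax hy)
  have hzx : ‖z - x‖ ≤ h := by rw [← dist_eq_norm]; exact hz
  have hzp : δ + h ≤ ‖z - p‖ := by
    rw [← dist_eq_norm]; exact hzge.trans (infDist_le_dist_of_mem hp)
  have hinner : h * δ ≤ ⟪z - x, x - p⟫ := by
    have h1 := norm_add_sq_real (z - x) (x - p)
    rw [sub_add_sub_cancel, ← hδ] at h1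
    have h2 : (δ + h) ^ 2 ≤ ‖z - p‖ ^ 2 := by gcongr
    have h3 : ‖z - x‖ ^ 2 ≤ h ^ 2 := by gcongr
    nlinarith
  have hzeq : z = p + (t / δ) • (x - p) := by
    have h1 := norm_sub_sq_real (z - x) ((h / δ) • (x - p))
    rw [inner_smul_right, norm_smul, ← hδ, Real.norm_of_nonneg (by positivity)] at h1
    have h2 : h / δ * δ = h := by field_simp
    rw [h2] at h1
    have h3 : ‖z - x‖ ^ 2 ≤ h ^ 2 := by gcongr
    have h4 : h ^ 2 ≤ h / δ * ⟪z - x, x - p⟫ := by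
      calc h ^ 2 = h / δ * (h * δ) := by field_simp
        _ ≤ _ := by gcongr
    have h5 : ‖z - x - (h / δ) • (x - p)‖ ^ 2 ≤ 0 := by linarith
    have h6 : z - x - (h / δ) • (x - p) = 0 := by
      rw [← norm_eq_zero]; exact pow_eq_zero_iff two_ne_zero |>.1 (le_antisymm h5 (sq_nonneg _))
    have h7 : t / δ = 1 + h / δ := by rw [hh]; field_simp; ring
    rw [h7, add_smul, one_smul]
    rw [sub_sub, sub_eq_zero] at h6
    rw [h6]; abel
  rw [← hzeq, ← dist_eq_norm]
  exact (by linarith : t ≤ infDist z A).trans (infDist_le_dist_of_mem ha)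

/-- A limit of vectors that are nearly tangent at points `p n` is tangent at the limit of `p n`. -/
theorem HasUniformTangents.mem_of_tendsto {d : ℕ} {S : Set E} {T : E → Submodule ℝ E} {K : ℝ}
    (hS : HasUniformTangents d S T K) {p u : ℕ → E} {s v : E} (hpS : ∀ n, p n ∈ S) (hs : s ∈ S)
    (hp : Tendsto p atTop (𝓝 s)) (hu : Tendsto u atTop (𝓝 v)) (hu1 : ∀ n, ‖u n‖ ≤ 1) {e : ℕ → ℝ}
    (he : Tendsto e atTop (𝓝 0)) (hue : ∀ᶠ n in atTop, ‖u n - (T (p n)).starProjection (u n)‖ ≤ e n) :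
    v ∈ T s := by
  have h1 : Tendsto (fun n => ‖u n - (T s).starProjection (u n)‖) atTop
      (𝓝 ‖v - (T s).starProjection v‖) :=
    (hu.sub (((T s).starProjection.continuous.tendsto _).comp hu)).norm
  have h2 : Tendsto (fun n => e n + K * ‖p n - s‖) atTop (𝓝 (0 + K * ‖s - s‖)) :=
    he.add ((hp.sub_const s).norm.const_mul K)
  have h3 : ‖v - (T s).starProjection v‖ ≤ 0 + K * ‖s - s‖ := by
    refine le_of_tendsto_of_tendsto h1 h2 ?_
    filter_upwards [hue] with n hn
    refine (norm_sub_le_norm_sub_add_norm_sub _ ((T (p n)).starProjection (u n)) _).trans ?_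
    refine add_le_add hn ?_
    have := ((T (p n)).starProjection - (T s).starProjection).le_opNorm (u n)
    rw [sub_apply] at this
    refine this.trans ?_
    calc _ ≤ (K * ‖p n - s‖) * 1 := by
          gcongr
          · exact mul_nonneg (by linarith [hS.one_le]) (norm_nonneg _)
          · exact hS.lipschitz _ (hpS n) _ hs
          · exact hu1 n
      _ = _ := mul_one _
  have h4 : v - (T s).starProjection v = 0 := norm_le_zero_iff.1 (by simpa using h3)
  rw [sub_eq_zero.1 h4]
  exact (T s).starProjection_apply_mem v

/-- The two surfaces separate at least linearly away from their intersection. Otherwise the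
directions from the nearest points of the intersection to points of `S₁` that are nearly on `S₂`
accumulate at a unit vector which is tangent to both surfaces, hence to the intersection, and which
is also a limit of normals to the intersection; positive reach makes such limits orthogonal to the
tangent cone. -/
theorem exists_infDist_inter_le {d : ℕ} {S₁ S₂ : Set E} {T₁ T₂ : E → Submodule ℝ E} {K : ℝ}
    (h₁ : HasUniformTangents d S₁ T₁ K) (h₂ : HasUniformTangents d S₂ T₂ K)
    (hne : (S₁ ∩ S₂).Nonempty) (hreach : 0 < reach (S₁ ∩ S₂))
    (htan : ∀ s ∈ S₁ ∩ S₂, posTangentConeAt (S₁ ∩ S₂) s = (T₁ s ⊓ T₂ s : Submodule ℝ E)) :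
    ∃ M : ℝ, ∀ s ∈ S₁, infDist s (S₁ ∩ S₂) ≤ M * infDist s S₂ := by
  set A := S₁ ∩ S₂ with hAdef
  have hA : IsCompact A := h₁.isCompact.inter h₂.isCompact
  obtain ⟨ρ, hρ0, hρ⟩ : ∃ ρ : ℝ, 0 < ρ ∧
      ∀ x, infDist x A < ρ → ∃! s, s ∈ A ∧ dist x s = infDist x A := by
    rw [reach, lt_iSup_iff] at hreach
    obtain ⟨ρ, h⟩ := hreach
    rw [lt_iSup_iff] at h
    exact ⟨ρ, h.1⟩
  by_contra! hcon
  choose s hsS hs using fun n : ℕ => hcon n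
  choose t htS ht using fun n => h₂.isCompact.exists_infDist_eq_dist h₂.nonempty (s n)
  choose p hpA hp using fun n => hA.exists_infDist_eq_dist hne (s n)
  set δ : ℕ → ℝ := fun n => infDist (s n) A with hδ
  have hδ0 : ∀ n, 0 < δ n := fun n =>
    (mul_nonneg (Nat.cast_nonneg n) infDist_nonneg).trans_lt (hs n)
  have hδp : ∀ n, δ n = ‖s n - p n‖ := fun n => by rw [← dist_eq_norm]; exact hp n
  have hst : ∀ n : ℕ, n * ‖s n - t n‖ < δ n := fun n => by
    rw [← dist_eq_norm, ← ht]; exact hs n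
  set u : ℕ → E := fun n => (δ n)⁻¹ • (s n - p n) with hu
  have hu1 : ∀ n, ‖u n‖ = 1 := fun n => by
    rw [hu]
    simp only
    rw [norm_smul, ← hδp, norm_inv, Real.norm_of_nonneg (hδ0 n).le, inv_mul_cancel₀ (hδ0 n).ne']
  obtain ⟨⟨s', t', p', u'⟩, ⟨hs'S, ht'S, hp'A, hu'1⟩, ψ, hψ, hlim⟩ :=
    (h₁.isCompact.prod (h₂.isCompact.prod (hA.prod (isCompact_sphere (0 : E) 1)))).tendsto_subseq
      (x := fun n => (s n, t n, p n, u n))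
      (fun n => ⟨hsS n, htS n, hpA n, by simpa using hu1 n⟩)
  have hlims : Tendsto (fun n => s (ψ n)) atTop (𝓝 s') := (continuous_fst.tendsto _).comp hlim
  have hlimt : Tendsto (fun n => t (ψ n)) atTop (𝓝 t') :=
    ((continuous_fst.comp continuous_snd).tendsto _).comp hlim
  have hlimp : Tendsto (fun n => p (ψ n)) atTop (𝓝 p') :=
    ((continuous_fst.comp (continuous_snd.comp continuous_snd)).tendsto _).comp hlim
  have hlimu : Tendsto (fun n => u (ψ n)) atTop (𝓝 u') :=
    ((continuous_snd.comp (continuous_snd.comp continuous_snd)).tendsto _).comp hlim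
  have hψ1 : Tendsto (fun n => ((ψ n : ℕ) : ℝ)) atTop atTop :=
    tendsto_natCast_atTop_atTop.comp hψ.tendsto_atTop
  have hlimδ : Tendsto (fun n => δ (ψ n)) atTop (𝓝 (infDist s' A)) :=
    ((continuous_infDist_pt A).tendsto s').comp hlims
  -- the limit of the points of `S₁` lies on `S₂`
  have hs't' : s' = t' := by
    have h1 : Tendsto (fun n => ‖s (ψ n) - t (ψ n)‖) atTop (𝓝 ‖s' - t'‖) :=
      (hlims.sub hlimt).norm
    have h2 : Tendsto (fun n => δ (ψ n) / (ψ n : ℝ)) atTop (𝓝 0) := hlimδ.div_atTop hψ1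
    have h3 : ‖s' - t'‖ ≤ 0 := by
      refine le_of_tendsto_of_tendsto h1 h2 ?_
      filter_upwards [hψ1.eventually_gt_atTop 0] with n hn
      rw [le_div_iff₀ hn, mul_comm]
      exact (hst (ψ n)).le
    exact sub_eq_zero.1 (norm_le_zero_iff.1 h3)
  have hs'A : s' ∈ A := ⟨hs'S, hs't' ▸ ht'S⟩
  have hδlim : Tendsto (fun n => δ (ψ n)) atTop (𝓝 0) := by
    rwa [infDist_zero_of_mem hs'A] at hlimδ
  have hp's' : p' = s' := by
    have h1 : Tendsto (fun n => ‖s (ψ n) - p (ψ n)‖) atTop (𝓝 ‖s' - p'‖) :=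
      (hlims.sub hlimp).norm
    have h2 := tendsto_nhds_unique h1 (hδlim.congr fun n => hδp (ψ n))
    exact (sub_eq_zero.1 (norm_eq_zero.1 h2)).symm
  rw [hp's'] at hlimp
  have hK0 : 0 ≤ K := by linarith [h₁.one_le]
  -- the limit direction is tangent to both surfaces
  have hu'T₁ : u' ∈ T₁ s' := by
    refine h₁.mem_of_tendsto (fun n => (hpA (ψ n)).1) hs'S hlimp hlimu (fun n => (hu1 _).le)
      (e := fun n => K * δ (ψ n)) (by simpa using hδlim.const_mul K) (Eventually.of_forall fun n => ?_)
    have h1 := h₁.near _ (hpA (ψ n)).1 _ (hsS (ψ n))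
    rw [hu]
    simp only
    rw [map_smul, ← smul_sub, norm_smul, norm_inv, Real.norm_of_nonneg (hδ0 _).le]
    rw [← hδp] at h1
    calc _ ≤ (δ (ψ n))⁻¹ * (K * δ (ψ n) ^ 2) := by
          gcongr
          exact inv_nonneg.2 (hδ0 _).le
      _ = _ := by have := (hδ0 (ψ n)).ne'; field_simp
  have hu'T₂ : u' ∈ T₂ s' := by
    have he : Tendsto (fun n => 1 / (ψ n : ℝ) + 4 * K * δ (ψ n)) atTop (𝓝 0) := by
      have h1 : Tendsto (fun n => 1 / (ψ n : ℝ)) atTop (𝓝 0) :=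
        tendsto_const_nhds.div_atTop hψ1
      simpa using h1.add (hδlim.const_mul (4 * K))
    refine h₂.mem_of_tendsto (fun n => (hpA (ψ n)).2) hs'A.2 hlimp hlimu (fun n => (hu1 _).le)
      he ?_
    filter_upwards [hψ1.eventually_ge_atTop 1] with n hn
    set m := ψ n
    have hδm := hδ0 m
    have hstm : ‖s m - t m‖ ≤ δ m / m := by
      rw [le_div_iff₀ (by linarith), mul_comm]; exact (hst m).le
    have hstm' : ‖s m - t m‖ ≤ δ m := hstm.trans (div_le_self hδm.le hn)
    have htp : ‖t m - p m‖ ≤ 2 * δ m := by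
      have := norm_sub_le_norm_sub_add_norm_sub (t m) (s m) (p m)
      rw [norm_sub_rev (t m) (s m), ← hδp] at this
      linarith
    have h1 := h₂.near _ (hpA m).2 _ (htS m)
    set P := (T₂ (p m)).starProjection
    refine (norm_sub_starProjection_le _ _ (w := (δ m)⁻¹ • P (t m - p m))
      (Submodule.smul_mem _ _ (Submodule.starProjection_apply_mem _ _))).trans ?_
    have h2 : u m - (δ m)⁻¹ • P (t m - p m) =
        (δ m)⁻¹ • ((s m - t m) + ((t m - p m) - P (t m - p m))) := by
      rw [hu]
      simp only [← smul_sub]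
      congr 1
      abel
    rw [h2, norm_smul, norm_inv, Real.norm_of_nonneg hδm.le]
    calc _ ≤ (δ m)⁻¹ * (δ m / m + K * (2 * δ m) ^ 2) := by
          gcongr
          refine (norm_add_le _ _).trans (add_le_add hstm (h1.trans ?_))
          gcongr
      _ = _ := by have : (m : ℝ) ≠ 0 := by positivity
                  field_simp; ring
  -- the limit direction is normal to the intersection
  set τ := ρ / 2 with hτ
  have hprox : ∀ a ∈ A, 2 * τ * ⟪u', a - s'⟫ ≤ ‖a - s'‖ ^ 2 := by
    intro a ha
    have h1 : Tendsto (fun n => ‖p (ψ n) + τ • u (ψ n) - a‖) atTop (𝓝 ‖s' + τ • u' - a‖) :=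
      ((hlimp.add (hlimu.const_smul τ)).sub_const a).norm
    have h2 : τ ≤ ‖s' + τ • u' - a‖ := by
      refine ge_of_tendsto h1 ?_
      filter_upwards [hδlim.eventually_le_const (by positivity : 0 < τ)] with n hn
      have := le_dist_of_reach hA hρ (hpA (ψ n)) (x := s (ψ n)) (hδp (ψ n))
        (by intro h; have := hδ0 (ψ n); rw [hδp, h, sub_self, norm_zero] at this; exact this.false)
        (t := τ) (by rw [← hδp]; exact hn) (by rw [hτ]; linarith) ha
      rw [← hδp, div_eq_mul_inv, mul_smul] at this
      exact this
    have h3 : s' + τ • u' - a = τ • u' - (a - s') := by abel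
    rw [h3] at h2
    have h4 := norm_sub_sq_real (τ • u') (a - s')
    have hu'n : ‖u'‖ = 1 := by simpa using hu'1
    have hτ0 : 0 < τ := by positivity
    rw [inner_smul_left, norm_smul, hu'n, mul_one, Real.norm_of_nonneg hτ0.le] at h4
    simp only [conj_trivial] at h4
    have h5 : τ ^ 2 ≤ ‖τ • u' - (a - s')‖ ^ 2 := by gcongr
    linarith
  have hcone : u' ∈ posTangentConeAt A s' := by
    rw [htan s' hs'A]; exact ⟨hu'T₁, hu'T₂⟩
  -- testing normality along a sequence in the intersection with direction `u'` gives `‖u'‖ = 0`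
  obtain ⟨α, l, hl, c, b, hb0, hbA, hc⟩ := exists_fun_of_mem_tangentConeAt hcone
  have h1 : Tendsto (fun n => 2 * τ * ⟪u', c n • b n⟫) l (𝓝 (2 * τ * ⟪u', u'⟫)) :=
    (tendsto_const_nhds.inner hc).const_mul _
  have h2 : Tendsto (fun n => ‖c n • b n‖ * ‖b n‖) l (𝓝 (‖u'‖ * ‖(0 : E)‖)) := hc.norm.mul hb0.norm
  have h3 : 2 * τ * ⟪u', u'⟫ ≤ ‖u'‖ * ‖(0 : E)‖ := by
    refine le_of_tendsto_of_tendsto h1 h2 ?_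
    filter_upwards [hbA] with n hn
    have := hprox _ hn
    rw [add_sub_cancel_left] at this
    rw [NNReal.smul_def, inner_smul_right, norm_smul, NNReal.norm_eq]
    have h4 := mul_le_mul_of_nonneg_left this (c n).2
    calc _ = (c n : ℝ) * (2 * τ * ⟪u', b n⟫) := by ring
      _ ≤ (c n : ℝ) * ‖b n‖ ^ 2 := h4
      _ = _ := by ring
  rw [real_inner_self_eq_norm_sq, norm_zero, mul_zero] at h3
  have hu'n : ‖u'‖ = 1 := by simpa using hu'1
  rw [hu'n] at h3
  have : 0 < τ := by positivity
  linarith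

/-- A positive `minAngle` is witnessed by singular vectors, since the junk value `sInf ∅ = 0` is
excluded; they are at distance at least its sine from the other space. -/
theorem exists_mem_sin_minAngle_le {T₁ T₂ : Submodule ℝ E} (h : 0 < minAngle T₁ T₂) {θ : ℝ}
    (hθ0 : 0 ≤ θ) (hθ : θ ≤ minAngle T₁ T₂) :
    (∃ e ∈ T₁, ‖e‖ = 1 ∧ Real.sin θ ≤ ‖e - T₂.starProjection e‖) ∧
      ∃ e ∈ T₂, ‖e‖ = 1 ∧ Real.sin θ ≤ ‖e - T₁.starProjection e‖ := by
  set Θ := {θ | θ ∈ principalAngles T₁ T₂ ∧ θ ≠ 0} with hΘ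
  have hne : Θ.Nonempty := by
    by_contra hcon
    rw [not_nonempty_iff_eq_empty] at hcon
    rw [minAngle, ← hΘ, hcon, Real.sInf_empty] at h
    exact h.false
  obtain ⟨φ, hφ⟩ := hne
  have hle : θ ≤ φ := hθ.trans (csInf_le ⟨0, fun x hx => hx.1.1.1⟩ hφ)
  obtain ⟨⟨⟨hφ0, hφ2⟩, u, hu, v, hv, hu1, hv1, hPu, hPv⟩, -⟩ := hφ
  have hsin : Real.sin θ ≤ Real.sin φ :=
    Real.sin_le_sin_of_le_of_le_pi_div_two (by linarith [Real.pi_pos]) hφ2 hle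
  have hs0 : 0 ≤ Real.sin φ := Real.sin_nonneg_of_nonneg_of_le_pi hφ0 (by linarith [Real.pi_pos])
  have key : ∀ (T : Submodule ℝ E) (a b : E), ‖a‖ = 1 → ‖b‖ = 1 →
      T.starProjection a = Real.cos φ • b → Real.sin θ ≤ ‖a - T.starProjection a‖ := by
    intro T a b ha hb hab
    have h1 := norm_sq_eq_norm_sq_starProjection_add T a
    have h2 : ‖T.starProjection a‖ ^ 2 = Real.cos φ ^ 2 := by
      rw [hab, norm_smul, hb, mul_one, Real.norm_eq_abs, sq_abs]
    have h3 := Real.sin_sq_add_cos_sq φ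
    refine hsin.trans (abs_le_of_sq_le_sq' ?_ (norm_nonneg _)).2
    rw [ha] at h1
    nlinarith
  exact ⟨⟨u, hu, hu1, key T₂ u v hu1 hv1 hPu⟩, ⟨v, hv, hv1, key T₁ v u hv1 hu1 hPv⟩⟩

end Reach

/-! ### Moments of flat discs -/

section Discs

open Set Filter Metric Topology

section EuclideanBall

variable {d : ℕ}

local notation "𝔽" => EuclideanSpace ℝ (Fin d)

instance isAddHaarMeasure_hausdorffMeasure_euclideanSpace :
    (μH[(d : ℝ)] : Measure 𝔽).IsAddHaarMeasure := by
  have h := isAddHaarMeasure_hausdorffMeasure (E := 𝔽)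
  rwa [finrank_euclideanSpace_fin] at h

theorem setIntegral_closedBall_comp_linearIsometryEquiv (e : 𝔽 ≃ₗᵢ[ℝ] 𝔽) (f : 𝔽 → ℝ) :
    ∫ z in closedBall (0 : 𝔽) 1, f (e z) ∂μH[(d : ℝ)] =
      ∫ z in closedBall (0 : 𝔽) 1, f z ∂μH[(d : ℝ)] := by
  have h := (e.toIsometryEquiv.measurePreserving_hausdorffMeasure (d : ℝ)).setIntegral_preimage_emb
    e.toIsometryEquiv.toHomeomorph.measurableEmbedding f (closedBall 0 1)
  rw [← h]
  congr 2
  ext z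
  simp

theorem setIntegral_closedBall_inner (a : 𝔽) :
    ∫ z in closedBall (0 : 𝔽) 1, ⟪z, a⟫ ∂μH[(d : ℝ)] = 0 := by
  have h := setIntegral_closedBall_comp_linearIsometryEquiv (LinearIsometryEquiv.neg ℝ)
    (fun z : 𝔽 => ⟪z, a⟫)
  simp only [LinearIsometryEquiv.coe_neg, inner_neg_left] at h
  rw [integral_neg] at h
  linarith

theorem setIntegral_closedBall_inner_sq {e : 𝔽} (he : ‖e‖ = 1) (a : 𝔽) :
    ∫ z in closedBall (0 : 𝔽) 1, ⟪z, a⟫ ^ 2 ∂μH[(d : ℝ)] =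
      (∫ z in closedBall (0 : 𝔽) 1, ⟪z, e⟫ ^ 2 ∂μH[(d : ℝ)]) * ‖a‖ ^ 2 := by
  have hnorm : ‖a‖ = ‖‖a‖ • e‖ := by rw [norm_smul, he, mul_one, norm_norm]
  set ρ := (ℝ ∙ (a - ‖a‖ • e))ᗮ.reflection with hρ
  have hρa : ρ a = ‖a‖ • e := Submodule.reflection_sub hnorm
  have h := setIntegral_closedBall_comp_linearIsometryEquiv ρ (fun z : 𝔽 => ⟪z, ‖a‖ • e⟫ ^ 2)
  have h2 : ∀ z, ⟪ρ z, ‖a‖ • e⟫ = ⟪z, a⟫ := fun z => by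
    rw [← hρa]; exact ρ.inner_map_map z a
  simp only [h2] at h
  rw [h, ← integral_mul_const]
  congr 1
  ext z
  rw [inner_smul_right]
  ring

theorem setIntegral_closedBall_eq_pow_mul (hd : 1 ≤ d) (q : 𝔽) {R : ℝ} (hR : 0 ≤ R) (f : 𝔽 → ℝ) :
    ∫ z in closedBall q R, f z ∂μH[(d : ℝ)] =
      R ^ d * ∫ z in closedBall (0 : 𝔽) 1, f (q + R • z) ∂μH[(d : ℝ)] := by
  rcases hR.eq_or_lt with rfl | hR
  · have : Nontrivial 𝔽 := by
      have : Nonempty (Fin d) := ⟨⟨0, hd⟩⟩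
      infer_instance
    have h0 : (μH[(d : ℝ)] : Measure 𝔽) (closedBall q 0) = 0 := by
      rw [closedBall_zero]; exact measure_singleton q
    rw [Measure.restrict_eq_zero.2 h0, integral_zero_measure, zero_pow (by omega), zero_mul]
  · have h1 := (measurePreserving_add_left (μH[(d : ℝ)] : Measure 𝔽) q).setIntegral_preimage_emb
      (MeasurableEquiv.addLeft q).measurableEmbedding f (closedBall q R)
    have h2 : (fun x => q + x) ⁻¹' closedBall q R = closedBall 0 R := by
      ext z; simp
    rw [h2] at h1
    have h3 := Measure.setIntegral_comp_smul_of_pos (μH[(d : ℝ)] : Measure 𝔽) (fun z => f (q + z))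
      (closedBall 0 1) hR
    rw [smul_unitClosedBall_of_nonneg hR.le, finrank_euclideanSpace_fin] at h3
    rw [← h1, h3, smul_eq_mul, ← mul_assoc, mul_inv_cancel₀ (by positivity), one_mul]

theorem measure_closedBall_hausdorff_lt_top (q : 𝔽) (R : ℝ) :
    (μH[(d : ℝ)] : Measure 𝔽) (closedBall q R) < ⊤ :=
  (isCompact_closedBall q R).measure_lt_top

theorem setIntegral_closedBall_sq (hd : 1 ≤ d) {e : 𝔽} (he : ‖e‖ = 1) (q : 𝔽) {R : ℝ} (hR : 0 ≤ R)
    (α : ℝ) (a : 𝔽) :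
    ∫ z in closedBall q R, (α + ⟪z, a⟫) ^ 2 ∂μH[(d : ℝ)] =
      R ^ d * ((α + ⟪q, a⟫) ^ 2 * (μH[(d : ℝ)] : Measure 𝔽).real (closedBall 0 1) +
        R ^ 2 * ((∫ z in closedBall (0 : 𝔽) 1, ⟪z, e⟫ ^ 2 ∂μH[(d : ℝ)]) * ‖a‖ ^ 2)) := by
  rw [setIntegral_closedBall_eq_pow_mul hd q hR]
  congr 1
  have hint : ∀ f : 𝔽 → ℝ, Continuous f → IntegrableOn f (closedBall (0 : 𝔽) 1) μH[(d : ℝ)] :=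
    fun f hf => hf.continuousOn.integrableOn_compact (isCompact_closedBall 0 1)
  have hexp : ∀ z : 𝔽, (α + ⟪q + R • z, a⟫) ^ 2 =
      (α + ⟪q, a⟫) ^ 2 + (2 * (α + ⟪q, a⟫) * R) * ⟪z, a⟫ + R ^ 2 * ⟪z, a⟫ ^ 2 := by
    intro z
    rw [inner_add_left, inner_smul_left]
    simp only [conj_trivial]
    ring
  simp only [hexp]
  rw [integral_add (hint _ (by fun_prop)) (hint _ (by fun_prop)),
    integral_add (hint _ (by fun_prop)) (hint _ (by fun_prop)), integral_const_mul,
    integral_const_mul, setIntegral_closedBall_inner, setIntegral_closedBall_inner_sq he]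
  simp [mul_comm]

theorem setIntegral_closedBall_inner_sq_pos {e : 𝔽} (he : ‖e‖ = 1) :
    0 < ∫ z in closedBall (0 : 𝔽) 1, ⟪z, e⟫ ^ 2 ∂μH[(d : ℝ)] := by
  have hint : IntegrableOn (fun z : 𝔽 => ⟪z, e⟫ ^ 2) (closedBall (0 : 𝔽) 1) μH[(d : ℝ)] := by
    refine Continuous.continuousOn ?_ |>.integrableOn_compact (isCompact_closedBall 0 1)
    fun_prop
  have hsub : ball ((1 / 2 : ℝ) • e) (1 / 4) ⊆
      (Function.support fun z : 𝔽 => ⟪z, e⟫ ^ 2) ∩ closedBall 0 1 := by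
    intro z hz
    rw [mem_ball, dist_eq_norm] at hz
    constructor
    · have h1 : ⟪z, e⟫ = 1 / 2 + ⟪z - (1 / 2 : ℝ) • e, e⟫ := by
        rw [inner_sub_left, inner_smul_left, real_inner_self_eq_norm_sq, he]; simp
      have h2 := abs_real_inner_le_norm (z - (1 / 2 : ℝ) • e) e
      rw [he, mul_one] at h2
      have h3 := (abs_le.1 (h2.trans hz.le)).1
      have : 0 < ⟪z, e⟫ := by linarith
      exact (pow_pos this 2).ne'
    · rw [mem_closedBall_zero_iff]
      have := norm_add_le (z - (1 / 2 : ℝ) • e) ((1 / 2 : ℝ) • e)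
      rw [sub_add_cancel, norm_smul, he] at this
      norm_num at this
      linarith
  rw [setIntegral_pos_iff_support_of_nonneg_ae (Eventually.of_forall fun z => sq_nonneg _) hint]
  exact (isOpen_ball.measure_pos _ ⟨_, mem_ball_self (by norm_num)⟩).trans_le (measure_mono hsub)

theorem setIntegral_closedBall_inner_sq_le {e : 𝔽} (he : ‖e‖ = 1) :
    ∫ z in closedBall (0 : 𝔽) 1, ⟪z, e⟫ ^ 2 ∂μH[(d : ℝ)] ≤
      (μH[(d : ℝ)] : Measure 𝔽).real (closedBall 0 1) := by
  have h := norm_setIntegral_le_of_norm_le_const (f := fun z : 𝔽 => ⟪z, e⟫ ^ 2) (C := 1)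
    (measure_closedBall_hausdorff_lt_top (0 : 𝔽) 1) (fun z hz => by
      have h2 := abs_real_inner_le_norm z e
      rw [he, mul_one] at h2
      have h3 : |⟪z, e⟫| ≤ 1 := h2.trans (mem_closedBall_zero_iff.1 hz)
      rw [Real.norm_of_nonneg (sq_nonneg _), ← sq_abs]
      exact pow_le_one₀ (abs_nonneg _) h3)
  rw [one_mul] at h
  exact (le_abs_self _).trans h

end EuclideanBall

variable {E : Type*} [NormedAddCommGroup E] [InnerProductSpace ℝ E] [FiniteDimensional ℝ E]

/-- The radius of the disc `T ∩ closedBall v R`; it is `0` when the ball misses `T`. -/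
noncomputable def discRadius (T : Submodule ℝ E) (v : E) (R : ℝ) : ℝ :=
  √(R ^ 2 - ‖v - T.starProjection v‖ ^ 2)

/-- The integral of `w ↦ (α + ⟪w, u⟫) ^ 2` over the `d`-dimensional disc `T ∩ closedBall v R`, in
units of the volume of the unit disc; `c` is the variance of a coordinate on the unit disc. -/
noncomputable def discMoment (d : ℕ) (c : ℝ) (T : Submodule ℝ E) (v : E) (R α : ℝ) (u : E) : ℝ :=
  discRadius T v R ^ d * ((α + ⟪T.starProjection v, u⟫) ^ 2 +
    c * discRadius T v R ^ 2 * ‖T.starProjection u‖ ^ 2)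

theorem inter_closedBall_eq {T : Submodule ℝ E} {v : E} {R : ℝ} (hR : 0 ≤ R)
    (h : ‖v - T.starProjection v‖ ≤ R) :
    (T : Set E) ∩ closedBall v R =
      (T : Set E) ∩ closedBall (T.starProjection v) (discRadius T v R) := by
  ext w
  simp only [mem_inter_iff, SetLike.mem_coe, and_congr_right_iff]
  intro hw
  have h0 : 0 ≤ R ^ 2 - ‖v - T.starProjection v‖ ^ 2 := by
    rw [sub_nonneg]; gcongr
  rw [mem_closedBall, mem_closedBall, dist_eq_norm, dist_eq_norm, discRadius,
    Real.le_sqrt (norm_nonneg _)]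
  have h1 := norm_sq_eq_norm_sq_starProjection_add T (w - v)
  have h2 : w - v - (w - T.starProjection v) = -(v - T.starProjection v) := by abel
  rw [map_sub, starProjection_of_mem hw, h2, norm_neg] at h1
  rw [← pow_le_pow_iff_left₀ (norm_nonneg _) hR two_ne_zero, h1]
  · constructor <;> intro _ <;> linarith
  · exact h0

theorem discRadius_eq_zero {T : Submodule ℝ E} {v : E} {R : ℝ} (hR : 0 ≤ R)
    (h : R ≤ ‖v - T.starProjection v‖) : discRadius T v R = 0 := by
  refine Real.sqrt_eq_zero_of_nonpos ?_
  have : R ^ 2 ≤ ‖v - T.starProjection v‖ ^ 2 := by gcongr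
  linarith

theorem inter_closedBall_eq_empty {T : Submodule ℝ E} {v : E} {R : ℝ}
    (h : R < ‖v - T.starProjection v‖) : (T : Set E) ∩ closedBall v R = ∅ := by
  rw [eq_empty_iff_forall_notMem]
  rintro w ⟨hw, hwv⟩
  have := norm_sub_starProjection_le T v hw
  rw [mem_closedBall, dist_eq_norm, norm_sub_rev] at hwv
  linarith

/-- The second moments of a ball in a `d`-dimensional subspace: by symmetry the covariance of the
uniform distribution on a centred ball is a multiple of the identity, and an isometry from
`EuclideanSpace ℝ (Fin d)` transports the formula to every subspace. -/
theorem exists_setIntegral_disc_eq (E : Type*) [NormedAddCommGroup E] [InnerProductSpace ℝ E]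
    [FiniteDimensional ℝ E] [MeasurableSpace E] [BorelSpace E] {d : ℕ} (hd : 1 ≤ d) :
    ∃ ω c : ℝ, 0 < ω ∧ 0 < c ∧ c ≤ 1 ∧ ∀ T : Submodule ℝ E, finrank ℝ T = d → ∀ (v : E) (R : ℝ),
      0 ≤ R → μH[(d : ℝ)] ((T : Set E) ∩ closedBall v R) < ⊤ ∧ ∀ (α : ℝ) (u : E),
        ∫ w in (T : Set E) ∩ closedBall v R, (α + ⟪w, u⟫) ^ 2 ∂μH[(d : ℝ)] =
          ω * discMoment d c T v R α u := by
  have e₀ : ∃ e : EuclideanSpace ℝ (Fin d), ‖e‖ = 1 :=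
    ⟨EuclideanSpace.single ⟨0, hd⟩ 1, by simp⟩
  obtain ⟨e, he⟩ := e₀
  set ω := (μH[(d : ℝ)] : Measure (EuclideanSpace ℝ (Fin d))).real (closedBall 0 1) with hω
  set κ := ∫ z in closedBall (0 : EuclideanSpace ℝ (Fin d)) 1, ⟪z, e⟫ ^ 2 ∂μH[(d : ℝ)] with hκ
  have hκ0 : 0 < κ := setIntegral_closedBall_inner_sq_pos he
  have hκω : κ ≤ ω := setIntegral_closedBall_inner_sq_le he
  have hω0 : 0 < ω := hκ0.trans_le hκω
  refine ⟨ω, κ / ω, hω0, by positivity, (div_le_one hω0).2 hκω, fun T hT v R hR => ?_⟩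
  rcases lt_or_ge R ‖v - T.starProjection v‖ with h | h
  · rw [inter_closedBall_eq_empty h]
    refine ⟨by simp, fun α u => ?_⟩
    rw [discMoment, discRadius_eq_zero hR h.le, zero_pow (by omega)]
    simp
  -- a linear isometry from the model space onto `T`
  set b := (stdOrthonormalBasis ℝ T).reindex (finCongr hT) with hb
  set j : EuclideanSpace ℝ (Fin d) →ₗᵢ[ℝ] E := T.subtypeₗᵢ.comp b.repr.symm.toLinearIsometry with hj
  have hjT : ∀ w ∈ T, ∃ z, j z = w := fun w hw => ⟨b.repr ⟨w, hw⟩, by simp [hj]⟩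
  have hrange : range j = (T : Set E) := by
    ext w
    constructor
    · rintro ⟨z, rfl⟩
      exact (b.repr.symm z).2
    · exact fun hw => hjT w hw
  have hmap := j.isometry.map_hausdorffMeasure (d := (d : ℝ)) (Or.inl (Nat.cast_nonneg d))
  have hemb : MeasurableEmbedding j := j.isometry.isClosedEmbedding.measurableEmbedding
  obtain ⟨q, hq⟩ := hjT _ (T.starProjection_apply_mem v)
  rw [inter_closedBall_eq hR h, ← hq]
  set R' := discRadius T v R with hR'
  have hR'0 : 0 ≤ R' := Real.sqrt_nonneg _
  have hpre : j ⁻¹' closedBall (j q) R' = closedBall q R' := by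
    ext z
    rw [mem_preimage, mem_closedBall, mem_closedBall, j.isometry.dist_eq]
  have hrestr : (μH[(d : ℝ)] : Measure E).restrict ((T : Set E) ∩ closedBall (j q) R') =
      (Measure.map j μH[(d : ℝ)]).restrict (closedBall (j q) R') := by
    rw [hmap, Measure.restrict_restrict measurableSet_closedBall, hrange, inter_comm]
  constructor
  · have h1 : μH[(d : ℝ)] ((T : Set E) ∩ closedBall (j q) R') =
        Measure.map j μH[(d : ℝ)] (closedBall (j q) R') := by
      rw [← Measure.restrict_apply_univ, hrestr, Measure.restrict_apply_univ]
    rw [h1, hemb.map_apply, hpre]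
    exact measure_closedBall_hausdorff_lt_top q R'
  · intro α u
    obtain ⟨a, ha⟩ := hjT _ (T.starProjection_apply_mem u)
    have hinner : ∀ z, ⟪j z, u⟫ = ⟪z, a⟫ := by
      intro z
      have hz : j z ∈ T := by
        have := mem_range_self (f := j) z
        rwa [hrange] at this
      rw [← j.inner_map_map z a, ha, real_inner_comm, ← inner_starProjection_of_mem u hz,
        real_inner_comm]
    rw [hrestr, hemb.setIntegral_map, hpre]
    simp only [hinner]
    rw [setIntegral_closedBall_sq hd he q hR'0, discMoment, ← hR', ← hq, hinner, ← ha,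
      j.norm_map, ← hω, ← hκ]
    field_simp

end Discs

/-! ### Hausdorff measure of a surface in small balls -/

section Population

open Set Filter Metric Topology

variable {E : Type*} [NormedAddCommGroup E] [InnerProductSpace ℝ E] [FiniteDimensional ℝ E]

/-- Near `p` the projection to the tangent space at `p` distorts distances in `S` by a factor
`1 + O(l)`. -/
theorem HasUniformTangents.norm_sub_le_mul_norm_starProjection {d : ℕ} {S : Set E}
    {T : E → Submodule ℝ E} {K : ℝ} (h : HasUniformTangents d S T K) {p x y : E} (hp : p ∈ S)
    (hx : x ∈ S) (hy : y ∈ S) {l : ℝ} (hl : 6 * K * l ≤ 1) (hxl : ‖x - p‖ ≤ l)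
    (hyl : ‖y - p‖ ≤ l) :
    ‖x - y‖ ≤ (1 + 6 * K * l) * ‖(T p).starProjection (x - y)‖ := by
  have hK := h.one_le
  have hl0 : 0 ≤ l := (norm_nonneg _).trans hxl
  have hxy : ‖x - y‖ ≤ 2 * l := by
    have := norm_sub_le_norm_sub_add_norm_sub x p y
    rw [norm_sub_rev p y] at this
    linarith
  have h1 := h.near y hy x hx
  have h2 := ((T y).starProjection - (T p).starProjection).le_opNorm (x - y)
  rw [sub_apply] at h2
  have h3 : ‖(T y).starProjection - (T p).starProjection‖ ≤ K * l :=
    (h.lipschitz y hy p hp).trans (by gcongr)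
  have h4 : ‖x - y‖ ≤ ‖(T p).starProjection (x - y)‖ +
      ‖(T y).starProjection (x - y) - (T p).starProjection (x - y)‖ +
      ‖(x - y) - (T y).starProjection (x - y)‖ := by
    have e : x - y = (T p).starProjection (x - y) +
      ((T y).starProjection (x - y) - (T p).starProjection (x - y)) +
      ((x - y) - (T y).starProjection (x - y)) := by abel
    conv_lhs => rw [e]
    exact norm_add₃_le
  have h5 : ‖(T y).starProjection (x - y) - (T p).starProjection (x - y)‖ ≤
      K * l * ‖x - y‖ := h2.trans (by gcongr)
  have h6 : K * ‖x - y‖ ^ 2 ≤ 2 * (K * l) * ‖x - y‖ := by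
    have : K * ‖x - y‖ ≤ 2 * (K * l) := by nlinarith
    nlinarith [norm_nonneg (x - y)]
  have h7 : (1 - 3 * (K * l)) * ‖x - y‖ ≤ ‖(T p).starProjection (x - y)‖ := by linarith
  have hKl : 0 ≤ K * l := by positivity
  have h8 : 1 ≤ (1 + 6 * K * l) * (1 - 3 * (K * l)) := by nlinarith
  calc ‖x - y‖ ≤ (1 + 6 * K * l) * (1 - 3 * (K * l)) * ‖x - y‖ :=
        le_mul_of_one_le_left (norm_nonneg _) h8
    _ = (1 + 6 * K * l) * ((1 - 3 * (K * l)) * ‖x - y‖) := by ring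
    _ ≤ _ := by gcongr

variable [MeasurableSpace E] [BorelSpace E]

section Comparison

variable {d : ℕ} {S : Set E} {T : E → Submodule ℝ E} {K : ℝ}

/-- The projection is `1`-Lipschitz and hits the disc, so it does not increase the measure. -/
theorem HasUniformTangents.hausdorffMeasure_disc_le (h : HasUniformTangents d S T K) {p : E}
    (hp : p ∈ S) {l : ℝ} (hl : 6 * K * l ≤ 1) {A : Set E} (hA : A ⊆ closedBall 0 (l / 2)) :
    μH[(d : ℝ)] ((T p : Set E) ∩ A) ≤ μH[(d : ℝ)]
      ((S ∩ closedBall p l) ∩ (fun x => (T p).starProjection (x - p)) ⁻¹' A) := by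
  set g : E → E := fun x => (T p).starProjection (x - p) with hg
  have hgl : LipschitzWith 1 g := by
    refine LipschitzWith.of_dist_le_mul fun x y => ?_
    rw [hg, dist_eq_norm, dist_eq_norm, NNReal.coe_one, one_mul, ← map_sub, sub_sub_sub_cancel_right]
    exact (T p).norm_starProjection_apply_le _
  have hsub : (T p : Set E) ∩ A ⊆ g '' ((S ∩ closedBall p l) ∩ g ⁻¹' A) := by
    rintro w ⟨hwT, hwA⟩
    have hw : ‖w‖ ≤ l / 2 := mem_closedBall_zero_iff.1 (hA hwA)
    have hK := h.one_le
    have hl0 : 0 ≤ l := by linarith [norm_nonneg w]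
    have hKw : K * ‖w‖ ≤ 1 := by
      have : K * ‖w‖ ≤ K * (l / 2) := by gcongr
      nlinarith [mul_nonneg (by linarith : (0 : ℝ) ≤ K) hl0]
    obtain ⟨y, hyS, hyw, hyn⟩ := h.lift p hp w hwT hKw
    refine ⟨y, ⟨⟨hyS, ?_⟩, ?_⟩, hyw⟩
    · rw [mem_closedBall, dist_eq_norm]; linarith
    · rw [mem_preimage, hg]; simpa only [hyw] using hwA
  calc _ ≤ μH[(d : ℝ)] (g '' ((S ∩ closedBall p l) ∩ g ⁻¹' A)) := measure_mono hsub
    _ ≤ _ := by simpa using hgl.hausdorffMeasure_image_le (Nat.cast_nonneg d) _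

/-- The inverse of the projection is Lipschitz with constant `1 + O(l)`. -/
theorem HasUniformTangents.hausdorffMeasure_le_disc (h : HasUniformTangents d S T K) {p : E}
    (hp : p ∈ S) {l : ℝ} (hl0 : 0 ≤ l) (hl : 6 * K * l ≤ 1) (A : Set E) :
    μH[(d : ℝ)] ((S ∩ closedBall p l) ∩ (fun x => (T p).starProjection (x - p)) ⁻¹' A) ≤
      ENNReal.ofReal ((1 + 6 * K * l) ^ d) * μH[(d : ℝ)] ((T p : Set E) ∩ A) := by
  set g : E → E := fun x => (T p).starProjection (x - p) with hg
  set Y := (S ∩ closedBall p l) ∩ g ⁻¹' A with hY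
  have hK := h.one_le
  set f := Function.invFunOn g Y with hf
  have hfY : ∀ w ∈ g '' Y, f w ∈ Y ∧ g (f w) = w := fun w hw =>
    ⟨Function.invFunOn_mem hw, Function.invFunOn_eq hw⟩
  have hanti : ∀ x ∈ Y, ∀ y ∈ Y, ‖x - y‖ ≤ (1 + 6 * K * l) * ‖g x - g y‖ := by
    intro x hx y hy
    have := h.norm_sub_le_mul_norm_starProjection hp hx.1.1 hy.1.1 hl
      (by rw [← dist_eq_norm]; exact hx.1.2) (by rw [← dist_eq_norm]; exact hy.1.2)
    rwa [hg, ← map_sub, sub_sub_sub_cancel_right]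
  have hlip : LipschitzOnWith (Real.toNNReal (1 + 6 * K * l)) f (g '' Y) := by
    refine LipschitzOnWith.of_dist_le_mul fun w hw w' hw' => ?_
    rw [dist_eq_norm, dist_eq_norm, Real.coe_toNNReal _ (by positivity)]
    have := hanti _ (hfY w hw).1 _ (hfY w' hw').1
    rwa [(hfY w hw).2, (hfY w' hw').2] at this
  have hsub : Y ⊆ f '' (g '' Y) := by
    intro x hx
    refine ⟨g x, mem_image_of_mem g hx, ?_⟩
    have h1 := hfY (g x) (mem_image_of_mem g hx)
    have h2 := hanti _ h1.1 _ hx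
    rw [h1.2, sub_self, norm_zero, mul_zero] at h2
    exact sub_eq_zero.1 (norm_le_zero_iff.1 h2)
  have hgY : g '' Y ⊆ (T p : Set E) ∩ A := by
    rintro _ ⟨x, hx, rfl⟩
    exact ⟨(T p).starProjection_apply_mem _, hx.2⟩
  calc μH[(d : ℝ)] Y ≤ μH[(d : ℝ)] (f '' (g '' Y)) := measure_mono hsub
    _ ≤ (Real.toNNReal (1 + 6 * K * l) : ENNReal) ^ (d : ℝ) * μH[(d : ℝ)] (g '' Y) :=
        hlip.hausdorffMeasure_image_le (Nat.cast_nonneg d)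
    _ ≤ _ := by
        rw [ENNReal.rpow_natCast, ENNReal.ofReal_pow (by positivity)]
        gcongr
        exact le_rfl

/-- Integrals over a piece of `S` of functions of the projection to the tangent space, compared with
integrals over the tangent space. -/
theorem HasUniformTangents.setIntegral_comp_bounds (h : HasUniformTangents d S T K) {p : E}
    (hp : p ∈ S) {l : ℝ} (hl0 : 0 ≤ l) (hl : 6 * K * l ≤ 1) {B : Set E} (hB : MeasurableSet B)
    (hBl : B ⊆ closedBall 0 (l / 2)) (hfin : μH[(d : ℝ)] ((T p : Set E) ∩ B) < ⊤) {F : E → ℝ}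
    (hF : Continuous F) (hF0 : ∀ w, 0 ≤ F w) :
    ∫ w in (T p : Set E) ∩ B, F w ∂μH[(d : ℝ)] ≤
        ∫ x in (S ∩ closedBall p l) ∩ (fun x => (T p).starProjection (x - p)) ⁻¹' B,
          F ((T p).starProjection (x - p)) ∂μH[(d : ℝ)] ∧
      ∫ x in (S ∩ closedBall p l) ∩ (fun x => (T p).starProjection (x - p)) ⁻¹' B,
          F ((T p).starProjection (x - p)) ∂μH[(d : ℝ)] ≤
        (1 + 6 * K * l) ^ d * ∫ w in (T p : Set E) ∩ B, F w ∂μH[(d : ℝ)] := by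
  set g : E → E := fun x => (T p).starProjection (x - p) with hg
  have hK := h.one_le
  have hgc : Continuous g := by fun_prop
  have hgm : Measurable g := hgc.measurable
  set X := S ∩ closedBall p l with hX
  have hXm : MeasurableSet X := h.isCompact.measurableSet.inter measurableSet_closedBall
  have hTm : MeasurableSet (T p : Set E) := (T p).closed_of_finiteDimensional.measurableSet
  set ν := Measure.map g ((μH[(d : ℝ)] : Measure E).restrict X) with hν
  set θ := ENNReal.ofReal ((1 + 6 * K * l) ^ d) with hθ
  set lam := (μH[(d : ℝ)] : Measure E).restrict ((T p : Set E) ∩ B) with hlam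
  have hνB : ∀ A, MeasurableSet A → ν.restrict B A = μH[(d : ℝ)] (X ∩ g ⁻¹' (B ∩ A)) := by
    intro A hA
    rw [Measure.restrict_apply hA, hν, Measure.map_apply hgm (hA.inter hB),
      Measure.restrict_apply (hgm (hA.inter hB)), inter_comm X, inter_comm A]
  have hlamA : ∀ A, MeasurableSet A → lam A = μH[(d : ℝ)] ((T p : Set E) ∩ (B ∩ A)) := by
    intro A hA
    rw [hlam, Measure.restrict_apply hA, inter_comm A, inter_assoc]
  have hle₁ : lam ≤ ν.restrict B := by
    rw [Measure.le_iff]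
    intro A hA
    rw [hνB A hA, hlamA A hA]
    exact h.hausdorffMeasure_disc_le hp hl (inter_subset_left.trans hBl)
  have hle₂ : ν.restrict B ≤ θ • lam := by
    rw [Measure.le_iff]
    intro A hA
    rw [hνB A hA, Measure.smul_apply, hlamA A hA, smul_eq_mul]
    exact h.hausdorffMeasure_le_disc hp hl0 hl _
  have hint : ∫ x in X ∩ g ⁻¹' B, F (g x) ∂μH[(d : ℝ)] = ∫ w in B, F w ∂ν := by
    rw [hν, setIntegral_map hB hF.aestronglyMeasurable hgm.aemeasurable,
      Measure.restrict_restrict (hgm hB), inter_comm]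
  -- `F` is bounded on the bounded set `B`
  obtain ⟨M, hM⟩ := (isCompact_closedBall (0 : E) (l / 2)).exists_bound_of_continuousOn hF.continuousOn
  have hFl : Integrable F lam := by
    refine Measure.integrableOn_of_bounded (M := M) hfin.ne hF.aestronglyMeasurable ?_
    filter_upwards [ae_restrict_mem (hTm.inter hB)] with w hw
    exact hM w (hBl hw.2)
  have hFθ : Integrable F (θ • lam) := hFl.smul_measure ENNReal.ofReal_ne_top
  have hFν : Integrable F (ν.restrict B) := hFθ.mono_measure hle₂
  rw [hint]
  constructor
  · exact integral_mono_measure hle₁ (Eventually.of_forall hF0) hFν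
  · refine (integral_mono_measure hle₂ (Eventually.of_forall hF0) hFθ).trans ?_
    rw [integral_smul_measure, hθ, ENNReal.toReal_ofReal (by positivity), smul_eq_mul]

end Comparison

/-- The integral formula for discs: `ω` is the volume of the `d`-dimensional unit disc and `c` the
variance of a coordinate on it. -/
structure DiscFormula (E : Type*) [NormedAddCommGroup E] [InnerProductSpace ℝ E]
    [FiniteDimensional ℝ E] [MeasurableSpace E] [BorelSpace E] (d : ℕ) (ω c : ℝ) : Prop where
  vol_pos : 0 < ω
  var_pos : 0 < c
  var_le_one : c ≤ 1
  measure_lt_top : ∀ T : Submodule ℝ E, finrank ℝ T = d → ∀ (v : E) (R : ℝ), 0 ≤ R →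
    μH[(d : ℝ)] ((T : Set E) ∩ closedBall v R) < ⊤
  integral_eq : ∀ T : Submodule ℝ E, finrank ℝ T = d → ∀ (v : E) (R : ℝ), 0 ≤ R →
    ∀ (α : ℝ) (u : E), ∫ w in (T : Set E) ∩ closedBall v R, (α + ⟪w, u⟫) ^ 2 ∂μH[(d : ℝ)] =
      ω * discMoment d c T v R α u

theorem exists_discFormula (E : Type*) [NormedAddCommGroup E] [InnerProductSpace ℝ E]
    [FiniteDimensional ℝ E] [MeasurableSpace E] [BorelSpace E] {d : ℕ} (hd : 1 ≤ d) :
    ∃ ω c : ℝ, DiscFormula E d ω c := by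
  obtain ⟨ω, c, hω, hc, hc1, h⟩ := exists_setIntegral_disc_eq E hd
  exact ⟨ω, c, hω, hc, hc1, fun T hT v R hR => (h T hT v R hR).1,
    fun T hT v R hR => (h T hT v R hR).2⟩

omit [MeasurableSpace E] [BorelSpace E]

theorem discRadius_nonneg (T : Submodule ℝ E) (v : E) (R : ℝ) : 0 ≤ discRadius T v R :=
  Real.sqrt_nonneg _

theorem discRadius_le (T : Submodule ℝ E) (v : E) {R : ℝ} (hR : 0 ≤ R) : discRadius T v R ≤ R := by
  refine Real.sqrt_le_iff.2 ⟨hR, ?_⟩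
  linarith [sq_nonneg ‖v - T.starProjection v‖]

theorem discRadius_mono (T : Submodule ℝ E) (v : E) {R R' : ℝ} (hR : 0 ≤ R) (h : R ≤ R') :
    discRadius T v R ≤ discRadius T v R' := by
  unfold discRadius
  gcongr

theorem discMoment_mono (d : ℕ) {c : ℝ} (hc : 0 ≤ c) (T : Submodule ℝ E) (v : E) {R R' : ℝ}
    (hR : 0 ≤ R) (h : R ≤ R') (α : ℝ) (u : E) :
    discMoment d c T v R α u ≤ discMoment d c T v R' α u := by
  have h1 := discRadius_mono T v hR h
  have h2 := discRadius_nonneg T v R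
  have h3 := discRadius_nonneg T v R'
  unfold discMoment
  gcongr

theorem discMoment_le {d : ℕ} {c : ℝ} (hc : 0 ≤ c) (hc1 : c ≤ 1) (T : Submodule ℝ E) (v : E)
    {R : ℝ} (hR : 0 ≤ R) (α : ℝ) (u : E) :
    discMoment d c T v R α u ≤ R ^ d * ((|α| + ‖v‖ * ‖u‖) ^ 2 + (R * ‖u‖) ^ 2) := by
  have h1 := discRadius_nonneg T v R
  have h2 := discRadius_le T v hR
  have h3 : |α + ⟪T.starProjection v, u⟫| ≤ |α| + ‖v‖ * ‖u‖ := by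
    refine (abs_add_le _ _).trans (add_le_add_right ((abs_real_inner_le_norm _ _).trans ?_) _)
    gcongr
    exact T.norm_starProjection_apply_le v
  have h4 : (α + ⟪T.starProjection v, u⟫) ^ 2 ≤ (|α| + ‖v‖ * ‖u‖) ^ 2 := by
    rw [← sq_abs (α + _)]; gcongr
  have h5 := T.norm_starProjection_apply_le u
  unfold discMoment
  have h6 : c * discRadius T v R ^ 2 * ‖T.starProjection u‖ ^ 2 ≤ 1 * R ^ 2 * ‖u‖ ^ 2 := by
    gcongr
  have h7 : 0 ≤ c * discRadius T v R ^ 2 * ‖T.starProjection u‖ ^ 2 := by positivity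
  refine mul_le_mul (by gcongr) ?_ (by positivity) (by positivity)
  rw [mul_pow]
  linarith

theorem one_add_pow_le_one_add_two_pow_mul (d : ℕ) {x : ℝ} (h0 : 0 ≤ x) (h1 : x ≤ 1) :
    (1 + x) ^ d ≤ 1 + 2 ^ d * x := by
  have key : (1 + x) ^ d ≤ 1 + (2 ^ d - 1) * x := by
    induction d with
    | zero => simp
    | succ k ih =>
      have h2 : (1 : ℝ) ≤ 2 ^ k := one_le_pow₀ (by norm_num)
      calc (1 + x) ^ (k + 1) = (1 + x) ^ k * (1 + x) := pow_succ _ _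
        _ ≤ (1 + (2 ^ k - 1) * x) * (1 + x) := by gcongr
        _ ≤ 1 + (2 ^ (k + 1) - 1) * x := by
          rw [pow_succ]
          nlinarith [mul_nonneg (mul_nonneg h0 (by linarith : 0 ≤ 1 - x))
            (by linarith : (0 : ℝ) ≤ 2 ^ k - 1)]
  linarith

end Population

section PopulationBounds

open Set Filter Metric Topology

variable {E : Type*} [NormedAddCommGroup E] [InnerProductSpace ℝ E] [FiniteDimensional ℝ E]
  [MeasurableSpace E] [BorelSpace E]

set_option maxHeartbeats 1600000 in
/-- The second moments of a surface over a ball of radius comparable to `r` are those of a tangent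
disc, up to a relative error `O(r)` and a change of the radius by `O(r ^ 2)`: projecting to the
tangent space at `p` moves points by `O(r ^ 2)` and distorts lengths by a factor `1 + O(r)`. The
base point `p` may differ from the centre `v`. -/
theorem exists_population_bounds {d : ℕ} {ω c : ℝ} (hω : DiscFormula E d ω c)
    {M K : ℝ} (hM : 1 ≤ M) (hK : 1 ≤ K) :
    ∃ C : ℝ, 1 ≤ C ∧ ∀ (S : Set E) (T : E → Submodule ℝ E), HasUniformTangents d S T K →
      ∀ p ∈ S, ∀ r, 0 < r → 2 * C * r ≤ 1 → ∀ v, ‖v - p‖ ≤ M * r → ∀ R, r / 2 ≤ R → R ≤ 2 * r →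
        μH[(d : ℝ)] (S ∩ closedBall v R) < ⊤ ∧ ∀ (α : ℝ) (u : E), |α| ≤ M → ‖u‖ * r ≤ 1 →
          ω * discMoment d c (T p) (v - p) (R - C * r ^ 2) α u - C * r ^ (d + 1) ≤
            ∫ x in S ∩ closedBall v R, (α + ⟪x - p, u⟫) ^ 2 ∂μH[(d : ℝ)] ∧
          ∫ x in S ∩ closedBall v R, (α + ⟪x - p, u⟫) ^ 2 ∂μH[(d : ℝ)] ≤
            ω * discMoment d c (T p) (v - p) (R + C * r ^ 2) α u + C * r ^ (d + 1) := by
  have hω0 := hω.vol_pos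
  set N := M + 3 with hN
  set C₁ := 2 * (3 * M + 6) * (4 * K * N ^ 2) with hC₁
  set θ₁ := 2 ^ d * (12 * K * N) with hθ₁
  set Q := 4 * M ^ 2 + 9 with hQ
  set C := 16 * K * N ^ 2 + ω * 3 ^ d * (θ₁ * Q + 2 ^ d * C₁) with hC
  have hN0 : 4 ≤ N := by linarith
  have hC₁0 : 0 ≤ C₁ := by positivity
  have hQ0 : 0 ≤ Q := by positivity
  have hθ₁0 : 0 ≤ θ₁ := by positivity
  have hCerr : 0 ≤ ω * 3 ^ d * (θ₁ * Q + 2 ^ d * C₁) := by positivity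
  have hKN : 16 ≤ 16 * K * N ^ 2 := by nlinarith [mul_nonneg (sub_nonneg.2 hK) (sq_nonneg N)]
  refine ⟨C, by linarith, ?_⟩
  intro S T hS p hp r hr hCr v hv R hR₁ hR₂
  have hCr2 : C * r ^ 2 ≤ r / 2 := by
    have : 2 * C * r * r ≤ 1 * r := mul_le_mul_of_nonneg_right hCr hr.le
    linarith
  clear_value C Q θ₁ C₁ N
  -- everything happens within distance `l` of `p`; `b` bounds the distance to the tangent space
  set l := 2 * N * r with hl
  have hl0 : 0 ≤ l := by positivity
  set b := K * l ^ 2 with hb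
  have hbr : b = 4 * K * N ^ 2 * r ^ 2 := by rw [hb, hl]; ring
  have hb0 : 0 ≤ b := by positivity
  have hr16 : 16 * K * N ^ 2 * r ≤ 1 := by
    have : 16 * K * N ^ 2 * r ≤ C * r := by gcongr; linarith
    have : 0 ≤ C * r := by
      have : 0 ≤ C := by linarith
      positivity
    linarith
  have hb4 : b ≤ r / 4 := by
    have : 16 * K * N ^ 2 * r * r ≤ 1 * r := mul_le_mul_of_nonneg_right hr16 hr.le
    rw [hbr]; linarith
  have hbC : b ≤ C * r ^ 2 := by
    rw [hbr]
    have : 4 * K * N ^ 2 ≤ C := by linarith [mul_nonneg (by linarith : 0 ≤ K) (sq_nonneg N)]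
    gcongr
  have h6 : 6 * K * l ≤ 1 := by
    have h1 : 6 * K * l = 12 * K * N * r := by rw [hl]; ring
    have h2 : 12 * K * N * r ≤ 16 * K * N ^ 2 * r := by
      have : 12 * (K * N) ≤ 16 * (K * N) * N := by
        nlinarith [mul_nonneg (by linarith : 0 ≤ K) (by linarith : 0 ≤ N)]
      nlinarith
    linarith
  set θ := (1 + 6 * K * l) ^ d with hθ
  have hθ1 : θ ≤ 1 + θ₁ * r := by
    have := one_add_pow_le_one_add_two_pow_mul d (by positivity : 0 ≤ 6 * K * l) h6
    refine this.trans (le_of_eq ?_)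
    rw [hθ₁, hl]; ring
  have hθ2 : θ ≤ 2 ^ d := by rw [hθ]; gcongr; linarith
  have hθ0 : 0 ≤ θ := by positivity
  set g : E → E := fun x => (T p).starProjection (x - p) with hg
  set X := S ∩ closedBall p l with hX
  have hTfin := hS.finrank_eq p hp
  have hgnear : ∀ x ∈ X, ‖x - p - g x‖ ≤ b := by
    intro x hx
    have h1 := hS.near p hp x hx.1
    have h2 : ‖x - p‖ ≤ l := by rw [← dist_eq_norm]; exact hx.2
    exact h1.trans (by rw [hb]; gcongr)
  -- the projection moves the points of `X` by at most `b`, so `S ∩ closedBall v R` lies between the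
  -- preimages of the balls of radius `R - b` and `R + b`
  set Bp := closedBall (v - p) (R + b) with hBp
  set Bm := closedBall (v - p) (R - b) with hBm
  have hRm : 0 ≤ R - b := by linarith
  have hBpl : Bp ⊆ closedBall 0 (l / 2) := by
    intro w hw
    rw [hBp, mem_closedBall, dist_eq_norm] at hw
    rw [mem_closedBall_zero_iff]
    have := norm_add_le (w - (v - p)) (v - p)
    rw [sub_add_cancel] at this
    have h2 : l / 2 = M * r + 3 * r := by rw [hl, hN]; ring
    linarith
  have hBmp : Bm ⊆ Bp := closedBall_subset_closedBall (by linarith)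
  have hSX : S ∩ closedBall v R ⊆ X ∩ g ⁻¹' Bp := by
    rintro x ⟨hxS, hxv⟩
    rw [mem_closedBall, dist_eq_norm] at hxv
    have hxp : ‖x - p‖ ≤ l := by
      have := norm_sub_le_norm_sub_add_norm_sub x v p
      have h2 : l = 2 * (M * r) + 6 * r := by rw [hl, hN]; ring
      nlinarith [mul_nonneg (by linarith : 0 ≤ M) hr.le]
    have hxX : x ∈ X := ⟨hxS, by rw [mem_closedBall, dist_eq_norm]; exact hxp⟩
    refine ⟨hxX, ?_⟩
    rw [mem_preimage, hBp, mem_closedBall, dist_eq_norm]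
    have h1 : g x - (v - p) = (x - v) - (x - p - g x) := by abel
    rw [h1]
    exact (norm_sub_le _ _).trans (add_le_add hxv (hgnear x hxX))
  have hXS : X ∩ g ⁻¹' Bm ⊆ S ∩ closedBall v R := by
    rintro x ⟨hxX, hxB⟩
    refine ⟨hxX.1, ?_⟩
    rw [mem_preimage, hBm, mem_closedBall, dist_eq_norm] at hxB
    rw [mem_closedBall, dist_eq_norm]
    have h1 : x - v = (g x - (v - p)) + (x - p - g x) := by abel
    rw [h1]
    exact (norm_add_le _ _).trans (by linarith [hgnear x hxX])
  have hfinp : μH[(d : ℝ)] ((T p : Set E) ∩ Bp) < ⊤ :=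
    hω.measure_lt_top _ hTfin _ _ (by linarith)
  have hfinX : μH[(d : ℝ)] (X ∩ g ⁻¹' Bp) < ⊤ :=
    (hS.hausdorffMeasure_le_disc hp hl0 h6 Bp).trans_lt
      (ENNReal.mul_lt_top ENNReal.ofReal_lt_top hfinp)
  have hfinS := (measure_mono hSX).trans_lt hfinX
  refine ⟨hfinS, fun α u hα hu => ?_⟩
  have hgm : Measurable g := by
    have : Continuous g := by fun_prop
    exact this.measurable
  have hXm : MeasurableSet X := hS.isCompact.measurableSet.inter measurableSet_closedBall
  have hYp : MeasurableSet (X ∩ g ⁻¹' Bp) := hXm.inter (hgm measurableSet_closedBall)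
  have hYm : MeasurableSet (X ∩ g ⁻¹' Bm) := hXm.inter (hgm measurableSet_closedBall)
  have hSm : MeasurableSet (S ∩ closedBall v R) :=
    hS.isCompact.measurableSet.inter measurableSet_closedBall
  -- the integrand changes little under the projection
  have hnu : ∀ {x t : ℝ}, 0 ≤ x → x ≤ t * r → x * ‖u‖ ≤ t := by
    intro x t hx hxt
    have h1 : x * ‖u‖ ≤ t * r * ‖u‖ := mul_le_mul_of_nonneg_right hxt (norm_nonneg _)
    have ht : 0 ≤ t := nonneg_of_mul_nonneg_left (hx.trans hxt) hr
    have h2 : t * (‖u‖ * r) ≤ t * 1 := mul_le_mul_of_nonneg_left hu ht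
    calc x * ‖u‖ ≤ t * r * ‖u‖ := h1
      _ = t * (‖u‖ * r) := by ring
      _ ≤ t := by rw [mul_one] at h2; exact h2
  have hval : ∀ w : E, ‖w‖ ≤ l → |α + ⟪w, u⟫| ≤ 3 * M + 6 := by
    intro w hw
    have h1 := abs_add_le α ⟪w, u⟫
    have h2 := abs_real_inner_le_norm w u
    have h3 := hnu (norm_nonneg w) hw
    rw [hN] at h3
    linarith
  have hdiff : ∀ x ∈ X, |(α + ⟪x - p, u⟫) ^ 2 - (α + ⟪g x, u⟫) ^ 2| ≤ C₁ * r := by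
    intro x hx
    have h2 : ‖x - p‖ ≤ l := by rw [← dist_eq_norm]; exact hx.2
    have h3 := hval _ h2
    have h4 := hval _ (((T p).norm_starProjection_apply_le (x - p)).trans h2)
    have h5 : (α + ⟪x - p, u⟫) ^ 2 - (α + ⟪g x, u⟫) ^ 2 =
        ⟪x - p - g x, u⟫ * ((α + ⟪x - p, u⟫) + (α + ⟪g x, u⟫)) := by
      rw [inner_sub_left (x - p) (g x) u]; ring
    rw [h5, abs_mul]
    have h6 : |⟪x - p - g x, u⟫| ≤ 4 * K * N ^ 2 * r := by
      refine (abs_real_inner_le_norm _ _).trans (hnu (norm_nonneg _) ((hgnear x hx).trans ?_))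
      rw [hbr]; exact le_of_eq (by ring)
    have h7 : |(α + ⟪x - p, u⟫) + (α + ⟪g x, u⟫)| ≤ 2 * (3 * M + 6) :=
      (abs_add_le _ _).trans (by linarith)
    calc _ ≤ (4 * K * N ^ 2 * r) * (2 * (3 * M + 6)) :=
          mul_le_mul h6 h7 (abs_nonneg _) (by positivity)
      _ = C₁ * r := by rw [hC₁]; ring
  have hGc : Continuous fun x => (α + ⟪g x, u⟫) ^ 2 := by fun_prop
  have hFc : Continuous fun x => (α + ⟪x - p, u⟫) ^ 2 := by fun_prop
  have hint : ∀ {f : E → ℝ} {Y : Set E}, Continuous f → MeasurableSet Y → Y ⊆ X ∩ g ⁻¹' Bp →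
      IntegrableOn f Y μH[(d : ℝ)] := by
    intro f Y hf hY hYX
    obtain ⟨B, hB⟩ := (isCompact_closedBall p l).exists_bound_of_continuousOn hf.continuousOn
    refine Measure.integrableOn_of_bounded (M := B) ((measure_mono hYX).trans_lt hfinX).ne
      hf.aestronglyMeasurable ?_
    filter_upwards [ae_restrict_mem hY] with x hx
    exact hB x (hYX hx).1.2
  have hcomp := fun (B : Set E) (hB : MeasurableSet B) (hBp : B ⊆ Bp) (β : ℝ) (w : E) =>
    hS.setIntegral_comp_bounds hp hl0 h6 hB (hBp.trans hBpl)
      ((measure_mono (inter_subset_inter_right _ hBp)).trans_lt hfinp)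
      (F := fun x => (β + ⟪x, w⟫) ^ 2) (by fun_prop) (fun _ => sq_nonneg _)
  have hone : ∀ R', 0 ≤ R' → R' ≤ 3 * r → ω * discMoment d c (T p) (v - p) R' 1 0 ≤
      ω * (3 ^ d * r ^ d) := by
    intro R' h0 h1
    have h2 := discMoment_le (d := d) hω.var_pos.le hω.var_le_one (T p) (v - p) h0 1 0
    have h3 : R' ^ d ≤ 3 ^ d * r ^ d := by rw [← mul_pow]; gcongr
    simp only [norm_zero, mul_zero, add_zero, abs_one, one_pow, zero_pow two_ne_zero, mul_one] at h2
    gcongr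
    exact h2.trans h3
  have hmass : (μH[(d : ℝ)] : Measure E).real (X ∩ g ⁻¹' Bp) ≤ 2 ^ d * (ω * (3 ^ d * r ^ d)) := by
    have h1 := (hcomp Bp measurableSet_closedBall subset_rfl 1 0).2
    rw [hω.integral_eq _ hTfin _ _ (by linarith : 0 ≤ R + b)] at h1
    have h2 := hone (R + b) (by linarith) (by linarith)
    have h3 : ∫ x in X ∩ g ⁻¹' Bp, (1 + ⟪g x, (0 : E)⟫) ^ 2 ∂μH[(d : ℝ)] =
        (μH[(d : ℝ)] : Measure E).real (X ∩ g ⁻¹' Bp) := by simp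
    rw [← h3]
    refine h1.trans (mul_le_mul hθ2 h2 ?_ (by positivity))
    have h4 : 0 ≤ discMoment d c (T p) (v - p) (R + b) 1 0 := by
      have := discRadius_nonneg (T p) (v - p) (R + b)
      have := hω.var_pos
      unfold discMoment
      positivity
    positivity
  have hmassm : (μH[(d : ℝ)] : Measure E).real (X ∩ g ⁻¹' Bm) ≤ 2 ^ d * (ω * (3 ^ d * r ^ d)) :=
    (measureReal_mono (inter_subset_inter_right _ (preimage_mono hBmp)) hfinX.ne).trans hmass
  have hCfin : C₁ * r * (2 ^ d * (ω * (3 ^ d * r ^ d))) ≤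
      (ω * 3 ^ d * (2 ^ d * C₁)) * r ^ (d + 1) := le_of_eq (by ring)
  constructor
  · have h1 := (hcomp Bm measurableSet_closedBall hBmp α u).1
    rw [hω.integral_eq _ hTfin _ _ hRm] at h1
    have h2 : ∫ x in X ∩ g ⁻¹' Bm, ((α + ⟪g x, u⟫) ^ 2 - C₁ * r) ∂μH[(d : ℝ)] ≤
        ∫ x in X ∩ g ⁻¹' Bm, (α + ⟪x - p, u⟫) ^ 2 ∂μH[(d : ℝ)] := by
      have hsub := inter_subset_inter_right X (preimage_mono hBmp : g ⁻¹' Bm ⊆ g ⁻¹' Bp)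
      refine setIntegral_mono_on (hint (by fun_prop) hYm hsub) (hint hFc hYm hsub) hYm ?_
      intro x hx
      linarith [(abs_le.1 (hdiff x hx.1)).1]
    have h3 : ∫ x in X ∩ g ⁻¹' Bm, (α + ⟪x - p, u⟫) ^ 2 ∂μH[(d : ℝ)] ≤
        ∫ x in S ∩ closedBall v R, (α + ⟪x - p, u⟫) ^ 2 ∂μH[(d : ℝ)] :=
      setIntegral_mono_set (hint hFc hSm hSX) (Eventually.of_forall fun _ => sq_nonneg _)
        hXS.eventuallyLE
    have h4 : ∫ x in X ∩ g ⁻¹' Bm, ((α + ⟪g x, u⟫) ^ 2 - C₁ * r) ∂μH[(d : ℝ)] =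
        ∫ x in X ∩ g ⁻¹' Bm, (α + ⟪g x, u⟫) ^ 2 ∂μH[(d : ℝ)] -
          C₁ * r * (μH[(d : ℝ)] : Measure E).real (X ∩ g ⁻¹' Bm) := by
      have hsub := inter_subset_inter_right X (preimage_mono hBmp : g ⁻¹' Bm ⊆ g ⁻¹' Bp)
      rw [integral_sub (hint hGc hYm hsub) (hint continuous_const hYm hsub), setIntegral_const,
        smul_eq_mul, mul_comm]
    have h5 : C₁ * r * (μH[(d : ℝ)] : Measure E).real (X ∩ g ⁻¹' Bm) ≤ C * r ^ (d + 1) := by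
      refine (mul_le_mul_of_nonneg_left hmassm (by positivity)).trans (hCfin.trans ?_)
      gcongr
      have : 0 ≤ ω * 3 ^ d * (θ₁ * Q) := by positivity
      linarith
    have h6 : ω * discMoment d c (T p) (v - p) (R - C * r ^ 2) α u ≤
        ω * discMoment d c (T p) (v - p) (R - b) α u := by
      refine mul_le_mul_of_nonneg_left ?_ hω0.le
      exact discMoment_mono d hω.var_pos.le _ _ (by linarith) (by linarith) α u
    linarith
  · have h1 := (hcomp Bp measurableSet_closedBall subset_rfl α u).2
    rw [hω.integral_eq _ hTfin _ _ (by linarith : 0 ≤ R + b)] at h1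
    have h2 : ∫ x in X ∩ g ⁻¹' Bp, (α + ⟪x - p, u⟫) ^ 2 ∂μH[(d : ℝ)] ≤
        ∫ x in X ∩ g ⁻¹' Bp, ((α + ⟪g x, u⟫) ^ 2 + C₁ * r) ∂μH[(d : ℝ)] := by
      refine setIntegral_mono_on (hint hFc hYp subset_rfl) (hint (by fun_prop) hYp subset_rfl) hYp ?_
      intro x hx
      linarith [(abs_le.1 (hdiff x hx.1)).2]
    have h3 : ∫ x in S ∩ closedBall v R, (α + ⟪x - p, u⟫) ^ 2 ∂μH[(d : ℝ)] ≤
        ∫ x in X ∩ g ⁻¹' Bp, (α + ⟪x - p, u⟫) ^ 2 ∂μH[(d : ℝ)] :=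
      setIntegral_mono_set (hint hFc hYp subset_rfl) (Eventually.of_forall fun _ => sq_nonneg _)
        hSX.eventuallyLE
    have h4 : ∫ x in X ∩ g ⁻¹' Bp, ((α + ⟪g x, u⟫) ^ 2 + C₁ * r) ∂μH[(d : ℝ)] =
        ∫ x in X ∩ g ⁻¹' Bp, (α + ⟪g x, u⟫) ^ 2 ∂μH[(d : ℝ)] +
          C₁ * r * (μH[(d : ℝ)] : Measure E).real (X ∩ g ⁻¹' Bp) := by
      rw [integral_add (hint hGc hYp subset_rfl) (hint continuous_const hYp subset_rfl),
        setIntegral_const, smul_eq_mul, mul_comm (C₁ * r)]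
    have h5 := (mul_le_mul_of_nonneg_left hmass (by positivity : 0 ≤ C₁ * r)).trans hCfin
    have hdisc : discMoment d c (T p) (v - p) (R + b) α u ≤ 3 ^ d * r ^ d * Q := by
      refine (discMoment_le hω.var_pos.le hω.var_le_one (T p) (v - p) (by linarith) α u).trans ?_
      have e1 : (R + b) ^ d ≤ 3 ^ d * r ^ d := by
        rw [← mul_pow]
        exact pow_le_pow_left₀ (by linarith) (by linarith) d
      have e2 : ‖v - p‖ * ‖u‖ ≤ M := hnu (norm_nonneg _) hv
      have e3 : (R + b) * ‖u‖ ≤ 3 := hnu (by linarith) (by linarith)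
      have e4 : (|α| + ‖v - p‖ * ‖u‖) ^ 2 ≤ (M + M) ^ 2 := by gcongr
      have e5 : ((R + b) * ‖u‖) ^ 2 ≤ 3 ^ 2 :=
        pow_le_pow_left₀ (mul_nonneg (by linarith) (norm_nonneg _)) e3 2
      have e6 : (|α| + ‖v - p‖ * ‖u‖) ^ 2 + ((R + b) * ‖u‖) ^ 2 ≤ Q := by rw [hQ]; linarith
      exact mul_le_mul e1 e6 (by positivity) (by positivity)
    have hdisc0 : 0 ≤ discMoment d c (T p) (v - p) (R + b) α u := by
      have := discRadius_nonneg (T p) (v - p) (R + b)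
      have := hω.var_pos
      unfold discMoment
      positivity
    have h6 : θ * (ω * discMoment d c (T p) (v - p) (R + b) α u) ≤
        ω * discMoment d c (T p) (v - p) (R + b) α u + ω * 3 ^ d * (θ₁ * Q) * r ^ (d + 1) := by
      have e1 : θ * (ω * discMoment d c (T p) (v - p) (R + b) α u) ≤
          (1 + θ₁ * r) * (ω * discMoment d c (T p) (v - p) (R + b) α u) := by gcongr
      have e2 : θ₁ * r * (ω * discMoment d c (T p) (v - p) (R + b) α u) ≤
          θ₁ * r * (ω * (3 ^ d * r ^ d * Q)) := by gcongr
      have e3 : θ₁ * r * (ω * (3 ^ d * r ^ d * Q)) = ω * 3 ^ d * (θ₁ * Q) * r ^ (d + 1) := by ring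
      linarith
    have h7 : ω * discMoment d c (T p) (v - p) (R + b) α u ≤
        ω * discMoment d c (T p) (v - p) (R + C * r ^ 2) α u := by
      refine mul_le_mul_of_nonneg_left ?_ hω0.le
      exact discMoment_mono d hω.var_pos.le _ _ (by linarith) (by linarith) α u
    have h8 : ω * 3 ^ d * (θ₁ * Q) * r ^ (d + 1) + (ω * 3 ^ d * (2 ^ d * C₁)) * r ^ (d + 1) ≤
        C * r ^ (d + 1) := by
      rw [← add_mul]
      gcongr
      rw [hC]
      linarith
    linarith

end PopulationBounds

/-! ### Two surfaces crossing at a positive angle -/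

section CrossingSurfaces

open Set Filter Metric Topology

variable {E : Type*} [NormedAddCommGroup E] [InnerProductSpace ℝ E] [FiniteDimensional ℝ E]

/-- Two connected compact sets `S true` and `S false` with fields of tangent spaces `T k`, whose
curvature is at most `κ`, crossing quantitatively: away from the intersection the distance to the
other set grows linearly, and at each common point either tangent space has a unit vector at
distance at least `K⁻¹` from the other one. Rescaling the picture multiplies `κ` and leaves
`K` unchanged. -/
structure Crossing (d : ℕ) (S : Bool → Set E) (T : Bool → E → Submodule ℝ E) (κ K : ℝ) : Prop where
  isCompact : ∀ k, IsCompact (S k)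
  isPreconnected : ∀ k, IsPreconnected (S k)
  meet : (S true ∩ S false).Nonempty
  one_le : 1 ≤ K
  nonneg : 0 ≤ κ
  finrank_eq : ∀ k, ∀ s ∈ S k, finrank ℝ (T k s) = d
  near : ∀ k, ∀ s ∈ S k, ∀ y ∈ S k,
    ‖(y - s) - (T k s).starProjection (y - s)‖ ≤ κ * ‖y - s‖ ^ 2
  lipschitz : ∀ k, ∀ s ∈ S k, ∀ y ∈ S k,
    ‖(T k s).starProjection - (T k y).starProjection‖ ≤ κ * ‖s - y‖
  lift : ∀ k, ∀ s ∈ S k, ∀ w ∈ T k s, κ * ‖w‖ ≤ 1 →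
    ∃ y ∈ S k, (T k s).starProjection (y - s) = w ∧ ‖y - s‖ ≤ 2 * ‖w‖
  regular : ∀ k, ∀ s ∈ S k, infDist s (S true ∩ S false) ≤ K * infDist s (S (!k))
  angle : ∀ k, ∀ p ∈ S true ∩ S false,
    ∃ e ∈ T k p, ‖e‖ = 1 ∧ 1 ≤ K * ‖e - (T (!k) p).starProjection e‖

namespace Crossing

variable {d : ℕ} {S : Bool → Set E} {T : Bool → E → Submodule ℝ E} {κ K : ℝ}

theorem mem_of_mem_inter {S : Bool → Set E} {p : E} (hp : p ∈ S true ∩ S false) (k : Bool) :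
    p ∈ S k := by
  cases k
  · exact hp.2
  · exact hp.1

theorem nonempty (h : Crossing d S T κ K) (k : Bool) : (S k).Nonempty :=
  h.meet.imp fun _ hp => mem_of_mem_inter hp k

theorem hasUniformTangents (h : Crossing d S T κ K) (hκ : 1 ≤ κ) (k : Bool) :
    HasUniformTangents d (S k) (T k) κ :=
  ⟨h.isCompact k, h.nonempty k, hκ, h.finrank_eq k, h.near k, h.lipschitz k, h.lift k⟩

/-- Moving from a common point `p` a distance `L` along one of the surfaces, in the direction
transversal to the other, leads away from the other surface. -/
theorem exists_far_point (h : Crossing d S T κ K) (k : Bool) {p : E} (hp : p ∈ S true ∩ S false)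
    {L : ℝ} (hL : 0 < L) (hκL : 32 * K * κ * L ≤ 1) :
    ∃ y ∈ S k, ‖y - p‖ ≤ 2 * L ∧ ∀ z ∈ S (!k), L / (2 * K) ≤ ‖z - y‖ := by
  obtain ⟨e, heT, he, hK⟩ := h.angle k p hp
  have hK1 := h.one_le
  have hκ := h.nonneg
  have hκL0 : 0 ≤ κ * L := by positivity
  have hκL2 : κ * L ≤ K * (κ * L) := le_mul_of_one_le_left hκL0 hK1
  have hnorm : ‖L • e‖ = L := by rw [norm_smul, he, mul_one, Real.norm_of_nonneg hL.le]
  obtain ⟨y, hyS, hyw, hyn⟩ := h.lift k p (mem_of_mem_inter hp k) (L • e)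
    ((T k p).smul_mem _ heT) (by rw [hnorm]; linarith)
  rw [hnorm] at hyn
  refine ⟨y, hyS, hyn, fun z hz => ?_⟩
  by_contra! hlt
  have hlt2 : ‖z - y‖ ≤ L := by
    refine hlt.le.trans (div_le_self hL.le (by linarith))
  have hzp : ‖z - p‖ ≤ 3 * L := by
    have := norm_sub_le_norm_sub_add_norm_sub z y p
    linarith
  have h1 := h.near k p (mem_of_mem_inter hp k) y hyS
  rw [hyw] at h1
  have h2 := h.near (!k) p (mem_of_mem_inter hp _) z hz
  have h1' : κ * ‖y - p‖ ^ 2 ≤ 4 * (κ * L) * L :=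
    (mul_le_mul_of_nonneg_left (pow_le_pow_left₀ (norm_nonneg _) hyn 2) hκ).trans_eq (by ring)
  have h2' : κ * ‖z - p‖ ^ 2 ≤ 9 * (κ * L) * L :=
    (mul_le_mul_of_nonneg_left (pow_le_pow_left₀ (norm_nonneg _) hzp 2) hκ).trans_eq (by ring)
  set Q := (T (!k) p).starProjection
  have h3 : L * ‖e - Q e‖ ≤ 13 * (κ * L) * L + ‖z - y‖ := by
    have e1 : L • (e - Q e) = ((z - p) - Q (z - p)) +
        ((-(z - y) - (y - p - L • e)) - Q (-(z - y) - (y - p - L • e))) := by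
      simp only [map_sub, map_smul, smul_sub, map_neg]
      abel
    have e2 : L * ‖e - Q e‖ = ‖L • (e - Q e)‖ := by rw [norm_smul, Real.norm_of_nonneg hL.le]
    rw [e2, e1]
    have e3 := norm_sub_starProjection_le_norm (T (!k) p) (-(z - y) - (y - p - L • e))
    have e4 := norm_sub_le (-(z - y)) (y - p - L • e)
    rw [norm_neg] at e4
    refine (norm_add_le _ _).trans ?_
    linarith
  have h4 : L ≤ K * (L * ‖e - Q e‖) := by
    have := mul_le_mul_of_nonneg_left hK hL.le
    linarith
  have h5 : K * ‖z - y‖ < L / 2 := by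
    rw [lt_div_iff₀ (by positivity)] at hlt
    linarith
  have h6 : K * (L * ‖e - Q e‖) ≤ K * (13 * (κ * L) * L + ‖z - y‖) :=
    mul_le_mul_of_nonneg_left h3 (by linarith)
  have h7 : 32 * K * κ * L * L ≤ 1 * L := mul_le_mul_of_nonneg_right hκL hL.le
  linarith

end Crossing

end CrossingSurfaces

/-! ### Mass of small balls and of the intersection -/

section Mass

open Set Filter Metric Topology

variable {E : Type*} [NormedAddCommGroup E] [InnerProductSpace ℝ E] [FiniteDimensional ℝ E]
  [MeasurableSpace E] [BorelSpace E]

variable {d : ℕ} {ω c : ℝ}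

/-- Ball masses are comparable to `R ^ d` (Ahlfors regularity). -/
theorem HasUniformTangents.exists_mass_bounds (hω : DiscFormula E d ω c) {S : Set E}
    {T : E → Submodule ℝ E} {K : ℝ} (h : HasUniformTangents d S T K) :
    ∃ A r₀ : ℝ, 1 ≤ A ∧ 0 < r₀ ∧ ∀ y ∈ S, ∀ R, 0 < R → R ≤ r₀ →
      μH[(d : ℝ)] (S ∩ closedBall y R) < ⊤ ∧
      R ^ d ≤ A * (μH[(d : ℝ)] : Measure E).real (S ∩ closedBall y R) ∧
      (μH[(d : ℝ)] : Measure E).real (S ∩ closedBall y R) ≤ A * R ^ d := by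
  obtain ⟨C, hC1, hC⟩ := exists_population_bounds hω le_rfl h.one_le
  have hω0 := hω.vol_pos
  set A := max 1 (max (2 ^ (d + 1) / ω) (ω * 2 ^ d + 1)) with hA
  have hA1 : 1 ≤ A := le_max_left _ _
  have hA2 : 2 ^ (d + 1) / ω ≤ A := (le_max_left _ _).trans (le_max_right _ _)
  have hA3 : ω * 2 ^ d + 1 ≤ A := (le_max_right _ _).trans (le_max_right _ _)
  refine ⟨A, min (1 / (2 * C)) (ω / (2 ^ (d + 1) * C)), hA1, by positivity, ?_⟩
  intro y hy R hR hRr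
  have hR1 : R ≤ 1 / (2 * C) := hRr.trans (min_le_left _ _)
  have hR2 : R ≤ ω / (2 ^ (d + 1) * C) := hRr.trans (min_le_right _ _)
  rw [le_div_iff₀ (by positivity)] at hR1 hR2
  have hCR : C * R ^ 2 ≤ R / 2 := by
    have := mul_le_mul_of_nonneg_right hR1 hR.le
    linarith
  obtain ⟨hfin, hb⟩ := hC S T h y hy R hR (by linarith) y (by simp; positivity) R (by linarith)
    (by linarith)
  obtain ⟨h1, h2⟩ := hb 1 0 (by simp) (by simp)
  have h3 : ∫ x in S ∩ closedBall y R, (1 + ⟪x - y, (0 : E)⟫) ^ 2 ∂μH[(d : ℝ)] =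
      (μH[(d : ℝ)] : Measure E).real (S ∩ closedBall y R) := by simp
  have h4 : ∀ R', 0 ≤ R' → discMoment d c (T y) (y - y) R' 1 0 = R' ^ d := by
    intro R' hR'
    simp [discMoment, discRadius, Real.sqrt_sq hR']
  rw [h3, h4 _ (by linarith)] at h1
  rw [h3, h4 _ (by positivity)] at h2
  set m := (μH[(d : ℝ)] : Measure E).real (S ∩ closedBall y R)
  have hRd : 0 < R ^ d := by positivity
  have hCRd : C * R ^ (d + 1) = C * R * R ^ d := by ring
  refine ⟨hfin, ?_, ?_⟩
  · have h5 : (R / 2) ^ d ≤ (R - C * R ^ 2) ^ d :=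
      pow_le_pow_left₀ (by positivity) (by linarith) d
    have h6 : ω * (R / 2) ^ d ≤ ω * (R - C * R ^ 2) ^ d := by gcongr
    have h7 : C * R ^ (d + 1) ≤ ω / 2 ^ (d + 1) * R ^ d := by
      rw [hCRd]
      gcongr
      rw [le_div_iff₀ (by positivity)]
      linarith
    have h8 : ω * (R / 2) ^ d = 2 * (ω / 2 ^ (d + 1) * R ^ d) := by
      rw [div_pow, pow_succ]
      field_simp
    have h9 : ω / 2 ^ (d + 1) * R ^ d ≤ m := by linarith
    calc R ^ d = 2 ^ (d + 1) / ω * (ω / 2 ^ (d + 1) * R ^ d) := by field_simp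
      _ ≤ A * m := by gcongr
  · have h5 : (R + C * R ^ 2) ^ d ≤ (2 * R) ^ d :=
      pow_le_pow_left₀ (by positivity) (by linarith) d
    have h6 : ω * (R + C * R ^ 2) ^ d ≤ ω * 2 ^ d * R ^ d := by
      rw [mul_pow] at h5
      rw [mul_assoc]
      gcongr
    have h7 : C * R * R ^ d ≤ 1 * R ^ d := by
      gcongr
      linarith
    calc m ≤ (ω * 2 ^ d + 1) * R ^ d := by linarith
      _ ≤ A * R ^ d := by gcongr

theorem HasUniformTangents.measure_lt_top (hω : DiscFormula E d ω c) {S : Set E}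
    {T : E → Submodule ℝ E} {K : ℝ} (h : HasUniformTangents d S T K) : μH[(d : ℝ)] S < ⊤ := by
  obtain ⟨A, r₀, -, hr₀, hb⟩ := h.exists_mass_bounds hω
  refine h.isCompact.measure_lt_top_of_nhdsWithin fun y hy => ?_
  refine ⟨S ∩ closedBall y r₀, ?_, (hb y hy r₀ hr₀ le_rfl).1⟩
  exact inter_mem_nhdsWithin S (closedBall_mem_nhds y hr₀)

theorem HasUniformTangents.measure_pos (hω : DiscFormula E d ω c) {S : Set E}
    {T : E → Submodule ℝ E} {K : ℝ} (h : HasUniformTangents d S T K) : 0 < μH[(d : ℝ)] S := by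
  obtain ⟨A, r₀, hA, hr₀, hb⟩ := h.exists_mass_bounds hω
  obtain ⟨y, hy⟩ := h.nonempty
  have h1 := (hb y hy r₀ hr₀ le_rfl).2.1
  have h2 : 0 < (μH[(d : ℝ)] : Measure E).real (S ∩ closedBall y r₀) := by
    have : 0 < r₀ ^ d := by positivity
    by_contra! hneg
    nlinarith [mul_nonneg (by linarith : 0 ≤ A) (neg_nonneg.2 hneg)]
  refine (ENNReal.toReal_pos_iff.1 h2).1.trans_le (measure_mono inter_subset_left)

/-- The intersection is porous in either surface, so by the Lebesgue density theorem it is null. -/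
theorem Crossing.measure_inter_eq_zero (hω : DiscFormula E d ω c) {S : Bool → Set E}
    {T : Bool → E → Submodule ℝ E} {κ K : ℝ} (h : Crossing d S T κ K) (hκ : 1 ≤ κ) :
    μH[(d : ℝ)] (S true ∩ S false) = 0 := by
  have hS := h.hasUniformTangents hκ true
  obtain ⟨A, r₀, hA, hr₀, hb⟩ := hS.exists_mass_bounds hω
  have hK := h.one_le
  set I := S true ∩ S false with hI
  have hIm : MeasurableSet I :=
    (h.isCompact true).measurableSet.inter (h.isCompact false).measurableSet
  have hSm : MeasurableSet (S true) := (h.isCompact true).measurableSet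
  set ν := (μH[(d : ℝ)] : Measure E).restrict (S true) with hν
  have : IsFiniteMeasure ν := ⟨by
    rw [hν, Measure.restrict_apply_univ]; exact hS.measure_lt_top hω⟩
  have hνI : ν I = μH[(d : ℝ)] I := by
    rw [hν, Measure.restrict_apply hIm, inter_eq_left.2 inter_subset_left]
  rw [← hνI]
  by_contra hne
  have hae := (Besicovitch.ae_tendsto_measure_inter_div ν I).and (ae_restrict_mem hIm)
  have : NeBot (ae (ν.restrict I)) := ae_neBot.2 (by rwa [Ne, Measure.restrict_eq_zero])
  obtain ⟨p, hlim, hp⟩ := hae.exists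
  have hlim' : Tendsto (fun r => ν.real (I ∩ closedBall p r) / ν.real (closedBall p r)) (𝓝[>] 0)
      (𝓝 1) := by
    have := (ENNReal.tendsto_toReal ENNReal.one_ne_top).comp hlim
    simpa [Function.comp_def, ENNReal.toReal_div, Measure.real] using this
  have hνb : ∀ y R, ν.real (closedBall y R) =
      (μH[(d : ℝ)] : Measure E).real (S true ∩ closedBall y R) := by
    intro y R
    rw [Measure.real, Measure.real, hν, Measure.restrict_apply measurableSet_closedBall, inter_comm]
  set q := (16 * K)⁻¹ ^ d / A ^ 2 with hq
  have hq0 : 0 < q := by positivity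
  have hbound : ∀ᶠ r in 𝓝[>] (0 : ℝ),
      ν.real (I ∩ closedBall p r) / ν.real (closedBall p r) ≤ 1 - q := by
    have hmem : Ioo (0 : ℝ) (min r₀ (1 / (8 * K * κ))) ∈ 𝓝[>] (0 : ℝ) :=
      Ioo_mem_nhdsGT (by positivity)
    filter_upwards [hmem] with r hr
    obtain ⟨hr0, hr1⟩ := hr
    have hr2 : r ≤ 1 / (8 * K * κ) := (hr1.trans_le (min_le_right _ _)).le
    have hr3 : r ≤ r₀ := (hr1.trans_le (min_le_left _ _)).le
    rw [le_div_iff₀ (by positivity)] at hr2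
    obtain ⟨y, hyS, hyp, hyz⟩ := h.exists_far_point true hp (L := r / 4) (by positivity)
      (by linarith)
    set ρ := r * (16 * K)⁻¹ with hρ
    have hρ0 : 0 < ρ := by positivity
    have hρr : ρ ≤ r / 16 := by
      rw [hρ, ← div_eq_mul_inv]
      gcongr
      linarith
    have hρ2 : ρ < r / 4 / (2 * K) := by
      rw [hρ]; field_simp; norm_num
    have hdisj : Disjoint (I ∩ closedBall p r) (closedBall y ρ) := by
      rw [Set.disjoint_left]
      rintro z ⟨hz, -⟩ hzy
      have h1 := hyz z hz.2
      rw [mem_closedBall, dist_eq_norm] at hzy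
      linarith
    have hsub : (I ∩ closedBall p r) ∪ closedBall y ρ ⊆ closedBall p r := by
      refine union_subset inter_subset_right (closedBall_subset_closedBall' ?_)
      rw [dist_eq_norm]
      linarith
    have h1 := measureReal_union (μ := ν) hdisj measurableSet_closedBall
    have h2 : ν.real ((I ∩ closedBall p r) ∪ closedBall y ρ) ≤ ν.real (closedBall p r) :=
      measureReal_mono hsub
    have h3 := (hb p hp.1 r hr0 hr3).2.2
    have h4 := (hb y hyS ρ hρ0 (by linarith)).2.1
    have h5 := (hb p hp.1 r hr0 hr3).2.1
    rw [← hνb] at h3 h4 h5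
    have hpos : 0 < ν.real (closedBall p r) := by
      have : 0 < r ^ d := by positivity
      by_contra! hneg
      nlinarith [mul_nonneg (by linarith : 0 ≤ A) (neg_nonneg.2 hneg)]
    rw [div_le_iff₀ hpos]
    have h6 : q * ν.real (closedBall p r) ≤ ν.real (closedBall y ρ) := by
      calc q * ν.real (closedBall p r) ≤ q * (A * r ^ d) := by gcongr
        _ = ρ ^ d / A := by rw [hq, hρ, mul_pow]; field_simp
        _ ≤ _ := by rw [div_le_iff₀ (by positivity)]; linarith
    linarith
  have := le_of_tendsto hlim' hbound
  linarith

end Mass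

/-! ### The crossing formed by the two given surfaces -/

section FromHypotheses

open Set Filter Metric Topology

variable {E : Type*} [NormedAddCommGroup E] [InnerProductSpace ℝ E] [FiniteDimensional ℝ E]

/-- The infimum defining the incidence angle is over a set bounded below, hence a lower bound. -/
theorem incidenceAngle_le_minAngle {S₁ S₂ : Set E} {s : E} (hs : s ∈ S₁ ∩ S₂) :
    incidenceAngle S₁ S₂ ≤ minAngle (tangentSubspace S₁ s) (tangentSubspace S₂ s) := by
  refine ciInf_le (f := fun s : ↥(S₁ ∩ S₂) =>
    minAngle (tangentSubspace S₁ s) (tangentSubspace S₂ s)) ⟨0, ?_⟩ ⟨s, hs⟩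
  rintro _ ⟨x, rfl⟩
  exact Real.sInf_nonneg fun θ hθ => hθ.1.1.1

/-- Smoothness, positive reach and the positive incidence angle provide a quantitative crossing. -/
theorem exists_crossing {D d : ℕ} {S₁ S₂ : Set (EuclideanSpace ℝ (Fin D))}
    (hS₁ : IsClosedSurface d S₁) (hS₂ : IsClosedSurface d S₂) (hmeet : (S₁ ∩ S₂).Nonempty)
    (hangle : 0 < incidenceAngle S₁ S₂) (hreach : 0 < reach (S₁ ∩ S₂))
    (htangent : ∀ s ∈ S₁ ∩ S₂, posTangentConeAt (S₁ ∩ S₂) s =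
      (tangentSubspace S₁ s ⊓ tangentSubspace S₂ s : Submodule ℝ (EuclideanSpace ℝ (Fin D)))) :
    ∃ K, Crossing d (fun k => bif k then S₁ else S₂)
      (fun k => tangentSubspace (bif k then S₁ else S₂)) K K := by
  obtain ⟨K₁, h₁⟩ := hS₁.exists_hasUniformTangents
  obtain ⟨K₂, h₂⟩ := hS₂.exists_hasUniformTangents
  have h₁' := h₁.mono (le_max_left K₁ K₂)
  have h₂' := h₂.mono (le_max_right K₁ K₂)
  obtain ⟨M₁, hM₁⟩ := exists_infDist_inter_le h₁' h₂' hmeet hreach htangent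
  obtain ⟨M₂, hM₂⟩ := exists_infDist_inter_le h₂' h₁' (by rwa [inter_comm])
    (by rwa [inter_comm]) (by rw [inter_comm]; intro s hs; rw [htangent s hs, inf_comm])
  rw [inter_comm] at hM₂
  set θ := min (incidenceAngle S₁ S₂) 1 with hθ
  have hθ0 : 0 < θ := lt_min hangle one_pos
  have hsin : 0 < Real.sin θ :=
    Real.sin_pos_of_pos_of_lt_pi hθ0 ((min_le_right _ _).trans_lt (by linarith [Real.pi_gt_three]))
  have hpair := fun (p : EuclideanSpace ℝ (Fin D)) (hp : p ∈ S₁ ∩ S₂) =>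
    exists_mem_sin_minAngle_le (hangle.trans_le (incidenceAngle_le_minAngle hp)) hθ0.le
      ((min_le_left _ _).trans (incidenceAngle_le_minAngle hp))
  set K := max (max K₁ K₂) (max (max M₁ M₂) (Real.sin θ)⁻¹) with hK
  have hKK : max K₁ K₂ ≤ K := le_max_left _ _
  have hKM₁ : M₁ ≤ K := ((le_max_left _ _).trans (le_max_left _ _)).trans (le_max_right _ _)
  have hKM₂ : M₂ ≤ K := ((le_max_right _ _).trans (le_max_left _ _)).trans (le_max_right _ _)
  have hKs : (Real.sin θ)⁻¹ ≤ K := (le_max_right _ _).trans (le_max_right _ _)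
  have hKsin : ∀ {x : ℝ}, Real.sin θ ≤ x → 1 ≤ K * x := by
    intro x hx
    calc (1 : ℝ) = (Real.sin θ)⁻¹ * Real.sin θ := (inv_mul_cancel₀ hsin.ne').symm
      _ ≤ K * x := by gcongr
  have H₁ := h₁'.mono hKK
  have H₂ := h₂'.mono hKK
  refine ⟨K, ⟨?_, ?_, hmeet, H₁.one_le, zero_le_one.trans H₁.one_le, ?_, ?_, ?_, ?_, ?_, ?_⟩⟩
  · rintro (_ | _)
    exacts [H₂.isCompact, H₁.isCompact]
  · rintro (_ | _)
    exacts [hS₂.isConnected.isPreconnected, hS₁.isConnected.isPreconnected]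
  · rintro (_ | _)
    exacts [H₂.finrank_eq, H₁.finrank_eq]
  · rintro (_ | _)
    exacts [H₂.near, H₁.near]
  · rintro (_ | _)
    exacts [H₂.lipschitz, H₁.lipschitz]
  · rintro (_ | _)
    exacts [H₂.lift, H₁.lift]
  · rintro (_ | _) s hs
    · exact (hM₂ s hs).trans (mul_le_mul_of_nonneg_right hKM₂ infDist_nonneg)
    · exact (hM₁ s hs).trans (mul_le_mul_of_nonneg_right hKM₁ infDist_nonneg)
  · rintro (_ | _) p hp
    · obtain ⟨e, he, h1, h2⟩ := (hpair p hp).2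
      exact ⟨e, he, h1, hKsin h2⟩
    · obtain ⟨e, he, h1, h2⟩ := (hpair p hp).1
      exact ⟨e, he, h1, hKsin h2⟩

end FromHypotheses

/-! ### Concentration of empirical moments -/

section Concentration

open Set Filter Metric Topology

variable {Ω : Type*} [MeasurableSpace Ω] {P : Measure Ω} [IsProbabilityMeasure P]

/-- The exponential moments of a centred bounded variable, from `exp x ≤ 1 + x + x ^ 2` for
`|x| ≤ 1`. -/
theorem mgf_le_of_bounded {Y : Ω → ℝ} (hYm : AEMeasurable Y P) (hY : ∀ ω, |Y ω| ≤ 2)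
    (hmean : ∫ ω, Y ω ∂P = 0) {v : ℝ} (hv : ∫ ω, Y ω ^ 2 ∂P ≤ v) {l : ℝ} (hl0 : 0 ≤ l)
    (hl : l ≤ 1 / 2) : mgf Y P l ≤ Real.exp (l ^ 2 * v) := by
  have hYi : Integrable Y P := Integrable.of_bound hYm.aestronglyMeasurable 2
    (Eventually.of_forall hY)
  have hYi2 : Integrable (fun ω => Y ω ^ 2) P := by
    refine Integrable.of_bound (hYm.pow_const 2).aestronglyMeasurable 4 (Eventually.of_forall ?_)
    intro ω
    rw [Real.norm_eq_abs, abs_pow]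
    calc |Y ω| ^ 2 ≤ 2 ^ 2 := pow_le_pow_left₀ (abs_nonneg _) (hY ω) 2
      _ = 4 := by norm_num
  have hpt : ∀ ω, Real.exp (l * Y ω) ≤ 1 + l * Y ω + l ^ 2 * Y ω ^ 2 := by
    intro ω
    have h1 : |l * Y ω| ≤ 1 := by
      rw [abs_mul, abs_of_nonneg hl0]
      calc l * |Y ω| ≤ 1 / 2 * 2 := by gcongr; exact hY ω
        _ = 1 := by norm_num
    have h2 := (abs_le.1 (Real.abs_exp_sub_one_sub_id_le h1)).2
    linarith [mul_pow l (Y ω) 2]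
  have hint : Integrable (fun ω => 1 + l * Y ω + l ^ 2 * Y ω ^ 2) P :=
    ((integrable_const _).add (hYi.const_mul l)).add (hYi2.const_mul _)
  calc mgf Y P l = ∫ ω, Real.exp (l * Y ω) ∂P := rfl
    _ ≤ ∫ ω, (1 + l * Y ω + l ^ 2 * Y ω ^ 2) ∂P :=
        integral_mono_of_nonneg (Eventually.of_forall fun _ => (Real.exp_pos _).le) hint
          (Eventually.of_forall hpt)
    _ = 1 + l ^ 2 * ∫ ω, Y ω ^ 2 ∂P := by
        rw [integral_add (f := fun ω => 1 + l * Y ω) ((integrable_const _).add (hYi.const_mul l))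
            (hYi2.const_mul _), integral_add (integrable_const _) (hYi.const_mul l),
          integral_const_mul,
          integral_const_mul, hmean]
        simp
    _ ≤ 1 + l ^ 2 * v := by gcongr
    _ ≤ Real.exp (l ^ 2 * v) := by linarith [Real.add_one_le_exp (l ^ 2 * v)]

variable {E : Type*} [MeasurableSpace E] {n : ℕ} {X : Fin n → Ω → E} {μ : Measure E}

/-- Bernstein's inequality in the regime where the deviation is at most the variance. -/
theorem measure_sum_sub_ge_le (hX : ∀ i, Measurable (X i)) (hind : iIndepFun X P)
    (hμ : ∀ i, P.map (X i) = μ) {f : E → ℝ} (hf : Measurable f) (hf1 : ∀ x, |f x| ≤ 1) {v t : ℝ}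
    (hv : ∫ x, f x ^ 2 ∂μ ≤ v) (ht0 : 0 ≤ t) (ht1 : t ≤ 1) :
    P.real {ω | n * (t * v) ≤ ∑ i, f (X i ω) - n * ∫ x, f x ∂μ} ≤
      Real.exp (-(t ^ 2 * n * v / 4)) := by
  rcases Nat.eq_zero_or_pos n with rfl | hn
  · simp
  have hμP : IsProbabilityMeasure μ := by
    rw [← hμ ⟨0, hn⟩]; exact Measure.isProbabilityMeasure_map (hX _).aemeasurable
  set m := ∫ x, f x ∂μ with hm
  have hfi : Integrable f μ := Integrable.of_bound hf.aestronglyMeasurable 1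
    (Eventually.of_forall hf1)
  have hfi2 : Integrable (fun x => f x ^ 2) μ := by
    refine Integrable.of_bound (hf.pow_const 2).aestronglyMeasurable 1 (Eventually.of_forall ?_)
    intro x
    rw [Real.norm_eq_abs, abs_pow]
    exact pow_le_one₀ (abs_nonneg _) (hf1 x)
  have hm1 : |m| ≤ 1 := by
    have := norm_integral_le_of_norm_le_const (μ := μ) (f := f) (C := 1)
      (Eventually.of_forall hf1)
    simpa using this
  set Y : Fin n → Ω → ℝ := fun i ω => f (X i ω) - m with hY
  have hYm : ∀ i, Measurable (Y i) := fun i => (hf.comp (hX i)).sub_const m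
  have hYind : iIndepFun Y P := hind.comp (fun _ x => f x - m) fun _ => hf.sub_const m
  have hYb : ∀ i ω, |Y i ω| ≤ 2 := fun i ω =>
    (abs_sub _ _).trans (by linarith [hf1 (X i ω)])
  have htrans : ∀ i, ∀ g : E → ℝ, Measurable g → ∫ ω, g (X i ω) ∂P = ∫ x, g x ∂μ := by
    intro i g hg
    rw [← hμ i, integral_map (hX i).aemeasurable hg.aestronglyMeasurable]
  have hmean : ∀ i, ∫ ω, Y i ω ∂P = 0 := by
    intro i
    rw [hY, htrans i (fun x => f x - m) (hf.sub_const m), integral_sub hfi (integrable_const _),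
      integral_const]
    simp [hm]
  have hvar : ∀ i, ∫ ω, Y i ω ^ 2 ∂P ≤ v := by
    intro i
    rw [hY, htrans i (fun x => (f x - m) ^ 2) ((hf.sub_const m).pow_const 2)]
    have e : ∀ x, (f x - m) ^ 2 = f x ^ 2 - 2 * m * f x + m ^ 2 := fun x => by ring
    simp only [e]
    rw [integral_add (f := fun x => f x ^ 2 - 2 * m * f x) (hfi2.sub (hfi.const_mul _))
        (integrable_const _),
      integral_sub hfi2 (hfi.const_mul _), integral_const_mul, integral_const, ← hm]
    simp only [probReal_univ, one_smul]
    nlinarith [sq_nonneg m]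
  set l := t / 2 with hl
  have hmgf : mgf (fun ω => ∑ i, Y i ω) P l ≤ Real.exp (l ^ 2 * v) ^ n := by
    have h1 := hYind.mgf_sum hYm Finset.univ (t := l)
    have h2 : (∑ i, Y i) = fun ω => ∑ i, Y i ω := by ext ω; simp
    rw [h2] at h1
    rw [h1]
    calc ∏ i, mgf (Y i) P l ≤ ∏ _i : Fin n, Real.exp (l ^ 2 * v) :=
          Finset.prod_le_prod (fun i _ => mgf_nonneg) fun i _ =>
            mgf_le_of_bounded (hYm i).aemeasurable (hYb i) (hmean i) (hvar i) (by positivity)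
              (by rw [hl]; linarith)
      _ = _ := by simp
  have hint : Integrable (fun ω => Real.exp (l * ∑ i, Y i ω)) P := by
    refine Integrable.of_bound (C := Real.exp (l * (n * 2))) ?_ (Eventually.of_forall fun ω => ?_)
    · exact (Real.measurable_exp.comp ((Finset.measurable_sum _ fun i _ =>
        hYm i).const_mul l)).aestronglyMeasurable
    · rw [Real.norm_of_nonneg (Real.exp_pos _).le]
      refine Real.exp_le_exp.2 (mul_le_mul_of_nonneg_left ?_ (by positivity))
      calc ∑ i, Y i ω ≤ ∑ _i : Fin n, (2 : ℝ) :=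
            Finset.sum_le_sum fun i _ => (le_abs_self _).trans (hYb i ω)
        _ = n * 2 := by simp
  have hcher := measure_ge_le_exp_mul_mgf (μ := P) (X := fun ω => ∑ i, Y i ω) (n * (t * v))
    (by positivity : 0 ≤ l) hint
  have hset : {ω | (n : ℝ) * (t * v) ≤ ∑ i, Y i ω} =
      {ω | n * (t * v) ≤ ∑ i, f (X i ω) - n * ∫ x, f x ∂μ} := by
    ext ω
    simp [hY, Finset.sum_sub_distrib, hm]
  rw [hset] at hcher
  refine hcher.trans ?_
  calc _ ≤ Real.exp (-l * (n * (t * v))) * Real.exp (l ^ 2 * v) ^ n := by gcongr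
    _ = _ := by
      rw [← Real.exp_nat_mul, ← Real.exp_add]
      congr 1
      rw [hl]; ring

theorem measure_abs_sum_sub_gt_le (hX : ∀ i, Measurable (X i)) (hind : iIndepFun X P)
    (hμ : ∀ i, P.map (X i) = μ) {f : E → ℝ} (hf : Measurable f) (hf1 : ∀ x, |f x| ≤ 1) {v t : ℝ}
    (hv : ∫ x, f x ^ 2 ∂μ ≤ v) (ht0 : 0 ≤ t) (ht1 : t ≤ 1) :
    P.real {ω | n * (t * v) < |∑ i, f (X i ω) - n * ∫ x, f x ∂μ|} ≤
      2 * Real.exp (-(t ^ 2 * n * v / 4)) := by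
  have h1 := measure_sum_sub_ge_le hX hind hμ hf hf1 hv ht0 ht1
  have h2 := measure_sum_sub_ge_le hX hind hμ hf.neg (f := fun x => - f x)
    (fun x => by rw [abs_neg]; exact hf1 x) (v := v) (by simpa using hv) ht0 ht1
  calc _ ≤ P.real ({ω | n * (t * v) ≤ ∑ i, f (X i ω) - n * ∫ x, f x ∂μ} ∪
        {ω | n * (t * v) ≤ ∑ i, -f (X i ω) - n * ∫ x, -f x ∂μ}) := by
        refine measureReal_mono fun ω hω => ?_
        rw [mem_ofPred_eq, lt_abs] at hω
        rcases hω with hω | hω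
        · exact Or.inl hω.le
        · refine Or.inr ?_
          rw [mem_ofPred_eq, Finset.sum_neg_distrib, integral_neg]
          linarith
    _ ≤ _ := measureReal_union_le _ _
    _ ≤ _ := by linarith

end Concentration

section Nets

open Set Filter Metric Topology

/-- If balls of radius `δ / 3` have mass at least `q` in a set of mass at most `m`, that set has a
`δ`-net with at most `m / q` points. -/
theorem exists_finset_net {E : Type*} [PseudoMetricSpace E] [MeasurableSpace E] [BorelSpace E]
    {μ : Measure E} {S : Set E} (hS : MeasurableSet S) (hμ : μ S ≠ ⊤) {δ q : ℝ} (hδ : 0 < δ)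
    (hq : 0 < q) (hball : ∀ y ∈ S, q ≤ μ.real (S ∩ closedBall y (δ / 3))) :
    ∃ Y : Finset E, ↑Y ⊆ S ∧ (∀ x ∈ S, ∃ y ∈ Y, dist x y ≤ δ) ∧ (Y.card : ℝ) * q ≤ μ.real S := by
  classical
  have hcard : ∀ Y : Finset E, ↑Y ⊆ S → (∀ x ∈ Y, ∀ y ∈ Y, x ≠ y → δ < dist x y) →
      (Y.card : ℝ) * q ≤ μ.real S := by
    intro Y hYS hY
    have hdisj : (↑Y : Set E).PairwiseDisjoint fun y => S ∩ closedBall y (δ / 3) := by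
      intro x hx y hy hxy
      rw [Function.onFun, Set.disjoint_left]
      rintro z ⟨-, hzx⟩ ⟨-, hzy⟩
      have h1 := hY x hx y hy hxy
      have h2 := dist_triangle_left x y z
      rw [mem_closedBall] at hzx hzy
      linarith
    calc (Y.card : ℝ) * q = ∑ _y ∈ Y, q := by simp
      _ ≤ ∑ y ∈ Y, μ.real (S ∩ closedBall y (δ / 3)) :=
          Finset.sum_le_sum fun y hy => hball y (hYS hy)
      _ = μ.real (⋃ y ∈ Y, S ∩ closedBall y (δ / 3)) :=
          (measureReal_biUnion_finset hdisj (fun y _ => hS.inter measurableSet_closedBall)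
            fun y _ => measure_ne_top_of_subset inter_subset_left hμ).symm
      _ ≤ μ.real S := measureReal_mono (iUnion₂_subset fun y _ => inter_subset_left) hμ
  obtain ⟨m, hm⟩ := exists_nat_ge (μ.real S / q)
  set A := {k : ℕ | ∃ Y : Finset E, ↑Y ⊆ S ∧ (∀ x ∈ Y, ∀ y ∈ Y, x ≠ y → δ < dist x y) ∧
    Y.card = k} with hA
  have hbdd : BddAbove A := by
    refine ⟨m, ?_⟩
    rintro _ ⟨Y, hYS, hY, rfl⟩
    have h1 := hcard Y hYS hY
    rw [← le_div_iff₀ hq] at h1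
    exact_mod_cast h1.trans hm
  obtain ⟨Y, hYS, hY, hYc⟩ : sSup A ∈ A := Nat.sSup_mem ⟨0, ∅, by simp⟩ hbdd
  refine ⟨Y, hYS, fun x hx => ?_, hcard Y hYS hY⟩
  by_contra! hfar
  have hxY : x ∉ Y := fun h => by
    have := hfar x h
    rw [dist_self] at this
    linarith
  have hmem : Y.card + 1 ∈ A := by
    refine ⟨insert x Y, ?_, ?_, Finset.card_insert_of_notMem hxY⟩
    · rw [Finset.coe_insert]; exact insert_subset hx hYS
    · intro a ha b hb hab
      rw [Finset.mem_insert] at ha hb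
      rcases ha with rfl | ha <;> rcases hb with rfl | hb
      · exact absurd rfl hab
      · exact hfar b hb
      · rw [dist_comm]; exact hfar a ha
      · exact hY a ha b hb hab
  have := le_csSup hbdd hmem
  omega

end Nets

section TestFunctions

open Set Filter Metric Topology

variable {E : Type*} [NormedAddCommGroup E] [InnerProductSpace ℝ E] [FiniteDimensional ℝ E]

/-- The affine coordinates on `E` centred at `y` and normalized to be bounded by `1` on the ball of
radius `2 * r`, including the constant coordinate `1`. -/
noncomputable def affineCoord (y : E) (r : ℝ) (a : Option (Fin (finrank ℝ E))) (x : E) : ℝ :=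
  a.elim 1 fun a => ⟪x - y, stdOrthonormalBasis ℝ E a⟫ / (2 * r)

/-- The products of two affine coordinates, cut off outside `A`. Controlling the empirical means of
these finitely many functions controls those of all squares of affine functions on `A`. -/
noncomputable def momentTest (A : Set E) (y : E) (r : ℝ) (a b : Option (Fin (finrank ℝ E))) :
    E → ℝ :=
  A.indicator fun x => affineCoord y r a x * affineCoord y r b x

theorem continuous_affineCoord (y : E) (r : ℝ) (a : Option (Fin (finrank ℝ E))) :
    Continuous (affineCoord y r a) := by
  cases a
  · exact continuous_const
  · exact ((continuous_id.sub continuous_const).inner continuous_const).div_const _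

theorem abs_affineCoord_le {y : E} {r : ℝ} (hr : 0 < r) (a : Option (Fin (finrank ℝ E))) {x : E}
    (hx : x ∈ closedBall y (2 * r)) : |affineCoord y r a x| ≤ 1 := by
  cases a with
  | none => simp [affineCoord]
  | some a =>
    rw [mem_closedBall, dist_eq_norm] at hx
    have h1 := abs_real_inner_le_norm (x - y) (stdOrthonormalBasis ℝ E a)
    rw [(stdOrthonormalBasis ℝ E).orthonormal.1 a, mul_one] at h1
    simp only [affineCoord, Option.elim_some]
    rw [abs_div, abs_of_pos (by positivity : 0 < 2 * r), div_le_one (by positivity)]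
    linarith

theorem abs_momentTest_le {A : Set E} {y : E} {r : ℝ} (hr : 0 < r) (hA : A ⊆ closedBall y (2 * r))
    (a b : Option (Fin (finrank ℝ E))) (x : E) :
    |momentTest A y r a b x| ≤ A.indicator 1 x := by
  by_cases hx : x ∈ A
  · rw [momentTest, indicator_of_mem hx, indicator_of_mem hx, abs_mul]
    exact mul_le_one₀ (abs_affineCoord_le hr a (hA hx)) (abs_nonneg _)
      (abs_affineCoord_le hr b (hA hx))
  · rw [momentTest, indicator_of_notMem hx, indicator_of_notMem hx, abs_zero]

theorem abs_momentTest_le_one {A : Set E} {y : E} {r : ℝ} (hr : 0 < r)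
    (hA : A ⊆ closedBall y (2 * r)) (a b : Option (Fin (finrank ℝ E))) (x : E) :
    |momentTest A y r a b x| ≤ 1 :=
  (abs_momentTest_le hr hA a b x).trans (indicator_le_self' (fun _ _ => zero_le_one) x)

/-- The coefficients, in the affine coordinates, of `x ↦ α + ⟪x - y, u⟫`. -/
noncomputable def affineCoeff (r α : ℝ) (u : E) (a : Option (Fin (finrank ℝ E))) : ℝ :=
  a.elim α fun a => 2 * r * ⟪stdOrthonormalBasis ℝ E a, u⟫

theorem sum_affineCoeff_mul_affineCoord {r : ℝ} (hr : 0 < r) (α : ℝ) (u y x : E) :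
    ∑ a, affineCoeff r α u a * affineCoord y r a x = α + ⟪x - y, u⟫ := by
  rw [Fintype.sum_option, ← (stdOrthonormalBasis ℝ E).sum_inner_mul_inner (x - y) u]
  simp only [affineCoeff, affineCoord, Option.elim_none, Option.elim_some, mul_one]
  congr 1
  refine Finset.sum_congr rfl fun a _ => ?_
  field_simp

theorem sum_abs_affineCoeff_le {r α M : ℝ} (hr : 0 < r) {u : E} (hα : |α| ≤ M)
    (hu : ‖u‖ * r ≤ 1) : ∑ a, |affineCoeff r α u a| ≤ M + 2 * finrank ℝ E := by
  rw [Fintype.sum_option]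
  simp only [affineCoeff, Option.elim_none, Option.elim_some]
  refine add_le_add hα ?_
  calc ∑ a, |2 * r * ⟪stdOrthonormalBasis ℝ E a, u⟫| ≤ ∑ _a : Fin (finrank ℝ E), (2 : ℝ) := by
        refine Finset.sum_le_sum fun a _ => ?_
        have h1 := abs_real_inner_le_norm (stdOrthonormalBasis ℝ E a) u
        rw [(stdOrthonormalBasis ℝ E).orthonormal.1 a, one_mul] at h1
        rw [abs_mul, abs_of_pos (by positivity : 0 < 2 * r)]
        calc 2 * r * |⟪stdOrthonormalBasis ℝ E a, u⟫| ≤ 2 * r * ‖u‖ := by gcongr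
          _ ≤ 2 := by linarith
    _ = 2 * finrank ℝ E := by simp [mul_comm]

theorem indicator_sq_eq_sum_momentTest (A : Set E) {r : ℝ} (hr : 0 < r) (α : ℝ) (u y x : E) :
    A.indicator (fun x => (α + ⟪x - y, u⟫) ^ 2) x =
      ∑ a, ∑ b, affineCoeff r α u a * affineCoeff r α u b * momentTest A y r a b x := by
  by_cases hx : x ∈ A
  · simp only [momentTest, indicator_of_mem hx]
    rw [← sum_affineCoeff_mul_affineCoord hr, sq, Finset.sum_mul_sum]
    refine Finset.sum_congr rfl fun a _ => Finset.sum_congr rfl fun b _ => ?_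
    ring
  · simp only [momentTest, indicator_of_notMem hx, mul_zero, Finset.sum_const_zero]

variable [MeasurableSpace E] [BorelSpace E]

theorem measurable_momentTest {A : Set E} (hA : MeasurableSet A) (y : E) (r : ℝ)
    (a b : Option (Fin (finrank ℝ E))) : Measurable (momentTest A y r a b) :=
  (((continuous_affineCoord y r a).mul (continuous_affineCoord y r b)).measurable).indicator hA

theorem integral_momentTest_sq_le {μ : Measure E} [IsFiniteMeasure μ] {A : Set E}
    (hAm : MeasurableSet A) {y : E} {r : ℝ} (hr : 0 < r) (hA : A ⊆ closedBall y (2 * r))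
    (a b : Option (Fin (finrank ℝ E))) : ∫ x, momentTest A y r a b x ^ 2 ∂μ ≤ μ.real A := by
  rw [← integral_indicator_one hAm]
  refine integral_mono_of_nonneg (Eventually.of_forall fun _ => sq_nonneg _) ?_
    (Eventually.of_forall fun x => ?_)
  · exact (integrable_const (1 : ℝ)).indicator hAm
  · have h1 := abs_momentTest_le hr hA a b x
    have h2 := abs_momentTest_le_one hr hA a b x
    change momentTest A y r a b x ^ 2 ≤ _
    rw [← sq_abs, sq]
    exact (mul_le_of_le_one_left (abs_nonneg _) h2).trans h1

/-- The deviation for the square of an affine function, expanded in products of affine coordinates,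
is at most that of the test functions times the square of the sum of the coefficients. -/
theorem abs_sum_indicator_sq_sub_le {n : ℕ} {s : Fin n → E} {μ : Measure E} [IsFiniteMeasure μ]
    {A : Set E} (hAm : MeasurableSet A) {y : E} {r : ℝ} (hr : 0 < r)
    (hA : A ⊆ closedBall y (2 * r)) {g : ℝ}
    (h : ∀ a b, |∑ j, momentTest A y r a b (s j) - n * ∫ x, momentTest A y r a b x ∂μ| ≤ g)
    {M α : ℝ} {u : E} (hα : |α| ≤ M) (hu : ‖u‖ * r ≤ 1) :
    |∑ j, A.indicator (fun x => (α + ⟪x - y, u⟫) ^ 2) (s j) -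
      n * ∫ x in A, (α + ⟪x - y, u⟫) ^ 2 ∂μ| ≤ (M + 2 * finrank ℝ E) ^ 2 * g := by
  have hint : ∀ a b, Integrable (momentTest A y r a b) μ := fun a b =>
    Integrable.of_bound (measurable_momentTest hAm y r a b).aestronglyMeasurable 1
      (Eventually.of_forall fun x => abs_momentTest_le_one hr hA a b x)
  set U := affineCoeff r α u with hU
  have h1 : ∑ j, A.indicator (fun x => (α + ⟪x - y, u⟫) ^ 2) (s j) =
      ∑ a, ∑ b, U a * U b * ∑ j, momentTest A y r a b (s j) := by
    simp only [indicator_sq_eq_sum_momentTest A hr]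
    rw [Finset.sum_comm]
    refine Finset.sum_congr rfl fun a _ => ?_
    rw [Finset.sum_comm]
    refine Finset.sum_congr rfl fun b _ => ?_
    rw [Finset.mul_sum]
  have h2 : ∫ x in A, (α + ⟪x - y, u⟫) ^ 2 ∂μ =
      ∑ a, ∑ b, U a * U b * ∫ x, momentTest A y r a b x ∂μ := by
    rw [← integral_indicator hAm]
    simp only [indicator_sq_eq_sum_momentTest A hr]
    rw [integral_finsetSum _ fun a _ => integrable_finsetSum _ fun b _ => (hint a b).const_mul _]
    refine Finset.sum_congr rfl fun a _ => ?_
    rw [integral_finsetSum _ fun b _ => (hint a b).const_mul _]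
    refine Finset.sum_congr rfl fun b _ => ?_
    rw [integral_const_mul]
  have hg : 0 ≤ g := (abs_nonneg _).trans (h none none)
  rw [h1, h2, Finset.mul_sum, ← Finset.sum_sub_distrib]
  calc |∑ a, (∑ b, U a * U b * ∑ j, momentTest A y r a b (s j) -
          n * ∑ b, U a * U b * ∫ x, momentTest A y r a b x ∂μ)|
      = |∑ a, ∑ b, U a * U b * (∑ j, momentTest A y r a b (s j) -
          n * ∫ x, momentTest A y r a b x ∂μ)| := by
        congr 1
        refine Finset.sum_congr rfl fun a _ => ?_
        rw [Finset.mul_sum, ← Finset.sum_sub_distrib]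
        refine Finset.sum_congr rfl fun b _ => ?_
        ring
    _ ≤ ∑ a, ∑ b, |U a| * |U b| * g := by
        refine (Finset.abs_sum_le_sum_abs _ _).trans (Finset.sum_le_sum fun a _ => ?_)
        refine (Finset.abs_sum_le_sum_abs _ _).trans (Finset.sum_le_sum fun b _ => ?_)
        rw [abs_mul, abs_mul]
        exact mul_le_mul_of_nonneg_left (h a b) (by positivity)
    _ = (∑ a, |U a|) ^ 2 * g := by
        rw [sq, Finset.sum_mul_sum, Finset.sum_mul]
        refine Finset.sum_congr rfl fun a _ => ?_
        rw [Finset.sum_mul]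
    _ ≤ _ := by
        gcongr
        exact sum_abs_affineCoeff_le hr hα hu

end TestFunctions

/-! ### Regular samples -/

section RegularSamples

set_option linter.unusedSectionVars false

open Set Filter Metric Topology

variable {E : Type*} [NormedAddCommGroup E] [InnerProductSpace ℝ E] [FiniteDimensional ℝ E]

/-- The properties of a sample on which the two algorithms depend. No surface point lies on the
intersection; the data points `x i` are within `β * r` of the surface points `s i`, which
are `l * r`-dense; and around each data point, the second moments of its neighbours from either
surface `S k` about any affine function agree, up to a common factor and errors of order `β`, with
those of a disc in the tangent space of `S k` at any nearby point `p`. -/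
structure RegularSample (d : ℕ) (c : ℝ) (S : Bool → Set E) (T : Bool → E → Submodule ℝ E)
    (M β l r : ℝ) {n : ℕ} (s x : Fin n → E) : Prop where
  mem : ∀ i, ∃ k, s i ∈ S k
  notMem_inter : ∀ i, s i ∉ S true ∩ S false
  noise : ∀ i, ‖x i - s i‖ ≤ β * r
  cover : ∀ k, ∀ y ∈ S k, ∃ j, s j ∈ S k ∧ ‖s j - y‖ ≤ l * r
  moments : ∃ m > 0, ∀ k i, ∀ p ∈ S k, ‖s i - p‖ ≤ M * r → ∀ (α : ℝ) (u : E), |α| ≤ M →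
    ‖u‖ * r ≤ 1 →
    discMoment d c (T k p) (s i - p) ((1 - β) * r) α u - β * r ^ d ≤
        m⁻¹ * ∑ j ∈ neighbors x r i, (S k).indicator (fun _ => (α + ⟪x j - p, u⟫) ^ 2) (s j) ∧
      m⁻¹ * ∑ j ∈ neighbors x r i, (S k).indicator (fun _ => (α + ⟪x j - p, u⟫) ^ 2) (s j) ≤
        discMoment d c (T k p) (s i - p) ((1 + β) * r) α u + β * r ^ d

theorem abs_sq_sub_sq_le_of_inner {α B D t : ℝ} {x y u : E} (hx : |α + ⟪x, u⟫| ≤ B)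
    (hy : |α + ⟪y, u⟫| ≤ B) (hxy : ‖x - y‖ * ‖u‖ ≤ t) (hD : 2 * B ≤ D) :
    |(α + ⟪x, u⟫) ^ 2 - (α + ⟪y, u⟫) ^ 2| ≤ D * t := by
  have h1 : (α + ⟪x, u⟫) ^ 2 - (α + ⟪y, u⟫) ^ 2 =
      ((α + ⟪x, u⟫) + (α + ⟪y, u⟫)) * ⟪x - y, u⟫ := by
    rw [inner_sub_left x y u]; ring
  rw [h1, abs_mul]
  have h2 : |⟪x - y, u⟫| ≤ t := (abs_real_inner_le_norm _ _).trans hxy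
  have h3 : |(α + ⟪x, u⟫) + (α + ⟪y, u⟫)| ≤ D := (abs_add_le _ _).trans (by linarith)
  exact mul_le_mul h3 h2 (abs_nonneg _) ((abs_nonneg _).trans h3)

theorem abs_add_inner_le {α A B r : ℝ} {x u : E} (hα : |α| ≤ A) (hB : 0 ≤ B) (hx : ‖x‖ ≤ B * r)
    (hu : ‖u‖ * r ≤ 1) : |α + ⟪x, u⟫| ≤ A + B := by
  refine (abs_add_le _ _).trans (add_le_add hα ((abs_real_inner_le_norm _ _).trans ?_))
  calc ‖x‖ * ‖u‖ ≤ B * r * ‖u‖ := by gcongr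
    _ = B * (‖u‖ * r) := by ring
    _ ≤ B * 1 := by gcongr
    _ = B := mul_one B

variable [MeasurableSpace E] [BorelSpace E]

/-- If the empirical means of the test functions around the points of a net are close to their
expectations, then so are all local second moments around the data points. -/
theorem moments_of_momentTest {d n : ℕ} {c : ℝ} {S : Set E} {T : Submodule ℝ E}
    {ω C M β δ A g r a : ℝ} {s x : Fin n → E} {μ : Measure E} [IsFiniteMeasure μ]
    (hSm : MeasurableSet S) (hM : 1 ≤ M) (hr : 0 < r) (hδ0 : 0 ≤ δ) (hδ : δ ≤ 1 / 12)
    (hω : 0 < ω) (ha : 0 < a) (hn : 0 < n) (hc : 0 ≤ c) (hCr : 2 * C * r ≤ 1) (hC : 1 ≤ C)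
    (hμ : ∀ B ⊆ S, MeasurableSet B → ∀ f : E → ℝ,
      ∫ z in B, f z ∂μ = a * ∫ z in B, f z ∂μH[(d : ℝ)])
    {i : Fin n} {p y : E} (hy : ‖s i - y‖ ≤ δ * r) (hip : ‖s i - p‖ ≤ M * r)
    (hnoise : ∀ j, ‖x j - s j‖ ≤ δ * r)
    (hpop : ∀ R, r / 2 ≤ R → R ≤ 2 * r →
      μH[(d : ℝ)] (S ∩ closedBall (s i) R) < ⊤ ∧ ∀ (α : ℝ) (u : E), |α| ≤ M → ‖u‖ * r ≤ 1 →
        ω * discMoment d c T (s i - p) (R - C * r ^ 2) α u - C * r ^ (d + 1) ≤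
          ∫ z in S ∩ closedBall (s i) R, (α + ⟪z - p, u⟫) ^ 2 ∂μH[(d : ℝ)] ∧
        ∫ z in S ∩ closedBall (s i) R, (α + ⟪z - p, u⟫) ^ 2 ∂μH[(d : ℝ)] ≤
          ω * discMoment d c T (s i - p) (R + C * r ^ 2) α u + C * r ^ (d + 1))
    (hmass : μ.real (S ∩ closedBall y ((1 + 3 * δ) * r)) ≤ A * r ^ d)
    (htest : ∀ R ∈ ({(1 - 3 * δ) * r, (1 + 3 * δ) * r} : Set ℝ), ∀ e e',
      |∑ j, momentTest (S ∩ closedBall y R) y r e e' (s j) -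
        n * ∫ z, momentTest (S ∩ closedBall y R) y r e e' z ∂μ| ≤ n * (g * r ^ d))
    (hβ : β ≤ 1) (hβ1 : 4 * δ + C * r ≤ β)
    (hβ2 : C * r / ω + ((2 * M + 1 + 2 * finrank ℝ E) ^ 2 * g + (4 * M + 4) * δ * (A + g)) /
      (a * ω) ≤ β)
    {α : ℝ} {u : E} (hα : |α| ≤ M) (hu : ‖u‖ * r ≤ 1) :
    discMoment d c T (s i - p) ((1 - β) * r) α u - β * r ^ d ≤
        (n * a * ω)⁻¹ * ∑ j ∈ neighbors x r i,
          S.indicator (fun _ => (α + ⟪x j - p, u⟫) ^ 2) (s j) ∧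
      (n * a * ω)⁻¹ * ∑ j ∈ neighbors x r i,
          S.indicator (fun _ => (α + ⟪x j - p, u⟫) ^ 2) (s j) ≤
        discMoment d c T (s i - p) ((1 + β) * r) α u + β * r ^ d := by
  classical
  set F : E → ℝ := fun z => (α + ⟪z - p, u⟫) ^ 2 with hF
  have hF0 : ∀ z, 0 ≤ F z := fun z => sq_nonneg _
  have hFc : Continuous F := by fun_prop
  have hg0 : 0 ≤ g := by
    have h1 := (abs_nonneg _).trans (htest _ (Or.inl rfl) none none)
    have h2 : 0 < (n : ℝ) * r ^ d := by positivity
    have h3 : 0 ≤ g * ((n : ℝ) * r ^ d) := by linarith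
    exact nonneg_of_mul_nonneg_left h3 h2
  have hδr : 0 ≤ δ * r := by positivity
  have hδr' : δ * r ≤ r / 12 := by
    calc δ * r ≤ 1 / 12 * r := by gcongr
      _ = r / 12 := by ring
  have hCr2 : C * r ^ 2 ≤ r / 2 := by
    have : 2 * C * r * r ≤ 1 * r := mul_le_mul_of_nonneg_right hCr hr.le
    linarith
  have hCr20 : 0 ≤ C * r ^ 2 := by positivity
  -- concentration, rewritten with base point `p`
  have hconc : ∀ R ∈ ({(1 - 3 * δ) * r, (1 + 3 * δ) * r} : Set ℝ),
      |∑ j, (S ∩ closedBall y R).indicator F (s j) - n * ∫ z in S ∩ closedBall y R, F z ∂μ| ≤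
        (2 * M + 1 + 2 * finrank ℝ E) ^ 2 * (n * (g * r ^ d)) := by
    intro R hR
    have hR2 : R ≤ 2 * r := by
      rcases hR with rfl | hR
      · linarith
      · rw [mem_singleton_iff.1 hR]; linarith
    have hα' : |α + ⟪y - p, u⟫| ≤ 2 * M + 1 := by
      have h1 : ‖y - p‖ ≤ (M + 1) * r := by
        have h2 := norm_sub_le_norm_sub_add_norm_sub y (s i) p
        rw [norm_sub_rev y (s i)] at h2
        linarith
      exact (abs_add_inner_le hα (by linarith) h1 hu).trans (by linarith)
    have h1 := abs_sum_indicator_sq_sub_le (hSm.inter measurableSet_closedBall) hr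
      (inter_subset_right.trans (closedBall_subset_closedBall hR2)) (htest R hR) hα' hu
    have h2 : ∀ z : E, (α + ⟪y - p, u⟫ + ⟪z - y, u⟫) ^ 2 = F z := by
      intro z
      rw [hF, add_assoc, ← inner_add_left]
      congr 4
      abel
    simpa only [h2] using h1
  have hcount : ∑ j, (S ∩ closedBall y ((1 + 3 * δ) * r)).indicator 1 (s j) ≤
      n * ((A + g) * r ^ d) := by
    have h1 := htest _ (Or.inr rfl) none none
    have h2 : momentTest (S ∩ closedBall y ((1 + 3 * δ) * r)) y r none none =
        (S ∩ closedBall y ((1 + 3 * δ) * r)).indicator 1 := by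
      ext z; simp [momentTest, affineCoord, indicator]
    rw [h2, integral_indicator_one (hSm.inter measurableSet_closedBall)] at h1
    have h3 := (abs_le.1 h1).2
    have h4 : (n : ℝ) * μ.real (S ∩ closedBall y ((1 + 3 * δ) * r)) ≤ n * (A * r ^ d) := by gcongr
    linarith
  -- passing from data points to surface points
  have hnear : ∀ j, s j ∈ closedBall y ((1 + 3 * δ) * r) →
      |(α + ⟪x j - p, u⟫) ^ 2 - F (s j)| ≤ (4 * M + 4) * δ := by
    intro j hj
    rw [mem_closedBall, dist_eq_norm] at hj
    have h1 : ‖s j - p‖ ≤ (M + 3 / 2) * r := by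
      have h2 := norm_sub_le_norm_sub_add_norm_sub (s j) y p
      have h3 := norm_sub_le_norm_sub_add_norm_sub y (s i) p
      rw [norm_sub_rev y (s i)] at h3
      linarith
    have h2 : ‖x j - p‖ ≤ (M + 2) * r := by
      have h3 := norm_sub_le_norm_sub_add_norm_sub (x j) (s j) p
      linarith [hnoise j]
    refine abs_sq_sub_sq_le_of_inner (B := 2 * M + 2)
      ((abs_add_inner_le hα (by linarith) h2 hu).trans (by linarith))
      ((abs_add_inner_le hα (by linarith) h1 hu).trans (by linarith)) ?_ (by linarith)
    rw [sub_sub_sub_cancel_right]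
    calc ‖x j - s j‖ * ‖u‖ ≤ δ * r * ‖u‖ := by gcongr; exact hnoise j
      _ = δ * (‖u‖ * r) := by ring
      _ ≤ δ * 1 := by gcongr
      _ = δ := mul_one δ
  -- the neighbours of `x i` are, up to a change `3 * δ * r` of the radius, the points in a ball
  -- around the net point `y`
  have hmemS : ∀ j ∈ neighbors x r i, s j ∈ closedBall y ((1 + 3 * δ) * r) := by
    intro j hj
    have h1 : ‖x i - x j‖ ≤ r := by simpa [neighbors] using hj
    rw [mem_closedBall, dist_eq_norm]
    have h2 : s j - y = -(x j - s j) - (x i - x j) + (x i - s i) + (s i - y) := by abel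
    rw [h2]
    have h3 := norm_add_le (-(x j - s j) - (x i - x j) + (x i - s i)) (s i - y)
    have h4 := norm_add_le (-(x j - s j) - (x i - x j)) (x i - s i)
    have h5 := norm_sub_le (-(x j - s j)) (x i - x j)
    rw [norm_neg] at h5
    linarith [hnoise i, hnoise j]
  have hmemN : ∀ j, s j ∈ closedBall y ((1 - 3 * δ) * r) → j ∈ neighbors x r i := by
    intro j hj
    rw [mem_closedBall, dist_eq_norm] at hj
    have : ‖x i - x j‖ ≤ r := by
      have h2 : x i - x j = -(x j - s j) + (x i - s i) + (s i - y) - (s j - y) := by abel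
      rw [h2]
      have h3 := norm_sub_le (-(x j - s j) + (x i - s i) + (s i - y)) (s j - y)
      have h4 := norm_add_le (-(x j - s j) + (x i - s i)) (s i - y)
      have h5 := norm_add_le (-(x j - s j)) (x i - s i)
      rw [norm_neg] at h5
      linarith [hnoise i, hnoise j]
    simpa [neighbors] using this
  have hD0 : 0 ≤ (4 * M + 4) * δ := mul_nonneg (by linarith) hδ0
  have hm : 0 < (n : ℝ) * a * ω := by positivity
  have hn0 : (0 : ℝ) < n := by exact_mod_cast hn
  have hpow : C * r ^ (d + 1) = C * r * r ^ d := by ring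
  have hrd : 0 < r ^ d := by positivity
  set L := 2 * M + 1 + 2 * (finrank ℝ E : ℝ) with hL
  -- the three sources of error: curvature, deviation, noise
  have herr : a * (C * r * r ^ d) + L ^ 2 * (g * r ^ d) +
      (4 * M + 4) * δ * ((A + g) * r ^ d) ≤ a * ω * (β * r ^ d) := by
    calc _ = (a * ω * (C * r / ω + (L ^ 2 * g + (4 * M + 4) * δ * (A + g)) / (a * ω))) * r ^ d := by
          field_simp
          ring
      _ ≤ (a * ω * β) * r ^ d := by gcongr
      _ = _ := by ring
  have hcount' := mul_le_mul_of_nonneg_left hcount hD0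
  constructor
  · set Am := S ∩ closedBall y ((1 - 3 * δ) * r) with hAm
    have hAmp : Am ⊆ S ∩ closedBall y ((1 + 3 * δ) * r) :=
      inter_subset_inter_right _ (closedBall_subset_closedBall (by linarith))
    -- lower bound: points well inside the ball are neighbours
    have h1 : ∑ j, Am.indicator F (s j) ≤
        ∑ j ∈ neighbors x r i, S.indicator (fun _ => (α + ⟪x j - p, u⟫) ^ 2) (s j) +
          (4 * M + 4) * δ *
            ∑ j, (S ∩ closedBall y ((1 + 3 * δ) * r)).indicator (1 : E → ℝ) (s j) := by
      have h2 : ∑ j, Am.indicator F (s j) = ∑ j ∈ neighbors x r i, Am.indicator F (s j) := by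
        symm
        refine Finset.sum_subset (Finset.subset_univ _) fun j _ hj => ?_
        exact indicator_of_notMem (fun h => hj (hmemN j h.2)) _
      rw [h2, Finset.mul_sum]
      refine (Finset.sum_le_sum (g := fun j => S.indicator (fun _ => (α + ⟪x j - p, u⟫) ^ 2) (s j) +
        (4 * M + 4) * δ *
          (S ∩ closedBall y ((1 + 3 * δ) * r)).indicator (1 : E → ℝ) (s j)) fun j _ => ?_).trans ?_
      · by_cases hj : s j ∈ Am
        · rw [indicator_of_mem hj, indicator_of_mem hj.1, indicator_of_mem (hAmp hj)]
          have := (abs_le.1 (hnear j (hAmp hj).2)).1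
          simp only [Pi.one_apply, mul_one]
          linarith
        · rw [indicator_of_notMem hj]
          exact add_nonneg (indicator_nonneg (fun _ _ => sq_nonneg _) _)
            (mul_nonneg hD0 (indicator_nonneg (fun _ _ => zero_le_one) _))
      · rw [Finset.sum_add_distrib]
        refine add_le_add_right (Finset.sum_le_univ_sum_of_nonneg fun j => ?_) _
        exact mul_nonneg hD0 (indicator_nonneg (fun _ _ => zero_le_one) _)
    have h3 := (abs_le.1 (hconc _ (Or.inl rfl))).1
    rw [hμ _ inter_subset_left (hSm.inter measurableSet_closedBall)] at h3
    obtain ⟨hfin, hb⟩ := hpop ((1 - 4 * δ) * r) (by linarith) (by linarith)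
    have h4 := (hb α u hα hu).1
    have hsub : S ∩ closedBall (s i) ((1 - 4 * δ) * r) ⊆ Am := by
      refine inter_subset_inter_right _ (closedBall_subset_closedBall' ?_)
      rw [dist_eq_norm]
      linarith
    have hfin' : μH[(d : ℝ)] Am ≠ ⊤ := by
      obtain ⟨hfin2, -⟩ := hpop (2 * r) (by linarith) le_rfl
      refine measure_ne_top_of_subset (inter_subset_inter_right _
        (closedBall_subset_closedBall' ?_)) hfin2.ne
      rw [dist_comm, dist_eq_norm]
      linarith
    have h5 : ∫ z in S ∩ closedBall (s i) ((1 - 4 * δ) * r), F z ∂μH[(d : ℝ)] ≤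
        ∫ z in Am, F z ∂μH[(d : ℝ)] := by
      refine setIntegral_mono_set ?_ (Eventually.of_forall hF0) hsub.eventuallyLE
      obtain ⟨B, hB⟩ := (isCompact_closedBall y ((1 - 3 * δ) * r)).exists_bound_of_continuousOn
        hFc.continuousOn
      refine Measure.integrableOn_of_bounded (M := B) hfin' hFc.aestronglyMeasurable ?_
      filter_upwards [ae_restrict_mem (hSm.inter measurableSet_closedBall)] with z hz
      exact hB z hz.2
    have h6 : discMoment d c T (s i - p) ((1 - β) * r) α u ≤
        discMoment d c T (s i - p) ((1 - 4 * δ) * r - C * r ^ 2) α u := by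
      refine discMoment_mono d hc _ _ (mul_nonneg (by linarith) hr.le) ?_ α u
      have := mul_le_mul_of_nonneg_right hβ1 hr.le
      linarith
    have h7 := mul_le_mul_of_nonneg_left h6 hω.le
    rw [hpow] at h4
    have h8 : a * (ω * discMoment d c T (s i - p) ((1 - β) * r) α u - C * r * r ^ d) ≤
        a * ∫ z in Am, F z ∂μH[(d : ℝ)] := by
      refine mul_le_mul_of_nonneg_left ?_ ha.le
      linarith
    have h9 := mul_le_mul_of_nonneg_left h8 hn0.le
    have h10 := mul_le_mul_of_nonneg_left herr hn0.le
    rw [inv_mul_eq_div, le_div_iff₀ hm]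
    linarith
  · set Ap := S ∩ closedBall y ((1 + 3 * δ) * r) with hAp
    have h1 : ∑ j ∈ neighbors x r i, S.indicator (fun _ => (α + ⟪x j - p, u⟫) ^ 2) (s j) ≤
        ∑ j, Ap.indicator F (s j) + (4 * M + 4) * δ * ∑ j, Ap.indicator (1 : E → ℝ) (s j) := by
      rw [Finset.mul_sum, ← Finset.sum_add_distrib]
      refine (Finset.sum_le_sum (g := fun j => Ap.indicator F (s j) +
        (4 * M + 4) * δ * Ap.indicator (1 : E → ℝ) (s j)) fun j hj => ?_).trans
        (Finset.sum_le_univ_sum_of_nonneg fun j => ?_)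
      · by_cases hjS : s j ∈ S
        · have hjA : s j ∈ Ap := ⟨hjS, hmemS j hj⟩
          rw [indicator_of_mem hjA, indicator_of_mem hjS, indicator_of_mem hjA]
          have := (abs_le.1 (hnear j hjA.2)).2
          simp only [Pi.one_apply, mul_one]
          linarith
        · rw [indicator_of_notMem hjS]
          exact add_nonneg (indicator_nonneg (fun _ _ => hF0 _) _)
            (mul_nonneg hD0 (indicator_nonneg (fun _ _ => zero_le_one) _))
      · exact add_nonneg (indicator_nonneg (fun _ _ => hF0 _) _)
            (mul_nonneg hD0 (indicator_nonneg (fun _ _ => zero_le_one) _))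
    have h3 := (abs_le.1 (hconc _ (Or.inr rfl))).2
    rw [hμ _ inter_subset_left (hSm.inter measurableSet_closedBall)] at h3
    obtain ⟨hfin, hb⟩ := hpop ((1 + 4 * δ) * r) (by linarith) (by linarith)
    have h4 := (hb α u hα hu).2
    have hsub : Ap ⊆ S ∩ closedBall (s i) ((1 + 4 * δ) * r) := by
      refine inter_subset_inter_right _ (closedBall_subset_closedBall' ?_)
      rw [dist_comm, dist_eq_norm]
      linarith
    have h5 : ∫ z in Ap, F z ∂μH[(d : ℝ)] ≤
        ∫ z in S ∩ closedBall (s i) ((1 + 4 * δ) * r), F z ∂μH[(d : ℝ)] := by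
      refine setIntegral_mono_set ?_ (Eventually.of_forall hF0) hsub.eventuallyLE
      obtain ⟨B, hB⟩ := (isCompact_closedBall (s i) ((1 + 4 * δ) * r)).exists_bound_of_continuousOn
        hFc.continuousOn
      refine Measure.integrableOn_of_bounded (M := B) hfin.ne hFc.aestronglyMeasurable ?_
      filter_upwards [ae_restrict_mem (hSm.inter measurableSet_closedBall)] with z hz
      exact hB z hz.2
    have h6 : discMoment d c T (s i - p) ((1 + 4 * δ) * r + C * r ^ 2) α u ≤
        discMoment d c T (s i - p) ((1 + β) * r) α u := by
      refine discMoment_mono d hc _ _ (by linarith) ?_ α u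
      have := mul_le_mul_of_nonneg_right hβ1 hr.le
      linarith
    have h7 := mul_le_mul_of_nonneg_left h6 hω.le
    rw [hpow] at h4
    have h8 : a * ∫ z in Ap, F z ∂μH[(d : ℝ)] ≤
        a * (ω * discMoment d c T (s i - p) ((1 + β) * r) α u + C * r * r ^ d) := by
      refine mul_le_mul_of_nonneg_left ?_ ha.le
      linarith
    have h9 := mul_le_mul_of_nonneg_left h8 hn0.le
    have h10 := mul_le_mul_of_nonneg_left herr hn0.le
    rw [inv_mul_eq_div, div_le_iff₀ hm]
    linarith

end RegularSamples

section GoodEvent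

open Set Filter Metric Topology

set_option linter.unusedSectionVars false

/-- Absorbing the cardinality of the net: unless the claimed failure probability exceeds `1`, the
net has at most polynomially many points in `n`, and powers of `n` are at most small powers of
`exp (n * r ^ d * η ^ 2)`. -/
theorem net_card_mul_exp_le {d n : ℕ} {r η N a C : ℝ} (hn : 1 ≤ n) (hr : 0 < r) (hη : 0 < η)
    (hr1 : r ≤ 1) (hη1 : η ≤ 1) (hNC : N ≤ C) (hC : 3 ≤ C)
    (haC : (d + 1) / C ≤ a) (hsmall : C * n * Real.exp (-(n * r ^ d * η ^ 2 / C)) < 1) :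
    N * ((η * r) ^ d)⁻¹ * Real.exp (-(a * (n * r ^ d * η ^ 2))) ≤
      C * n * Real.exp (-(n * r ^ d * η ^ 2 / C)) := by
  set q := (n : ℝ) * r ^ d * η ^ 2 with hq
  have hn1 : (1 : ℝ) ≤ n := by exact_mod_cast hn
  have hq0 : 0 < q := by positivity
  have hnexp : C * n < Real.exp (q / C) := by
    rw [Real.exp_neg, ← div_eq_mul_inv, div_lt_one (Real.exp_pos _)] at hsmall
    exact hsmall
  have hq1 : 1 ≤ q := by
    by_contra! hlt
    have h1 : Real.exp (q / C) ≤ Real.exp 1 :=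
      Real.exp_le_exp.2 ((div_le_one (by linarith)).2 (by linarith))
    have h2 := Real.exp_one_lt_d9
    have h3 : C * 1 ≤ C * n := by gcongr
    linarith
  have hrd1 : r ^ d ≤ 1 := pow_le_one₀ hr.le hr1
  have hη2 : η ^ 2 ≤ η := by rw [sq]; exact mul_le_of_le_one_left hη.le hη1
  have hη21 : η ^ 2 ≤ 1 := hη2.trans hη1
  have hηn : η⁻¹ ≤ n := by
    rw [inv_le_comm₀ hη (by linarith)]
    rw [inv_le_iff_one_le_mul₀ (by linarith)]
    calc 1 ≤ q := hq1
      _ ≤ n * 1 * η := by rw [hq]; gcongr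
      _ = η * n := by ring
  have hrn : (r ^ d)⁻¹ ≤ n := by
    rw [inv_le_iff_one_le_mul₀ (by positivity)]
    calc 1 ≤ q := hq1
      _ ≤ n * r ^ d * 1 := by rw [hq]; gcongr
      _ = n * r ^ d := by ring
  have hcard : ((η * r) ^ d)⁻¹ ≤ n ^ d * n := by
    rw [mul_pow, mul_inv, ← inv_pow]
    gcongr
  have hnd : (n : ℝ) ^ d ≤ Real.exp (d * (q / C)) := by
    rw [Real.exp_nat_mul]
    refine pow_le_pow_left₀ (by positivity) (le_trans ?_ hnexp.le) d
    exact le_mul_of_one_le_left (by positivity) (by linarith)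
  calc N * ((η * r) ^ d)⁻¹ * Real.exp (-(a * q)) ≤
        C * (Real.exp (d * (q / C)) * n) * Real.exp (-(a * q)) := by
        gcongr
        exact hcard.trans (by gcongr)
    _ = C * n * Real.exp (d * (q / C) - a * q) := by
        rw [sub_eq_add_neg, Real.exp_add]; ring
    _ ≤ _ := by
        gcongr
        have : (d + 1) / C * q ≤ a * q := by gcongr
        have e : (d + 1) / C * q = d * (q / C) + q / C := by ring
        linarith

/-- Simultaneous concentration of the empirical means of finitely many functions. -/
theorem exists_concentration_event {Ω : Type*} [MeasurableSpace Ω] {P : Measure Ω}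
    [IsProbabilityMeasure P] {E : Type*} [MeasurableSpace E] {n : ℕ} {X : Fin n → Ω → E}
    {μ : Measure E} (hX : ∀ i, Measurable (X i)) (hind : iIndepFun X P)
    (hμ : ∀ i, P.map (X i) = μ) {ι : Type*} (A : Finset ι) (f : ι → E → ℝ)
    (hf : ∀ e ∈ A, Measurable (f e)) (hf1 : ∀ e ∈ A, ∀ x, |f e x| ≤ 1) {v t : ℝ}
    (hv : ∀ e ∈ A, ∫ x, f e x ^ 2 ∂μ ≤ v) (ht0 : 0 ≤ t) (ht1 : t ≤ 1) :
    ∃ G : Set Ω, MeasurableSet G ∧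
      1 - A.card * (2 * Real.exp (-(t ^ 2 * n * v / 4))) ≤ P.real G ∧
      ∀ ω ∈ G, ∀ e ∈ A, |∑ i, f e (X i ω) - n * ∫ x, f e x ∂μ| ≤ n * (t * v) := by
  set B : ι → Set Ω := fun e => {ω | n * (t * v) < |∑ i, f e (X i ω) - n * ∫ x, f e x ∂μ|} with hB
  have hBm : ∀ e ∈ A, MeasurableSet (B e) := by
    intro e he
    refine measurableSet_lt measurable_const ?_
    exact ((Finset.measurable_fun_sum _ fun i _ => (hf e he).comp (hX i)).sub_const _).abs
  have hUm : MeasurableSet (⋃ e ∈ A, B e) := A.measurableSet_biUnion hBm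
  refine ⟨(⋃ e ∈ A, B e)ᶜ, hUm.compl, ?_, ?_⟩
  · rw [probReal_compl_eq_one_sub hUm]
    refine sub_le_sub_left ?_ _
    calc P.real (⋃ e ∈ A, B e) ≤ ∑ e ∈ A, P.real (B e) := measureReal_biUnion_finset_le _ _
      _ ≤ ∑ _e ∈ A, 2 * Real.exp (-(t ^ 2 * n * v / 4)) := Finset.sum_le_sum fun e he =>
          measure_abs_sum_sub_gt_le hX hind hμ (hf e he) (hf1 e he) (hv e he) ht0 ht1
      _ = _ := by simp
  · intro ω hω e he
    by_contra! hlt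
    exact hω (mem_iUnion₂.2 ⟨e, he, hlt⟩)

section

variable {E : Type*} [NormedAddCommGroup E] [InnerProductSpace ℝ E] [FiniteDimensional ℝ E]
  [MeasurableSpace E] [BorelSpace E]

/-- Everything that the sampling argument needs to know about the uniform distribution on the
union of two crossing surfaces. -/
theorem Crossing.exists_uniform_bounds {d : ℕ} {ω c K : ℝ} (hω : DiscFormula E d ω c)
    {S : Bool → Set E} {T : Bool → E → Submodule ℝ E} (h : Crossing d S T K K) :
    ∃ a A r₀ : ℝ, 0 < a ∧ 1 ≤ A ∧ 0 < r₀ ∧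
      IsProbabilityMeasure (ProbabilityTheory.cond μH[(d : ℝ)] (S true ∪ S false)) ∧
      (∀ᵐ x ∂ProbabilityTheory.cond μH[(d : ℝ)] (S true ∪ S false),
        x ∈ (S true ∪ S false) \ (S true ∩ S false)) ∧
      (∀ k, ∀ B ⊆ S k, MeasurableSet B → ∀ f : E → ℝ,
        ∫ z in B, f z ∂ProbabilityTheory.cond μH[(d : ℝ)] (S true ∪ S false) =
          a * ∫ z in B, f z ∂μH[(d : ℝ)]) ∧
      (∀ k, ∀ y ∈ S k, ∀ R, 0 < R → R ≤ r₀ →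
        R ^ d ≤ A * (ProbabilityTheory.cond μH[(d : ℝ)] (S true ∪ S false)).real
          (S k ∩ closedBall y R)) ∧
      (∀ k, ∀ y, ∀ R, 0 < R → R ≤ r₀ →
        (ProbabilityTheory.cond μH[(d : ℝ)] (S true ∪ S false)).real (S k ∩ closedBall y R) ≤
          A * R ^ d) := by
  set U := S true ∪ S false with hU
  have hSU : ∀ k, S k ⊆ U := by
    rintro (_ | _)
    exacts [subset_union_right, subset_union_left]
  have hSm : ∀ k, MeasurableSet (S k) := fun k => (h.isCompact k).measurableSet
  have hUm : MeasurableSet U := (hSm true).union (hSm false)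
  have hT := h.hasUniformTangents h.one_le
  have hfin : μH[(d : ℝ)] U < ⊤ := measure_union_lt_top ((hT true).measure_lt_top hω)
    ((hT false).measure_lt_top hω)
  have hpos : 0 < μH[(d : ℝ)] U := ((hT true).measure_pos hω).trans_le (measure_mono (hSU true))
  choose A r₀ hA hr₀ hb using fun k => (hT k).exists_mass_bounds hω
  set a := (μH[(d : ℝ)] U).toReal⁻¹ with ha
  have ha0 : 0 < a := inv_pos.2 (ENNReal.toReal_pos hpos.ne' hfin.ne)
  set μ := ProbabilityTheory.cond μH[(d : ℝ)] U with hμ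
  have hμP : IsProbabilityMeasure μ := cond_isProbabilityMeasure_of_finite hpos.ne' hfin.ne
  have hint : ∀ k, ∀ B ⊆ S k, MeasurableSet B → ∀ f : E → ℝ,
      ∫ z in B, f z ∂μ = a * ∫ z in B, f z ∂μH[(d : ℝ)] := by
    intro k B hB hBm f
    rw [hμ, ProbabilityTheory.cond, Measure.restrict_smul, Measure.restrict_restrict hBm,
      inter_eq_left.2 (hB.trans (hSU k)), integral_smul_measure, ENNReal.toReal_inv, smul_eq_mul]
  have hreal : ∀ k, ∀ B ⊆ S k, MeasurableSet B →
      μ.real B = a * (μH[(d : ℝ)] : Measure E).real B := by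
    intro k B hB hBm
    have := hint k B hB hBm fun _ => 1
    simpa using this
  set A' := max (A true) (A false) with hA'
  have hAk : ∀ k, A k ≤ A' := by
    rintro (_ | _)
    exacts [le_max_right _ _, le_max_left _ _]
  have hA'1 : 1 ≤ A' := (hA true).trans (hAk true)
  set r₁ := min (r₀ true) (r₀ false) with hr₁
  have hr₁k : ∀ k, r₁ ≤ r₀ k := by
    rintro (_ | _)
    exacts [min_le_right _ _, min_le_left _ _]
  set A'' := max (A' / a) (a * A' * 2 ^ d + 1) with hA''
  have hA''1 : 1 ≤ A'' := by
    refine le_trans ?_ (le_max_right _ _)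
    have : 0 ≤ a * A' * 2 ^ d := by positivity
    linarith
  have hball : ∀ k y R, MeasurableSet (S k ∩ closedBall y R) := fun k y R =>
    (hSm k).inter measurableSet_closedBall
  refine ⟨a, A'', r₁ / 2, ha0, hA''1, half_pos (lt_min (hr₀ true) (hr₀ false)), hμP, ?_, hint, ?_, ?_⟩
  · rw [hμ, ProbabilityTheory.cond]
    refine Measure.ae_smul_measure ?_ _
    have h1 : ∀ᵐ x ∂(μH[(d : ℝ)] : Measure E), x ∉ S true ∩ S false :=
      measure_eq_zero_iff_ae_notMem.1 (h.measure_inter_eq_zero hω h.one_le)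
    filter_upwards [ae_restrict_mem hUm, ae_restrict_of_ae h1] with x hx hx'
    exact ⟨hx, hx'⟩
  · intro k y hy R hR hRr
    have h1 := (hb k y hy R hR (hRr.trans ((half_le_self (lt_min (hr₀ true) (hr₀ false)).le).trans
      (hr₁k k)))).2.1
    rw [hreal k _ inter_subset_left (hball k y R)]
    calc R ^ d ≤ A k * (μH[(d : ℝ)] : Measure E).real (S k ∩ closedBall y R) := h1
      _ ≤ A' * (μH[(d : ℝ)] : Measure E).real (S k ∩ closedBall y R) := by
          gcongr
          exact hAk k
      _ = A' / a * (a * (μH[(d : ℝ)] : Measure E).real (S k ∩ closedBall y R)) := by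
          field_simp
      _ ≤ _ := by
          gcongr
          exact le_max_left _ _
  · intro k y R hR hRr
    rcases (S k ∩ closedBall y R).eq_empty_or_nonempty with he | ⟨p, hp⟩
    · rw [he, measureReal_empty]; positivity
    have h1 := hb k p hp.1 (2 * R) (by positivity) (by
      have := hr₁k k
      linarith)
    have hsub : S k ∩ closedBall y R ⊆ S k ∩ closedBall p (2 * R) := by
      refine inter_subset_inter_right _ (closedBall_subset_closedBall' ?_)
      rw [dist_comm]
      linarith [mem_closedBall.1 hp.2]
    calc μ.real (S k ∩ closedBall y R) ≤ μ.real (S k ∩ closedBall p (2 * R)) :=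
          measureReal_mono hsub
      _ = a * (μH[(d : ℝ)] : Measure E).real (S k ∩ closedBall p (2 * R)) :=
          hreal k _ inter_subset_left (hball k p _)
      _ ≤ a * (A k * (2 * R) ^ d) := by gcongr; exact h1.2.2
      _ ≤ a * (A' * (2 * R) ^ d) := by gcongr; exact hAk k
      _ = a * A' * 2 ^ d * R ^ d := by rw [mul_pow]; ring
      _ ≤ _ := by
          gcongr
          exact le_trans (by linarith) (le_max_right _ _)

end

end GoodEvent

section Sampling

open Set Filter Metric Topology

variable {E : Type*} [NormedAddCommGroup E] [InnerProductSpace ℝ E] [FiniteDimensional ℝ E]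
  [MeasurableSpace E] [BorelSpace E]

set_option maxHeartbeats 1000000 in
/-- With high probability a sample from two crossing surfaces is regular. The test functions are
centred at the points of a net of mesh of order `η * r`, and each of the empirical means deviates
from its expectation by at most a small multiple of `η * r ^ d`. -/
theorem Crossing.exists_regularSample {d : ℕ} {ω c K : ℝ} (hω : DiscFormula E d ω c)
    {S : Bool → Set E} {T : Bool → E → Submodule ℝ E} (h : Crossing d S T K K) {M l b : ℝ}
    (hM : 1 ≤ M) (hl : 0 < l) (hl1 : l ≤ 1) (hb : 0 < b) :
    ∃ C₀ : ℝ, 1 ≤ C₀ ∧ ∀ (n : ℕ) (r η τ : ℝ), 1 ≤ n → 0 < r → 0 < η → τ ≤ r * η / C₀ →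
      r ≤ η / C₀ → η ≤ 1 / C₀ → ∀ {Ω : Type*} [MeasurableSpace Ω] (P : Measure Ω)
        [IsProbabilityMeasure P] (s z : Fin n → Ω → E), (∀ i, Measurable (s i)) →
        (∀ i, Measurable (z i)) → iIndepFun s P →
        (∀ i, P.map (s i) = ProbabilityTheory.cond μH[(d : ℝ)] (S true ∪ S false)) →
        (∀ i, ∀ᵐ w ∂P, ‖z i w‖ ≤ τ) →
      ∃ G : Set Ω, MeasurableSet G ∧
        1 - C₀ * n * Real.exp (-(n * r ^ d * η ^ 2 / C₀)) ≤ P.real G ∧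
        ∀ w ∈ G, RegularSample d c S T M (b * η) l r (fun i => s i w)
          (fun i => s i w + z i w) := by
  have hK := h.one_le
  have hT := h.hasUniformTangents hK
  obtain ⟨Cp, hCp1, hCp⟩ := exists_population_bounds hω hM hK
  obtain ⟨a, A₀, r₀, ha, hA₀, hr₀, hμP, hae, hint, hlow, hup⟩ := h.exists_uniform_bounds hω
  set μ := ProbabilityTheory.cond μH[(d : ℝ)] (S true ∪ S false) with hμ
  have hω0 := hω.vol_pos
  set D : ℝ := (finrank ℝ E : ℝ) with hD
  have hD0 : 0 ≤ D := Nat.cast_nonneg _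
  have hM0 : 0 < M := by linarith
  obtain ⟨A, hA⟩ : ∃ A, A = A₀ * 2 ^ d := ⟨_, rfl⟩
  have hAA : A₀ ≤ A := by
    rw [hA]; exact le_mul_of_one_le_right (by linarith) (one_le_pow₀ (by norm_num))
  have hA1 : 1 ≤ A := hA₀.trans hAA
  have hA0 : 0 < A := by linarith
  obtain ⟨γ, hγ⟩ : ∃ γ, γ = min 1 (b * a * ω / (4 * (2 * M + 1 + 2 * D) ^ 2)) := ⟨_, rfl⟩
  have hγ0 : 0 < γ := by rw [hγ]; positivity
  have hγ1 : γ ≤ 1 := by rw [hγ]; exact min_le_left _ _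
  have hγ2 : γ ≤ b * a * ω / (4 * (2 * M + 1 + 2 * D) ^ 2) := by rw [hγ]; exact min_le_right _ _
  obtain ⟨δ₀, hδ₀⟩ : ∃ δ₀, δ₀ = min (min (b / 8) (1 / 12))
    (min (l / 2) (b * a * ω / (4 * (4 * M + 4) * (A + 1)))) := ⟨_, rfl⟩
  have hδ₀0 : 0 < δ₀ := by rw [hδ₀]; positivity
  have hδ₀1 : δ₀ ≤ b / 8 := by rw [hδ₀]; exact (min_le_left _ _).trans (min_le_left _ _)
  have hδ₀2 : δ₀ ≤ 1 / 12 := by rw [hδ₀]; exact (min_le_left _ _).trans (min_le_right _ _)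
  have hδ₀3 : δ₀ ≤ l / 2 := by rw [hδ₀]; exact (min_le_right _ _).trans (min_le_left _ _)
  have hδ₀4 : δ₀ ≤ b * a * ω / (4 * (4 * M + 4) * (A + 1)) := by
    rw [hδ₀]; exact (min_le_right _ _).trans (min_le_right _ _)
  obtain ⟨N, hN⟩ : ∃ N : ℝ, N = 24 * (D + 1) ^ 2 * (A₀ * (3 / δ₀) ^ d) := ⟨_, rfl⟩
  have hN0 : 0 ≤ N := by rw [hN]; positivity
  obtain ⟨C₀, hC₀⟩ : ∃ C₀ : ℝ, C₀ = 3 + N + (d + 1) / (γ ^ 2 / (4 * A)) + 1 / δ₀ + 2 * Cp +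
    2 / r₀ + 2 * Cp / b + 2 * Cp / (ω * b) + b + 2 * A₀ * (2 / l) ^ d := ⟨_, rfl⟩
  have p1 : 0 < (d + 1) / (γ ^ 2 / (4 * A)) := by positivity
  have p2 : 0 < 1 / δ₀ := by positivity
  have p3 : 0 < 2 / r₀ := by positivity
  have p4 : 0 < 2 * Cp / b := by positivity
  have p5 : 0 < 2 * Cp / (ω * b) := by positivity
  have p6 : 0 < 2 * A₀ * (2 / l) ^ d := by positivity
  have hC3 : 3 ≤ C₀ := by linarith
  have hC0 : 0 < C₀ := by linarith
  refine ⟨C₀, by linarith, ?_⟩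
  intro n r η τ hn hr hη hτ hrη hη1 Ω _ P _ s z hs hz hind hlaw hnoise
  rw [le_div_iff₀ hC0] at hτ hrη hη1
  -- each condition on the constant, in the form in which it is used
  have hηC : ∀ {x : ℝ}, x ≤ C₀ → x * η ≤ 1 := fun hx =>
    (mul_le_mul_of_nonneg_right hx hη.le).trans (by linarith)
  have hrC : ∀ {x : ℝ}, x ≤ C₀ → x * r ≤ η := fun hx =>
    (mul_le_mul_of_nonneg_right hx hr.le).trans (by linarith)
  have hη1' : η ≤ 1 := by linarith [hηC (x := 1) (by linarith)]
  have hr1 : r ≤ 1 := by linarith [hrC (x := 1) (by linarith)]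
  have hCpr : 2 * Cp * r ≤ 1 := (hrC (x := 2 * Cp) (by linarith)).trans hη1'
  have hr₀r : 2 * r ≤ r₀ := by
    have h1 := (hrC (x := 2 / r₀) (by linarith)).trans hη1'
    rw [div_mul_eq_mul_div, div_le_one hr₀] at h1
    exact h1
  have hCpb : Cp * r ≤ b * η / 2 := by
    have h1 := hrC (x := 2 * Cp / b) (by linarith)
    rw [div_mul_eq_mul_div, div_le_iff₀ hb] at h1
    linarith
  have hCpω : Cp * r / ω ≤ b * η / 2 := by
    have h1 := hrC (x := 2 * Cp / (ω * b)) (by linarith)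
    rw [div_mul_eq_mul_div, div_le_iff₀ (by positivity)] at h1
    rw [div_le_iff₀ hω0]
    linarith
  have hbη : b * η ≤ 1 := hηC (by linarith)
  have hτδ : τ ≤ δ₀ * η * r := by
    have h1 : τ * (1 / δ₀) ≤ r * η := by
      rcases le_or_gt 0 τ with h0 | h0
      · exact (mul_le_mul_of_nonneg_left (by linarith) h0).trans hτ
      · exact (mul_neg_of_neg_of_pos h0 p2).le.trans (by positivity)
    rw [mul_one_div, div_le_iff₀ hδ₀0] at h1
    linarith
  have hcov : A₀ * (γ * η) < (l / 2) ^ d := by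
    have h1 := hηC (x := 2 * A₀ * (2 / l) ^ d) (by linarith)
    have h2 : (2 / l) ^ d = ((l / 2) ^ d)⁻¹ := by rw [← inv_pow, inv_div]
    have h3 : 0 < (l / 2) ^ d := by positivity
    rw [h2, mul_right_comm, ← div_eq_mul_inv, div_le_one h3] at h1
    have h4 : A₀ * (γ * η) ≤ A₀ * (1 * η) := by gcongr
    have h5 : 0 < A₀ * η := by positivity
    linarith
  -- if the failure probability exceeds `1` there is nothing to prove
  rcases le_or_gt 1 (C₀ * n * Real.exp (-(n * r ^ d * η ^ 2 / C₀))) with hbig | hsmall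
  · exact ⟨∅, MeasurableSet.empty, by rw [measureReal_empty]; linarith, fun w hw => hw.elim⟩
  obtain ⟨δ, hδ⟩ : ∃ δ, δ = δ₀ * η := ⟨_, rfl⟩
  have hδ0 : 0 < δ := by rw [hδ]; positivity
  have hδδ₀ : δ ≤ δ₀ := by rw [hδ]; exact mul_le_of_le_one_right hδ₀0.le hη1'
  have hδ12 : δ ≤ 1 / 12 := hδδ₀.trans hδ₀2
  have hδr : δ * r ≤ 1 / 12 * r := by gcongr
  have hSm : ∀ k, MeasurableSet (S k) := fun k => (h.isCompact k).measurableSet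
  -- the nets
  have hnet : ∀ k, ∃ Y : Finset E, ↑Y ⊆ S k ∧ (∀ x ∈ S k, ∃ y ∈ Y, dist x y ≤ δ * r) ∧
      (Y.card : ℝ) ≤ A₀ * (3 / δ₀) ^ d * ((η * r) ^ d)⁻¹ := by
    intro k
    obtain ⟨Y, hYS, hYc, hYn⟩ := exists_finset_net (μ := μ) (q := (δ * r / 3) ^ d / A₀) (hSm k)
      (measure_ne_top μ _) (by positivity : 0 < δ * r) (by positivity) (fun y hy => by
        have h1 := hlow k y hy (δ * r / 3) (by positivity) (by linarith)
        rw [div_le_iff₀ (by linarith)]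
        linarith)
    refine ⟨Y, hYS, hYc, ?_⟩
    have h1 : (Y.card : ℝ) * ((δ * r / 3) ^ d / A₀) ≤ 1 := hYn.trans measureReal_le_one
    have h2 : A₀ * (3 / δ₀) ^ d * ((η * r) ^ d)⁻¹ * ((δ * r / 3) ^ d / A₀) = 1 := by
      rw [hδ]
      have e : δ₀ * η * r / 3 = (3 / δ₀)⁻¹ * (η * r) := by field_simp
      rw [e, mul_pow (3 / δ₀)⁻¹ (η * r), inv_pow]
      field_simp
    have h3 : 0 < (δ * r / 3) ^ d / A₀ := by positivity
    exact le_of_mul_le_mul_right (by linarith) h3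
  choose Y hYS hYc hYn using hnet
  classical
  -- two radii bracket the neighbourhoods, and the third one serves to prove density
  set rad : Fin 3 → ℝ := ![(1 - 3 * δ) * r, (1 + 3 * δ) * r, l * r / 2] with hrad
  have hrad0 : ∀ j, 0 < rad j := by
    intro j
    fin_cases j
    · change 0 < (1 - 3 * δ) * r
      exact mul_pos (by linarith) hr
    · change 0 < (1 + 3 * δ) * r
      positivity
    · change 0 < l * r / 2
      positivity
  have hrad2 : ∀ j, rad j ≤ 2 * r := by
    intro j
    fin_cases j
    · change (1 - 3 * δ) * r ≤ 2 * r
      exact mul_le_mul_of_nonneg_right (by linarith) hr.le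
    · change (1 + 3 * δ) * r ≤ 2 * r
      exact mul_le_mul_of_nonneg_right (by linarith) hr.le
    · change l * r / 2 ≤ 2 * r
      have : l * r ≤ 1 * r := mul_le_mul_of_nonneg_right hl1 hr.le
      linarith
  have hradm : ∀ k y j, μ.real (S k ∩ closedBall y (rad j)) ≤ A * r ^ d := by
    intro k y j
    calc μ.real (S k ∩ closedBall y (rad j)) ≤ μ.real (S k ∩ closedBall y (2 * r)) :=
          measureReal_mono (inter_subset_inter_right _ (closedBall_subset_closedBall (hrad2 j)))
      _ ≤ A₀ * (2 * r) ^ d := hup k y _ (by positivity) hr₀r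
      _ = A * r ^ d := by rw [hA, mul_pow]; ring
  set tests : Finset (E × (Bool × Fin 3 × Option (Fin (finrank ℝ E)) ×
    Option (Fin (finrank ℝ E)))) := (Y true ∪ Y false) ×ˢ Finset.univ with htests
  obtain ⟨G, hGm, hGP, hG⟩ := exists_concentration_event hs hind hlaw tests
    (fun e => momentTest (S e.2.1 ∩ closedBall e.1 (rad e.2.2.1)) e.1 r e.2.2.2.1 e.2.2.2.2)
    (v := A * r ^ d) (t := γ * η / A)
    (fun e _ => measurable_momentTest ((hSm _).inter measurableSet_closedBall) _ _ _ _)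
    (fun e _ x => abs_momentTest_le_one hr
      (inter_subset_right.trans (closedBall_subset_closedBall (hrad2 _))) _ _ x)
    (fun e _ => (integral_momentTest_sq_le ((hSm _).inter measurableSet_closedBall) hr
      (inter_subset_right.trans (closedBall_subset_closedBall (hrad2 _))) _ _).trans (hradm _ _ _))
    (by positivity) (by
      rw [div_le_one hA0]
      calc γ * η ≤ 1 * 1 := by gcongr
        _ ≤ A := by linarith)
  have htv : γ * η / A * (A * r ^ d) = γ * η * r ^ d := by field_simp
  rw [htv] at hG
  have hexp : (γ * η / A) ^ 2 * n * (A * r ^ d) / 4 = γ ^ 2 / (4 * A) * (n * r ^ d * η ^ 2) := by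
    field_simp
  rw [hexp] at hGP
  have hcard : (tests.card : ℝ) * 2 ≤ N * ((η * r) ^ d)⁻¹ := by
    have h1 : (tests.card : ℝ) = ((Y true ∪ Y false).card : ℝ) * (6 * (D + 1) ^ 2) := by
      rw [htests, Finset.card_product, Finset.card_univ]
      simp only [Fintype.card_prod, Fintype.card_bool, Fintype.card_fin, Fintype.card_option]
      push_cast
      ring
    have h2 : ((Y true ∪ Y false).card : ℝ) ≤ (Y true).card + (Y false).card := by
      exact_mod_cast Finset.card_union_le _ _
    have h3 : ((Y true ∪ Y false).card : ℝ) ≤ 2 * (A₀ * (3 / δ₀) ^ d * ((η * r) ^ d)⁻¹) := by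
      linarith [hYn true, hYn false]
    rw [h1, hN]
    calc _ ≤ 2 * (A₀ * (3 / δ₀) ^ d * ((η * r) ^ d)⁻¹) * (6 * (D + 1) ^ 2) * 2 := by gcongr
      _ = _ := by ring
  -- the failure probability: the number of tests times the bound for each
  have hfail := net_card_mul_exp_le (a := γ ^ 2 / (4 * A)) hn hr hη hr1 hη1'
    (show N ≤ C₀ by linarith) hC3 (by
      rw [div_le_iff₀ hC0, ← div_le_iff₀' (by positivity)]
      linarith) hsmall
  -- the almost sure properties of the sample
  set G' : Set Ω := {w | ∀ i, s i w ∈ (S true ∪ S false) \ (S true ∩ S false) ∧ ‖z i w‖ ≤ τ}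
    with hG'
  have hG'm : MeasurableSet G' := by
    have : G' = ⋂ i, (s i ⁻¹' ((S true ∪ S false) \ (S true ∩ S false)) ∩ {w | ‖z i w‖ ≤ τ}) := by
      ext w
      simp [hG']
    rw [this]
    refine MeasurableSet.iInter fun i => ?_
    exact (hs i (((hSm true).union (hSm false)).diff ((hSm true).inter (hSm false)))).inter
      (measurableSet_le (hz i).norm measurable_const)
  have hG'ae : ∀ᵐ w ∂P, w ∈ G' := by
    refine ae_all_iff.2 fun i => ?_
    have h1 : ∀ᵐ w ∂P, s i w ∈ (S true ∪ S false) \ (S true ∩ S false) := by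
      refine ae_of_ae_map (hs i).aemeasurable ?_
      rw [hlaw i]
      exact hae
    exact h1.and (hnoise i)
  refine ⟨G ∩ G', hGm.inter hG'm, ?_, ?_⟩
  · have h1 : P.real (G ∩ G') = P.real G := by
      refine measureReal_congr ?_
      filter_upwards [hG'ae] with w hw
      exact propext ⟨fun h => h.1, fun h => ⟨h, hw⟩⟩
    rw [h1]
    refine le_trans (sub_le_sub_left ?_ 1) hGP
    calc _ = (tests.card : ℝ) * 2 * Real.exp (-(γ ^ 2 / (4 * A) * (n * r ^ d * η ^ 2))) := by ring
      _ ≤ N * ((η * r) ^ d)⁻¹ * Real.exp (-(γ ^ 2 / (4 * A) * (n * r ^ d * η ^ 2))) := by gcongr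
      _ ≤ _ := hfail
  rintro w ⟨hwG, hwG'⟩
  have hdev : ∀ k', ∀ y ∈ Y k', ∀ k j e e',
      |∑ i, momentTest (S k ∩ closedBall y (rad j)) y r e e' (s i w) -
        n * ∫ x, momentTest (S k ∩ closedBall y (rad j)) y r e e' x ∂μ| ≤
        n * (γ * η * r ^ d) := by
    intro k' y hy k j e e'
    refine hG w hwG (y, k, j, e, e') ?_
    rw [htests, Finset.mem_product, Finset.mem_union]
    refine ⟨?_, Finset.mem_univ _⟩
    cases k'
    exacts [Or.inr hy, Or.inl hy]
  have hmem : ∀ i, ∃ k, s i w ∈ S k := fun i =>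
    (hwG' i).1.1.elim (fun h => ⟨true, h⟩) fun h => ⟨false, h⟩
  have hδb : δ * r ≤ b * η * r := by
    have : δ₀ * η ≤ b * η := mul_le_mul_of_nonneg_right (by linarith) hη.le
    rw [hδ]
    gcongr
  have hnoise' : ∀ i, ‖s i w + z i w - s i w‖ ≤ δ * r := by
    intro i
    rw [add_sub_cancel_left, hδ]
    exact (hwG' i).2.trans hτδ
  have hn0 : (0 : ℝ) < n := by exact_mod_cast hn
  refine ⟨hmem, fun i => (hwG' i).1.2, fun i => (hnoise' i).trans hδb, ?_, n * a * ω,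
    by positivity, ?_⟩
  · intro k x hx
    obtain ⟨y, hyY, hxy⟩ := hYc k x hx
    have h1 := hdev k y hyY k 2 none none
    have h2 : momentTest (S k ∩ closedBall y (rad 2)) y r none none =
        (S k ∩ closedBall y (rad 2)).indicator 1 := by
      ext z; simp [momentTest, affineCoord, indicator]
    rw [h2, integral_indicator_one ((hSm k).inter measurableSet_closedBall)] at h1
    have h3 := hlow k y (hYS k hyY) (rad 2) (hrad0 2) ((hrad2 2).trans hr₀r)
    have h4 : rad 2 = l / 2 * r := by
      change l * r / 2 = _
      ring
    have hrd : 0 < r ^ d := by positivity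
    -- a small ball around a net point has more mass than the deviation, so it contains a sample point
    have h5 : γ * η * r ^ d < μ.real (S k ∩ closedBall y (rad 2)) := by
      have h6 : A₀ * (γ * η) * r ^ d < (l / 2) ^ d * r ^ d := by gcongr
      rw [h4, mul_pow, ← h4] at h3
      have h7 : A₀ * (γ * η * r ^ d) < A₀ * μ.real (S k ∩ closedBall y (rad 2)) := by linarith
      exact lt_of_mul_lt_mul_left h7 (by linarith)
    have h8 : 0 < ∑ i, (S k ∩ closedBall y (rad 2)).indicator (1 : E → ℝ) (s i w) := by
      have h9 := (abs_le.1 h1).1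
      have h10 := mul_lt_mul_of_pos_left h5 hn0
      linarith
    obtain ⟨i, -, hi⟩ := Finset.exists_ne_zero_of_sum_ne_zero h8.ne'
    have hi' := mem_of_indicator_ne_zero hi
    refine ⟨i, hi'.1, ?_⟩
    have h11 := mem_closedBall.1 hi'.2
    rw [h4] at h11
    have h12 := dist_triangle_right (s i w) x y
    rw [dist_eq_norm] at h12
    have h13 : δ * r ≤ l / 2 * r := mul_le_mul_of_nonneg_right (hδδ₀.trans hδ₀3) hr.le
    linarith
  · intro k i p hp hip α u hα hu
    obtain ⟨k', hk'⟩ := hmem i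
    obtain ⟨y, hyY, hxy⟩ := hYc k' _ hk'
    rw [dist_eq_norm] at hxy
    have hδbη : 4 * δ ≤ b * η / 2 := by
      rw [hδ]
      have : δ₀ * η ≤ b / 8 * η := by gcongr
      linarith
    have herr : ((2 * M + 1 + 2 * D) ^ 2 * (γ * η) + (4 * M + 4) * δ * (A + γ * η)) / (a * ω) ≤
        b * η / 2 := by
      rw [div_le_iff₀ (by positivity)]
      have e1 : (2 * M + 1 + 2 * D) ^ 2 * γ ≤ b * a * ω / 4 := by
        rw [le_div_iff₀ (by positivity)] at hγ2
        linarith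
      have e2 : (4 * M + 4) * δ₀ * (A + 1) ≤ b * a * ω / 4 := by
        rw [le_div_iff₀ (by positivity)] at hδ₀4
        linarith
      have e3 : (4 * M + 4) * δ * (A + γ * η) ≤ (4 * M + 4) * δ * (A + 1) := by
        gcongr
        calc γ * η ≤ 1 * 1 := by gcongr
          _ = 1 := one_mul 1
      have e4 := mul_le_mul_of_nonneg_right e1 hη.le
      have e5 := mul_le_mul_of_nonneg_right e2 hη.le
      rw [hδ] at e3 ⊢
      linarith
    refine moments_of_momentTest (T := T k p) (y := y) (g := γ * η) (δ := δ) (C := Cp) (hSm k) hM hr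
      hδ0.le hδ12 hω0 ha hn hω.var_pos.le hCpr hCp1 (hint k) hxy hip hnoise' ?_
      (hradm k y 1) ?_ hbη (by linarith) (by linarith) hα hu
    · exact fun R hR hR' => hCp (S k) (T k) (hT k) p hp r hr hCpr _ hip R hR hR'
    · rintro R (rfl | hR) e e'
      · exact hdev k' y hyY k 0 e e'
      · rw [mem_singleton_iff.1 hR]
        exact hdev k' y hyY k 1 e e'

end Sampling

/-! ### Local covariances as variances -/

section Covariance

open Set Filter Metric Topology

variable {E : Type*} [NormedAddCommGroup E] [InnerProductSpace ℝ E] {n : ℕ} {x : Fin n → E} {r : ℝ}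
  {i : Fin n}

theorem mem_neighbors {j : Fin n} : j ∈ neighbors x r i ↔ ‖x i - x j‖ ≤ r := by
  simp [neighbors]

theorem card_neighbors_pos (hr : 0 ≤ r) : 0 < ((neighbors x r i).card : ℝ) := by
  have : i ∈ neighbors x r i := by rw [mem_neighbors, sub_self, norm_zero]; exact hr
  exact_mod_cast Finset.card_pos.2 ⟨i, this⟩

theorem sum_sub_sampleMean (hr : 0 ≤ r) :
    ∑ j ∈ neighbors x r i, (x j - sampleMean x (neighbors x r i)) = 0 := by
  rw [Finset.sum_sub_distrib, Finset.sum_const, sampleMean, ← Nat.cast_smul_eq_nsmul ℝ,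
    smul_inv_smul₀ (card_neighbors_pos hr).ne', sub_self]

/-- The mean of the neighbours of `x i` lies in the ball of radius `r` around `x i`. -/
theorem norm_sampleMean_sub_le (hr : 0 ≤ r) : ‖x i - sampleMean x (neighbors x r i)‖ ≤ r := by
  have hc := card_neighbors_pos (x := x) (i := i) hr
  have h1 : x i - sampleMean x (neighbors x r i) =
      ((neighbors x r i).card : ℝ)⁻¹ • ∑ j ∈ neighbors x r i, (x i - x j) := by
    rw [Finset.sum_sub_distrib, Finset.sum_const, ← Nat.cast_smul_eq_nsmul ℝ, smul_sub,
      inv_smul_smul₀ hc.ne', sampleMean]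
  rw [h1, norm_smul, norm_inv, Real.norm_of_nonneg hc.le, inv_mul_le_iff₀ hc]
  calc ‖∑ j ∈ neighbors x r i, (x i - x j)‖ ≤ ∑ j ∈ neighbors x r i, r :=
        norm_sum_le_of_le _ fun j hj => mem_neighbors.1 hj
    _ = _ := by simp

theorem inner_localCov (x : Fin n → E) (r : ℝ) (i : Fin n) (u v : E) : ⟪localCov x r i u, v⟫ =
    ((neighbors x r i).card : ℝ)⁻¹ * ∑ j ∈ neighbors x r i,
      ⟪x j - sampleMean x (neighbors x r i), u⟫ * ⟪x j - sampleMean x (neighbors x r i), v⟫ := by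
  simp only [localCov, smul_apply, sum_apply, InnerProductSpace.rankOne_apply,
    real_inner_smul_left, sum_inner]

theorem isSymmetric_localCov (x : Fin n → E) (r : ℝ) (i : Fin n) :
    (localCov x r i : E →ₗ[ℝ] E).IsSymmetric := by
  intro u v
  rw [ContinuousLinearMap.coe_coe, real_inner_comm (localCov x r i v) u, inner_localCov,
    inner_localCov]
  congr 1
  exact Finset.sum_congr rfl fun j _ => mul_comm _ _

theorem inner_localCov_self_nonneg (x : Fin n → E) (r : ℝ) (i : Fin n) (u : E) :
    0 ≤ ⟪localCov x r i u, u⟫ := by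
  rw [inner_localCov]
  exact mul_nonneg (by positivity) (Finset.sum_nonneg fun j _ => mul_self_nonneg _)

/-- The variance in the direction `u`, with the mean expressed as an offset from a base point `p`. -/
theorem inner_localCov_self_eq (hr : 0 ≤ r) (p u : E) : ⟪localCov x r i u, u⟫ *
    (neighbors x r i).card = ∑ j ∈ neighbors x r i,
      (⟪p - sampleMean x (neighbors x r i), u⟫ + ⟪x j - p, u⟫) ^ 2 := by
  rw [inner_localCov, mul_comm, mul_inv_cancel_left₀ (card_neighbors_pos hr).ne']
  refine Finset.sum_congr rfl fun j _ => ?_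
  rw [← inner_add_left, ← sq]
  congr 2
  abel

/-- The variance is the least second moment about a constant. -/
theorem inner_localCov_self_le (hr : 0 ≤ r) (p u : E) (α : ℝ) : ⟪localCov x r i u, u⟫ *
    (neighbors x r i).card ≤ ∑ j ∈ neighbors x r i, (α + ⟪x j - p, u⟫) ^ 2 := by
  rw [inner_localCov, mul_comm, mul_inv_cancel_left₀ (card_neighbors_pos hr).ne']
  set m := sampleMean x (neighbors x r i) with hm
  have h0 : ∑ j ∈ neighbors x r i, ⟪x j - m, u⟫ = 0 := by
    rw [← sum_inner, sum_sub_sampleMean hr, inner_zero_left]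
  have h1 : ∀ j, (α + ⟪x j - p, u⟫) ^ 2 = ⟪x j - m, u⟫ * ⟪x j - m, u⟫ +
      2 * (α + ⟪m - p, u⟫) * ⟪x j - m, u⟫ + (α + ⟪m - p, u⟫) ^ 2 := by
    intro j
    have : ⟪x j - p, u⟫ = ⟪x j - m, u⟫ + ⟪m - p, u⟫ := by
      rw [← inner_add_left]; congr 1; abel
    rw [this]; ring
  simp only [h1, Finset.sum_add_distrib, ← Finset.mul_sum, h0, mul_zero, add_zero]
  exact le_add_of_nonneg_right (Finset.sum_nonneg fun j _ => sq_nonneg _)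

/-- The neighbours are within distance `2` of their mean. -/
theorem norm_localCov_le (x : Fin n → E) (i : Fin n) [FiniteDimensional ℝ E] :
    ‖localCov x 1 i‖ ≤ 4 := by
  refine norm_le_of_abs_inner_self_le (isSymmetric_localCov x 1 i) (fun u hu => ?_) (by norm_num)
  rw [abs_of_nonneg (inner_localCov_self_nonneg x 1 i u), inner_localCov]
  have hc := card_neighbors_pos (x := x) (i := i) zero_le_one
  rw [inv_mul_le_iff₀ hc]
  calc _ ≤ ∑ j ∈ neighbors x 1 i, (4 : ℝ) := by
        refine Finset.sum_le_sum fun j hj => ?_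
        have h1 := abs_real_inner_le_norm (x j - sampleMean x (neighbors x 1 i)) u
        have h2 := norm_sub_le_norm_sub_add_norm_sub (x j) (x i) (sampleMean x (neighbors x 1 i))
        have h3 := mem_neighbors.1 hj
        rw [norm_sub_rev] at h3
        have h4 := norm_sampleMean_sub_le (x := x) (i := i) zero_le_one
        rw [hu, mul_one] at h1
        have h5 := abs_le.1 (h1.trans (h2.trans (add_le_add h3 h4)))
        nlinarith
    _ = _ := by simp

end Covariance

section Moments

open Set Filter Metric Topology

variable {E : Type*} [NormedAddCommGroup E] [InnerProductSpace ℝ E] [FiniteDimensional ℝ E]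

theorem discRadius_of_mem {T : Submodule ℝ E} {v : E} (hv : v ∈ T) {R : ℝ} (hR : 0 ≤ R) :
    discRadius T v R = R := by
  rw [discRadius, starProjection_of_mem hv, sub_self, norm_zero, zero_pow two_ne_zero, sub_zero,
    Real.sqrt_sq hR]

theorem discMoment_zero_center (d : ℕ) (c : ℝ) (T : Submodule ℝ E) {R : ℝ} (hR : 0 ≤ R) (α : ℝ)
    (u : E) : discMoment d c T 0 R α u = R ^ d * (α ^ 2 + c * R ^ 2 * ‖T.starProjection u‖ ^ 2) := by
  rw [discMoment, discRadius_of_mem T.zero_mem hR, map_zero, inner_zero_left, add_zero]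

/-- The moments of a unit disc depend continuously on all data, uniformly in the direction of the
disc. No power of the error is available: the volume of the disc is only Hölder continuous in the
height of its centre. -/
theorem exists_discMoment_modulus (d : ℕ) (c M : ℝ) {γ : ℝ} (hγ : 0 < γ) :
    ∃ δ > 0, ∀ (T : Submodule ℝ E) (v v₀ : E) (R α : ℝ) (u : E), ‖v₀‖ ≤ M → ‖v - v₀‖ ≤ δ →
      |R - 1| ≤ δ → |α| ≤ M → ‖u‖ ≤ 1 →
      |discMoment d c T v R α u - discMoment d c T v₀ 1 α u| ≤ γ := by
  set F : (E →L[ℝ] E) × E × ℝ × ℝ × E → ℝ := fun z =>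
    √(z.2.2.1 ^ 2 - ‖z.2.1 - z.1 z.2.1‖ ^ 2) ^ d * ((z.2.2.2.1 + ⟪z.1 z.2.1, z.2.2.2.2⟫) ^ 2 +
      c * √(z.2.2.1 ^ 2 - ‖z.2.1 - z.1 z.2.1‖ ^ 2) ^ 2 * ‖z.1 z.2.2.2.2‖ ^ 2) with hF
  have hFc : Continuous F := by fun_prop
  set X : Set ((E →L[ℝ] E) × E × ℝ × ℝ × E) := closedBall 0 1 ×ˢ closedBall 0 (M + 1) ×ˢ
    Icc 0 2 ×ˢ Icc (-M) M ×ˢ closedBall 0 1 with hX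
  have hXc : IsCompact X := (isCompact_closedBall _ _).prod ((isCompact_closedBall _ _).prod
    (isCompact_Icc.prod (isCompact_Icc.prod (isCompact_closedBall _ _))))
  have hu := hXc.uniformContinuousOn_of_continuous hFc.continuousOn
  rw [Metric.uniformContinuousOn_iff_le] at hu
  obtain ⟨δ, hδ, hδF⟩ := hu γ hγ
  refine ⟨min δ 1, lt_min hδ one_pos, ?_⟩
  intro T v v₀ R α u hv₀ hv hR hα hu
  have hP : T.starProjection ∈ closedBall (0 : E →L[ℝ] E) 1 := by
    rw [mem_closedBall_zero_iff]
    exact T.starProjection_norm_le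
  have hvM : ‖v‖ ≤ M + 1 := by
    have := norm_add_le (v - v₀) v₀
    rw [sub_add_cancel] at this
    linarith [hv.trans (min_le_right _ _)]
  have hR' := abs_le.1 (hR.trans (min_le_right _ _))
  have h1 := hδF (T.starProjection, v, R, α, u)
    ⟨hP, mem_closedBall_zero_iff.2 hvM, ⟨by linarith, by linarith⟩, abs_le.1 hα,
      mem_closedBall_zero_iff.2 hu⟩ (T.starProjection, v₀, 1, α, u)
    ⟨hP, mem_closedBall_zero_iff.2 (by linarith), ⟨by norm_num, by norm_num⟩, abs_le.1 hα,
      mem_closedBall_zero_iff.2 hu⟩ (by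
      simp only [Prod.dist_eq]
      refine max_le ?_ (max_le ?_ (max_le ?_ (max_le ?_ ?_)))
      · rw [dist_self]; exact hδ.le
      · rw [dist_eq_norm]; exact hv.trans (min_le_left _ _)
      · rw [Real.dist_eq]; exact hR.trans (min_le_left _ _)
      · rw [dist_self]; exact hδ.le
      · rw [dist_self]; exact hδ.le)
  rwa [Real.dist_eq] at h1

end Moments

/-! ### Local covariances of a regular sample -/

section LocalCovariances

open Set Filter Metric Topology

set_option linter.unusedSectionVars false

variable {E : Type*} [NormedAddCommGroup E] [InnerProductSpace ℝ E] [FiniteDimensional ℝ E]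

/-- The second moment about an affine function of the neighbours of `x i` that come from `A`. -/
noncomputable def clusterMoment (A : Set E) {n : ℕ} (s x : Fin n → E) (i : Fin n) (p : E) (α : ℝ)
    (u : E) : ℝ :=
  ∑ j ∈ neighbors x 1 i, A.indicator (fun _ => (α + ⟪x j - p, u⟫) ^ 2) (s j)

variable {d n : ℕ} {c M β l : ℝ} {S : Bool → Set E} {T : Bool → E → Submodule ℝ E}
  {s x : Fin n → E}

theorem clusterMoment_nonneg (A : Set E) (s x : Fin n → E) (i : Fin n) (p : E) (α : ℝ) (u : E) :
    0 ≤ clusterMoment A s x i p α u :=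
  Finset.sum_nonneg fun _ _ => indicator_nonneg (fun _ _ => sq_nonneg _) _

/-- A sum over the neighbours splits into the two clusters, as no sample point lies on both
surfaces. -/
theorem RegularSample.sum_eq_add (hs : RegularSample d c S T M β l 1 s x) (k : Bool) (i : Fin n)
    (p : E) (α : ℝ) (u : E) : ∑ j ∈ neighbors x 1 i, (α + ⟪x j - p, u⟫) ^ 2 =
      clusterMoment (S k) s x i p α u + clusterMoment (S (!k)) s x i p α u := by
  rw [clusterMoment, clusterMoment, ← Finset.sum_add_distrib]
  refine Finset.sum_congr rfl fun j _ => ?_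
  obtain ⟨k', hk'⟩ := hs.mem j
  have hk'' : s j ∉ S (!k') := by
    intro h
    have := hs.notMem_inter j
    cases k'
    exacts [this ⟨h, hk'⟩, this ⟨hk', h⟩]
  rcases Bool.eq_or_eq_not k k' with rfl | rfl
  · rw [indicator_of_mem hk', indicator_of_notMem hk'', add_zero]
  · rw [Bool.not_not, indicator_of_mem hk', indicator_of_notMem hk'', zero_add]

theorem RegularSample.card_eq_add (hs : RegularSample d c S T M β l 1 s x) (k : Bool) (i : Fin n)
    (p p' : E) : ((neighbors x 1 i).card : ℝ) =
      clusterMoment (S k) s x i p 1 0 + clusterMoment (S (!k)) s x i p' 1 0 := by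
  have h1 := hs.sum_eq_add k i p 1 0
  have h2 : clusterMoment (S (!k)) s x i p 1 0 = clusterMoment (S (!k)) s x i p' 1 0 := by
    simp [clusterMoment]
  rw [h2] at h1
  rw [← h1]
  simp

theorem RegularSample.exists_moments (hs : RegularSample d c S T M β l 1 s x) :
    ∃ m > 0, ∀ k i, ∀ p ∈ S k, ‖s i - p‖ ≤ M → ∀ (α : ℝ) (u : E), |α| ≤ M → ‖u‖ ≤ 1 →
      m * (discMoment d c (T k p) (s i - p) (1 - β) α u - β) ≤ clusterMoment (S k) s x i p α u ∧
      clusterMoment (S k) s x i p α u ≤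
        m * (discMoment d c (T k p) (s i - p) (1 + β) α u + β) := by
  obtain ⟨m, hm, h⟩ := hs.moments
  refine ⟨m, hm, fun k i p hp hip α u hα hu => ?_⟩
  have := h k i p hp (by rwa [mul_one]) α u hα (by rwa [mul_one])
  rw [one_pow, mul_one, mul_one, mul_one, le_inv_mul_iff₀ hm, inv_mul_le_iff₀ hm] at this
  exact this

theorem one_add_pow_bounds (d : ℕ) {β : ℝ} (hβ0 : 0 ≤ β) (hβ1 : β ≤ 1) :
    (1 + β) ^ (d + 2) ≤ 1 + 2 ^ (d + 2) * β ∧ (1 + β) ^ d ≤ 1 + 2 ^ (d + 2) * β ∧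
      1 - 2 ^ (d + 2) * β ≤ (1 - β) ^ (d + 2) ∧ 1 - 2 ^ (d + 2) * β ≤ (1 - β) ^ d := by
  have h1 := one_add_pow_le_one_add_two_pow_mul (d + 2) hβ0 hβ1
  have h2 : 1 - 2 ^ (d + 2) * β ≤ (1 - β) ^ (d + 2) := by
    have h3 := one_add_mul_le_pow (by linarith : -2 ≤ -β) (d + 2)
    have h4 : ((d + 2 : ℕ) : ℝ) ≤ 2 ^ (d + 2) := by exact_mod_cast Nat.lt_two_pow_self.le
    have h5 := mul_le_mul_of_nonneg_right h4 hβ0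
    rw [← sub_eq_add_neg] at h3
    linarith
  refine ⟨h1, le_trans ?_ h1, h2, h2.trans ?_⟩
  · exact pow_le_pow_right₀ (by linarith) (by omega)
  · exact pow_le_pow_of_le_one (by linarith) (by linarith) (by omega)

theorem norm_starProjection_sq_le_one (V : Submodule ℝ E) {u : E} (hu : ‖u‖ = 1) :
    ‖V.starProjection u‖ ^ 2 ≤ 1 :=
  pow_le_one₀ (norm_nonneg _) ((V.norm_starProjection_apply_le u).trans hu.le)

/-- Where all neighbours come from one surface, the local covariance is a multiple of the
projection to the tangent space. -/
theorem RegularSample.norm_localCov_sub_le (hs : RegularSample d c S T M β l 1 s x) (hc : 0 < c)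
    (hc1 : c ≤ 1) (hM : 3 ≤ M) (hβ0 : 0 ≤ β) (hβ : 2 ^ (d + 2) * β ≤ 1 / 8) {k : Bool} {i : Fin n}
    (hi : s i ∈ S k) (hpure : ∀ j ∈ neighbors x 1 i, s j ∈ S k) :
    ‖localCov x 1 i - c • (T k (s i)).starProjection‖ ≤ 8 * 2 ^ (d + 2) * β := by
  obtain ⟨m, hm, hmom⟩ := hs.exists_moments
  have hB : (1 : ℝ) ≤ 2 ^ (d + 2) := one_le_pow₀ (by norm_num)
  have hβB : β ≤ 2 ^ (d + 2) * β := le_mul_of_one_le_left hβ0 hB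
  have hβ1 : β ≤ 1 / 8 := hβB.trans hβ
  obtain ⟨b1, b2, b3, b4⟩ := one_add_pow_bounds d hβ0 (by linarith)
  set P := (T k (s i)).starProjection with hP
  have hsym : (localCov x 1 i - c • P : E →L[ℝ] E).toLinearMap.IsSymmetric := by
    intro u v
    have h1 := isSymmetric_localCov x 1 i u v
    have h2 := (T k (s i)).starProjection_isSymmetric u v
    simp only [ContinuousLinearMap.coe_coe, sub_apply, smul_apply, inner_sub_left, inner_sub_right,
      real_inner_smul_left, real_inner_smul_right] at h1 h2 ⊢
    rw [h1, h2]
  refine norm_le_of_abs_inner_self_le hsym (fun u hu => ?_) (by positivity)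
  set q := ‖P u‖ ^ 2 with hq
  have hq0 : 0 ≤ q := sq_nonneg _
  have hq1 : q ≤ 1 := norm_starProjection_sq_le_one _ hu
  set V := ⟪localCov x 1 i u, u⟫ with hV
  have hVq : ⟪(localCov x 1 i - c • P) u, u⟫ = V - c * q := by
    rw [sub_apply, smul_apply, inner_sub_left, real_inner_smul_left, hP, inner_starProjection_self]
  rw [hVq]
  -- all neighbours are in the cluster
  have hclu : ∀ (α : ℝ) (v : E), ∑ j ∈ neighbors x 1 i, (α + ⟪x j - s i, v⟫) ^ 2 =
      clusterMoment (S k) s x i (s i) α v := fun α v =>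
    Finset.sum_congr rfl fun j hj => by rw [indicator_of_mem (hpure j hj)]
  set N := ((neighbors x 1 i).card : ℝ) with hN
  have hNcl : N = clusterMoment (S k) s x i (s i) 1 0 := by
    rw [← hclu]; simp [hN]
  have hmom' : ∀ (α : ℝ) (v : E), |α| ≤ M → ‖v‖ ≤ 1 →
      m * ((1 - β) ^ d * (α ^ 2 + c * (1 - β) ^ 2 * ‖P v‖ ^ 2) - β) ≤
        clusterMoment (S k) s x i (s i) α v ∧ clusterMoment (S k) s x i (s i) α v ≤
        m * ((1 + β) ^ d * (α ^ 2 + c * (1 + β) ^ 2 * ‖P v‖ ^ 2) + β) := by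
    intro α v hα hv
    have := hmom k i (s i) hi (by rw [sub_self, norm_zero]; linarith) α v hα hv
    rwa [sub_self, discMoment_zero_center d c _ (by linarith : 0 ≤ 1 - β),
      discMoment_zero_center d c _ (by linarith : 0 ≤ 1 + β)] at this
  obtain ⟨n1, n2⟩ := hmom' 1 0 (by rw [abs_one]; linarith) (by rw [norm_zero]; norm_num)
  rw [← hNcl, map_zero, norm_zero, zero_pow two_ne_zero, mul_zero, add_zero, one_pow, mul_one] at n1 n2
  set B : ℝ := 2 ^ (d + 2) with hBdef
  have n1' : m * (1 - 2 * (B * β)) ≤ N :=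
    (mul_le_mul_of_nonneg_left (by linarith) hm.le).trans n1
  have n2' : N ≤ m * (1 + 2 * (B * β)) :=
    n2.trans (mul_le_mul_of_nonneg_left (by linarith) hm.le)
  have hcq0 : 0 ≤ c * q := by positivity
  have hcq1 : c * q ≤ 1 := mul_le_one₀ hc1 hq0 hq1
  have hBβ0 : 0 ≤ B * β := by positivity
  have hup : V * N ≤ m * (c * q + 2 * (B * β)) := by
    have h1 := inner_localCov_self_le (x := x) (i := i) zero_le_one (s i) u 0
    rw [hclu] at h1
    have h2 := (hmom' 0 u (by rw [abs_zero]; linarith) hu.le).2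
    refine (h1.trans h2).trans (mul_le_mul_of_nonneg_left ?_ hm.le)
    have h3 : (1 + β) ^ d * (0 ^ 2 + c * (1 + β) ^ 2 * ‖P u‖ ^ 2) = (1 + β) ^ (d + 2) * (c * q) := by
      rw [hq]; ring
    rw [h3]
    have h4 : (1 + β) ^ (d + 2) * (c * q) ≤ (1 + B * β) * (c * q) := by gcongr
    have h5 : B * β * (c * q) ≤ B * β := mul_le_of_le_one_right hBβ0 hcq1
    linarith
  have hlow : m * (c * q - 2 * (B * β)) ≤ V * N := by
    have h1 := inner_localCov_self_eq (x := x) (i := i) zero_le_one (s i) u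
    rw [hclu] at h1
    set α := ⟪s i - sampleMean x (neighbors x 1 i), u⟫ with hα
    have hαM : |α| ≤ M := by
      have h2 := abs_real_inner_le_norm (s i - sampleMean x (neighbors x 1 i)) u
      have h3 := norm_sub_le_norm_sub_add_norm_sub (s i) (x i) (sampleMean x (neighbors x 1 i))
      have h4 := norm_sampleMean_sub_le (x := x) (i := i) zero_le_one
      have h5 := hs.noise i
      rw [norm_sub_rev] at h5
      rw [hu, mul_one] at h2
      linarith
    have h2 := (hmom' α u hαM hu.le).1
    rw [hV, hN, h1]
    refine le_trans (mul_le_mul_of_nonneg_left ?_ hm.le) h2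
    have h3 : (1 - β) ^ d * (α ^ 2 + c * (1 - β) ^ 2 * ‖P u‖ ^ 2) =
      (1 - β) ^ d * α ^ 2 + (1 - β) ^ (d + 2) * (c * q) := by rw [hq]; ring
    rw [h3]
    have h4 : (1 - B * β) * (c * q) ≤ (1 - β) ^ (d + 2) * (c * q) := by gcongr
    have h5 : B * β * (c * q) ≤ B * β := mul_le_of_le_one_right hBβ0 hcq1
    have h6 : 0 ≤ (1 - β) ^ d * α ^ 2 := by
      have : 0 ≤ 1 - β := by linarith
      positivity
    linarith
  have hV0 : 0 ≤ V := inner_localCov_self_nonneg x 1 i u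
  have e1 : V * (1 - 2 * (B * β)) ≤ c * q + 2 * (B * β) := by
    have h1 := mul_le_mul_of_nonneg_left n1' hV0
    have h2 : m * (V * (1 - 2 * (B * β))) ≤ m * (c * q + 2 * (B * β)) := by linarith
    exact le_of_mul_le_mul_left h2 hm
  have e2 : c * q - 2 * (B * β) ≤ V * (1 + 2 * (B * β)) := by
    have h1 := mul_le_mul_of_nonneg_left n2' hV0
    have h2 : m * (c * q - 2 * (B * β)) ≤ m * (V * (1 + 2 * (B * β))) := by linarith
    exact le_of_mul_le_mul_left h2 hm
  have hV2 : V ≤ 2 := by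
    have : V * (2 * (B * β)) ≤ V * (1 / 4) := by gcongr; linarith
    linarith
  have e3 : V * (2 * (B * β)) ≤ 2 * (2 * (B * β)) := by gcongr
  rw [abs_le]
  constructor <;> linarith

/-- The local covariance is never small along the tangent space. -/
theorem RegularSample.le_inner_localCov (hs : RegularSample d c S T M β l 1 s x) (hc : 0 < c)
    (hc1 : c ≤ 1) (hM : 3 ≤ M) (hβ0 : 0 ≤ β) (hβ : 2 ^ (d + 2) * β ≤ 1 / 8) {k : Bool} {i : Fin n}
    (hi : s i ∈ S k) {u : E} (hu : ‖u‖ = 1) :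
    c / 4 * ‖(T k (s i)).starProjection u‖ ^ 2 - 2 ^ (d + 2) * β ≤ ⟪localCov x 1 i u, u⟫ := by
  obtain ⟨m, hm, hmom⟩ := hs.exists_moments
  have hB : (1 : ℝ) ≤ 2 ^ (d + 2) := one_le_pow₀ (by norm_num)
  have hβB : β ≤ 2 ^ (d + 2) * β := le_mul_of_one_le_left hβ0 hB
  have hβ1 : β ≤ 1 / 8 := hβB.trans hβ
  obtain ⟨b1, b2, b3, b4⟩ := one_add_pow_bounds d hβ0 (by linarith)
  set B : ℝ := 2 ^ (d + 2) with hBdef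
  set P := (T k (s i)).starProjection with hP
  set q := ‖P u‖ ^ 2 with hq
  have hq0 : 0 ≤ q := sq_nonneg _
  have hq1 : q ≤ 1 := norm_starProjection_sq_le_one _ hu
  have hcq0 : 0 ≤ c * q := by positivity
  have hcq1 : c * q ≤ 1 := mul_le_one₀ hc1 hq0 hq1
  have hBβ0 : 0 ≤ B * β := by positivity
  set V := ⟪localCov x 1 i u, u⟫ with hV
  have hV0 : 0 ≤ V := inner_localCov_self_nonneg x 1 i u
  have hcount : ∀ k' (p : E), p ∈ S k' → ‖s i - p‖ ≤ M →
      clusterMoment (S k') s x i p 1 0 ≤ m * (1 + 2 * (B * β)) := by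
    intro k' p hp hip
    refine (hmom k' i p hp hip 1 0 (by rw [abs_one]; linarith)
      (by rw [norm_zero]; norm_num)).2.trans (mul_le_mul_of_nonneg_left ?_ hm.le)
    have h1 := discMoment_le (d := d) hc.le hc1 (T k' p) (s i - p) (by linarith : 0 ≤ 1 + β) 1 0
    rw [norm_zero, mul_zero, mul_zero, abs_one, add_zero, one_pow, zero_pow two_ne_zero, add_zero,
      mul_one] at h1
    linarith
  have hother : clusterMoment (S (!k)) s x i (s i) 1 0 ≤ m * (1 + 2 * (B * β)) := by
    by_cases hex : ∃ j ∈ neighbors x 1 i, s j ∈ S (!k)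
    · obtain ⟨j, hj, hjS⟩ := hex
      have h1 := hcount (!k) (s j) hjS (by
        have h2 : s i - s j = -(x i - s i) + (x i - x j) + (x j - s j) := by abel
        have h3 := norm_add₃_le (a := -(x i - s i)) (b := x i - x j) (c := x j - s j)
        rw [← h2, norm_neg] at h3
        linarith [hs.noise i, hs.noise j, mem_neighbors.1 hj])
      have h2 : clusterMoment (S (!k)) s x i (s j) 1 0 = clusterMoment (S (!k)) s x i (s i) 1 0 := by
        simp [clusterMoment]
      rwa [h2] at h1
    · push Not at hex
      have h1 : clusterMoment (S (!k)) s x i (s i) 1 0 = 0 :=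
        Finset.sum_eq_zero fun j hj => indicator_of_notMem (hex j hj) _
      rw [h1]
      positivity
  have hN := hs.card_eq_add k i (s i) (s i)
  have hown := hcount k (s i) hi (by rw [sub_self, norm_zero]; linarith)
  have hN4 : ((neighbors x 1 i).card : ℝ) ≤ m * 4 := by
    have : m * (1 + 2 * (B * β)) ≤ m * 2 := by gcongr; linarith
    linarith
  have hlow : m * (c * q - 2 * (B * β)) ≤ V * (neighbors x 1 i).card := by
    rw [inner_localCov_self_eq zero_le_one (s i) u, hs.sum_eq_add k]
    set α := ⟪s i - sampleMean x (neighbors x 1 i), u⟫ with hα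
    have hαM : |α| ≤ M := by
      have h2 := abs_real_inner_le_norm (s i - sampleMean x (neighbors x 1 i)) u
      have h3 := norm_sub_le_norm_sub_add_norm_sub (s i) (x i) (sampleMean x (neighbors x 1 i))
      have h4 := norm_sampleMean_sub_le (x := x) (i := i) zero_le_one
      have h5 := hs.noise i
      rw [norm_sub_rev] at h5
      rw [hu, mul_one] at h2
      linarith
    have h2 := (hmom k i (s i) hi (by rw [sub_self, norm_zero]; linarith) α u hαM hu.le).1
    rw [sub_self, discMoment_zero_center d c _ (by linarith : 0 ≤ 1 - β)] at h2
    refine le_add_of_le_of_nonneg (le_trans (mul_le_mul_of_nonneg_left ?_ hm.le) h2)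
      (clusterMoment_nonneg _ _ _ _ _ _ _)
    have h3 : (1 - β) ^ d * (α ^ 2 + c * (1 - β) ^ 2 * ‖P u‖ ^ 2) =
      (1 - β) ^ d * α ^ 2 + (1 - β) ^ (d + 2) * (c * q) := by rw [hq]; ring
    rw [h3]
    have h4 : (1 - B * β) * (c * q) ≤ (1 - β) ^ (d + 2) * (c * q) := by gcongr
    have h5 : B * β * (c * q) ≤ B * β := mul_le_of_le_one_right hBβ0 hcq1
    have h6 : 0 ≤ (1 - β) ^ d * α ^ 2 := by
      have : 0 ≤ 1 - β := by linarith
      positivity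
    linarith
  have h1 : m * (c * q - 2 * (B * β)) ≤ m * (V * 4) := by
    have := mul_le_mul_of_nonneg_left hN4 hV0
    linarith
  have h2 := le_of_mul_le_mul_left h1 hm
  linarith

end LocalCovariances

section VarianceGap

open Set Filter Metric Topology

set_option linter.unusedSectionVars false

/-- Two mixtures of two populations, of variances `0` and `c * ρ ^ 2 * q` with weights `1 : w`, and of
variances `0` and `c * q` with weights `w' : 1`, whose means are the same distance `μ` apart. If
`w ≤ w' ≤ 1` the second mixture is better balanced and has the larger variance. -/
theorem variance_gap {w w' N N' V V' μ g e e' : ℝ} (hw : 0 ≤ w) (hww' : w ≤ w') (hw' : w' ≤ 1)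
    (hg : 0 ≤ g) (hV0 : 0 ≤ V) (hV : V ≤ 4) (hV'0 : 0 ≤ V') (hV' : V' ≤ 4)
    (he : 0 ≤ e) (hee' : e ≤ e')
    (hN : 1 + w - 2 * g ≤ N) (hN' : N' ≤ 1 + w' + 2 * g)
    (hVN : V * N ≤ w / (1 + w) * μ ^ 2 + w * e + 2 * g)
    (hVN' : w' / (1 + w') * μ ^ 2 + e' - 2 * g ≤ V' * N') :
    (e' - e) / 2 - 20 * g ≤ V' - V := by
  have h1w : 0 < 1 + w := by linarith
  have h1w' : 0 < 1 + w' := by linarith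
  have h1 : V * (1 + w) ≤ w / (1 + w) * μ ^ 2 + w * e + 10 * g := by
    have := mul_le_mul_of_nonneg_left hN hV0
    have h2 : V * (2 * g) ≤ 4 * (2 * g) := by gcongr
    linarith
  have h2 : w' / (1 + w') * μ ^ 2 + e' - 10 * g ≤ V' * (1 + w') := by
    have := mul_le_mul_of_nonneg_left hN' hV'0
    have h2 : V' * (2 * g) ≤ 4 * (2 * g) := by gcongr
    linarith
  have h3 : V ≤ w / (1 + w) ^ 2 * μ ^ 2 + e / 2 + 10 * g := by
    have e1 : V ≤ (w / (1 + w) * μ ^ 2 + w * e + 10 * g) / (1 + w) := by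
      rwa [le_div_iff₀ h1w]
    have e2 : (w / (1 + w) * μ ^ 2 + w * e + 10 * g) / (1 + w) =
        w / (1 + w) ^ 2 * μ ^ 2 + w / (1 + w) * e + 10 * g / (1 + w) := by
      field_simp
    have e3 : w / (1 + w) * e ≤ 1 / 2 * e := by
      gcongr ?_ * _
      rw [div_le_div_iff₀ h1w two_pos]
      linarith
    have e4 : 10 * g / (1 + w) ≤ 10 * g := div_le_self (by positivity) (by linarith)
    linarith
  have h4 : w' / (1 + w') ^ 2 * μ ^ 2 + e' / 2 - 10 * g ≤ V' := by
    have e1 : (w' / (1 + w') * μ ^ 2 + e' - 10 * g) / (1 + w') ≤ V' := by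
      rwa [div_le_iff₀ h1w']
    have e2 : (w' / (1 + w') * μ ^ 2 + e' - 10 * g) / (1 + w') =
        w' / (1 + w') ^ 2 * μ ^ 2 + e' / (1 + w') - 10 * g / (1 + w') := by
      field_simp
    have e3 : e' / 2 ≤ e' / (1 + w') := by
      gcongr
      · linarith
      · linarith
    have e4 : 10 * g / (1 + w') ≤ 10 * g := div_le_self (by positivity) (by linarith)
    linarith
  have h5 : w / (1 + w) ^ 2 * μ ^ 2 ≤ w' / (1 + w') ^ 2 * μ ^ 2 := by
    gcongr ?_ * _
    rw [div_le_div_iff₀ (by positivity) (by positivity)]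
    have h6 : w * w' ≤ 1 := mul_le_one₀ (hww'.trans hw') (hw.trans hww') hw'
    linarith [mul_nonneg (sub_nonneg.2 hww') (sub_nonneg.2 h6)]
  linarith

/-- The second moment of a two-point distribution about any point is at least its variance. -/
theorem div_mul_sq_le {w : ℝ} (hw : 0 ≤ w) (α μ : ℝ) :
    w / (1 + w) * μ ^ 2 ≤ w * α ^ 2 + (α + μ) ^ 2 := by
  have h1w : 0 < 1 + w := by linarith
  rw [div_mul_eq_mul_div, div_le_iff₀ h1w]
  linarith [sq_nonneg ((1 + w) * α + μ)]

variable {E : Type*} [NormedAddCommGroup E] [InnerProductSpace ℝ E] [FiniteDimensional ℝ E]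
  {d n : ℕ} {c M β l : ℝ} {S : Bool → Set E} {T : Bool → E → Submodule ℝ E}
  {s x : Fin n → E}

/-- Near a crossing point `p`, a data point at position `a` in one tangent space and a data point
at the projection of `a` to the other have different local covariances. In a direction `v` normal
to the first space, the variance at the second point is larger: there the second surface is seen
in a disc of full radius and the two surfaces have more balanced masses, while the distance between
their means in the direction `v` is the same. -/
theorem RegularSample.gap (hs : RegularSample d c S T M β l 1 s x) (hc : 0 < c)
    {δ γ : ℝ} (hmod : ∀ (T : Submodule ℝ E) (v v₀ : E) (R α : ℝ) (u : E), ‖v₀‖ ≤ M → ‖v - v₀‖ ≤ δ →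
      |R - 1| ≤ δ → |α| ≤ M → ‖u‖ ≤ 1 →
      |discMoment d c T v R α u - discMoment d c T v₀ 1 α u| ≤ γ) (hβ0 : 0 ≤ β) (hβδ : β ≤ δ)
    (hδ : δ ≤ 1) {p : E} (hp : p ∈ S true ∩ S false) {k : Bool} {i j : Fin n} {a : E}
    (ha : a ∈ T k p) (haM : ‖a‖ + 4 ≤ M) (hi : ‖s i - p - a‖ ≤ δ)
    (hj : ‖s j - p - (T (!k) p).starProjection a‖ ≤ δ) {v : E} (hv : ‖v‖ = 1)
    (hPv : (T k p).starProjection v = 0) {t : ℝ} (ht0 : 0 ≤ t) (ht1 : t ≤ 1)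
    (ht : t ≤ ‖a - (T (!k) p).starProjection a‖) :
    c * ‖(T (!k) p).starProjection v‖ ^ 2 * t ^ 2 / 2 - 20 * (γ + β) ≤
      ‖localCov x 1 i - localCov x 1 j‖ := by
  obtain ⟨m, hm, hmom⟩ := hs.exists_moments
  set P₁ := (T k p).starProjection with hP₁
  set P₂ := (T (!k) p).starProjection with hP₂
  set b := P₂ a with hb
  have hbT : b ∈ T (!k) p := (T (!k) p).starProjection_apply_mem a
  have hbM : ‖b‖ ≤ ‖a‖ := (T (!k) p).norm_starProjection_apply_le a
  have ha0 := norm_nonneg a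
  have hp1 := Crossing.mem_of_mem_inter hp k
  have hp2 := Crossing.mem_of_mem_inter hp (!k)
  have hdist : ∀ {i' : Fin n} {a' : E}, ‖s i' - p - a'‖ ≤ δ → ‖s i' - p‖ ≤ ‖a'‖ + 1 := by
    intro i' a' h
    have := norm_add_le (s i' - p - a') a'
    rw [sub_add_cancel] at this
    linarith
  have hip : ‖s i - p‖ ≤ M := (hdist hi).trans (by linarith)
  have hjp : ‖s j - p‖ ≤ M := (hdist hj).trans (by linarith)
  -- empirical moments are within `γ + β` of the ideal ones
  have hideal : ∀ (k' : Bool) (i' : Fin n) (a' : E), ‖a'‖ ≤ M → ‖s i' - p - a'‖ ≤ δ →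
      ‖s i' - p‖ ≤ M → ∀ (α : ℝ) (u : E), |α| ≤ M → ‖u‖ ≤ 1 →
      m * (discMoment d c (T k' p) a' 1 α u - (γ + β)) ≤ clusterMoment (S k') s x i' p α u ∧
      clusterMoment (S k') s x i' p α u ≤
        m * (discMoment d c (T k' p) a' 1 α u + (γ + β)) := by
    intro k' i' a' ha' hia' hi' α u hα hu
    obtain ⟨h1, h2⟩ := hmom k' i' p (Crossing.mem_of_mem_inter hp k') hi' α u hα hu
    have h3 := (abs_le.1 (hmod (T k' p) (s i' - p) a' (1 - β) α u ha' hia'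
      (by rw [sub_sub_cancel_left, abs_neg, abs_of_nonneg hβ0]; exact hβδ) hα hu)).1
    have h4 := (abs_le.1 (hmod (T k' p) (s i' - p) a' (1 + β) α u ha' hia'
      (by rw [add_sub_cancel_left, abs_of_nonneg hβ0]; exact hβδ) hα hu)).2
    exact ⟨(mul_le_mul_of_nonneg_left (by linarith) hm.le).trans h1,
      h2.trans (mul_le_mul_of_nonneg_left (by linarith) hm.le)⟩
  set g := γ + β with hg
  set w := discRadius (T (!k) p) a 1 ^ d with hw
  set w' := discRadius (T k p) b 1 ^ d with hw'
  set ρ := discRadius (T (!k) p) a 1 with hρ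
  set μ := ⟪b, v⟫ with hμ
  set q := ‖P₂ v‖ ^ 2 with hq
  have hq0 : 0 ≤ q := sq_nonneg _
  have hρ0 : 0 ≤ ρ := discRadius_nonneg _ _ _
  have hw0 : 0 ≤ w := pow_nonneg hρ0 d
  have hρt : ρ ^ 2 ≤ 1 - t ^ 2 := by
    have h1 : t ^ 2 ≤ ‖a - P₂ a‖ ^ 2 := pow_le_pow_left₀ ht0 ht 2
    have h2 : t ^ 2 ≤ 1 := pow_le_one₀ ht0 ht1
    rw [hρ, discRadius, Real.sq_sqrt', one_pow]
    exact max_le (by linarith) (by linarith)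
  have hww' : w ≤ w' := by
    refine pow_le_pow_left₀ hρ0 ?_ d
    refine Real.sqrt_le_sqrt (sub_le_sub_left (pow_le_pow_left₀ (norm_nonneg _) ?_ 2) _)
    refine (norm_sub_starProjection_le (T k p) b ha).trans ?_
    rw [norm_sub_rev]
  have hw'1 : w' ≤ 1 := pow_le_one₀ (discRadius_nonneg _ _ _) (discRadius_le _ _ zero_le_one)
  have hort : ∀ z, ⟪P₁ z, v⟫ = 0 := by
    intro z
    have := (T k p).starProjection_isSymmetric z v
    simp only [ContinuousLinearMap.coe_coe] at this
    rw [this, hPv, inner_zero_right]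
  -- the four ideal moments: since `v` is normal to the first space, only its offset `α` is seen there
  have dA : ∀ α, discMoment d c (T k p) a 1 α v = α ^ 2 := by
    intro α
    rw [discMoment, discRadius_of_mem ha zero_le_one, ← hP₁, hort, hPv, norm_zero]
    ring
  have dB : ∀ α, discMoment d c (T (!k) p) a 1 α v = w * ((α + μ) ^ 2 + c * ρ ^ 2 * q) := fun α => rfl
  have dC : ∀ α, discMoment d c (T k p) b 1 α v = w' * α ^ 2 := by
    intro α
    rw [discMoment, ← hP₁, hort, hPv, norm_zero]
    ring
  have dD : ∀ α, discMoment d c (T (!k) p) b 1 α v = (α + μ) ^ 2 + c * q := by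
    intro α
    rw [discMoment, discRadius_of_mem hbT zero_le_one, starProjection_of_mem hbT]
    ring
  have dA' : discMoment d c (T k p) a 1 1 0 = 1 := by
    rw [discMoment, discRadius_of_mem ha zero_le_one, inner_zero_right, map_zero, norm_zero]
    ring
  have dB' : discMoment d c (T (!k) p) a 1 1 0 = w := by
    rw [discMoment, inner_zero_right, map_zero, norm_zero]
    ring
  have dC' : discMoment d c (T k p) b 1 1 0 = w' := by
    rw [discMoment, inner_zero_right, map_zero, norm_zero]
    ring
  have dD' : discMoment d c (T (!k) p) b 1 1 0 = 1 := by
    rw [discMoment, discRadius_of_mem hbT zero_le_one, inner_zero_right, map_zero, norm_zero]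
    ring
  have h1M : |(1 : ℝ)| ≤ M := by rw [abs_one]; linarith
  have h01 : ‖(0 : E)‖ ≤ 1 := by rw [norm_zero]; norm_num
  have haM' : ‖a‖ ≤ M := by linarith
  have hbM' : ‖b‖ ≤ M := by linarith
  set V := ⟪localCov x 1 i v, v⟫ with hV
  set V' := ⟪localCov x 1 j v, v⟫ with hV'
  set N : ℝ := (neighbors x 1 i).card / m with hN
  set N' : ℝ := (neighbors x 1 j).card / m with hN'
  have hNm : (neighbors x 1 i).card = m * N := by rw [hN, mul_comm, div_mul_cancel₀ _ hm.ne']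
  have hNm' : (neighbors x 1 j).card = m * N' := by rw [hN', mul_comm, div_mul_cancel₀ _ hm.ne']
  have hg0 : 0 ≤ g := by
    have h1 := hideal k i a haM' hi hip 1 0 h1M h01
    have h2 := le_of_mul_le_mul_left (h1.1.trans h1.2) hm
    linarith
  have hμM : |μ| ≤ ‖a‖ := by
    have := abs_real_inner_le_norm b v
    rw [hv, mul_one] at this
    linarith
  have hNlow : 1 + w - 2 * g ≤ N := by
    have h1 := (hideal k i a haM' hi hip 1 0 h1M h01).1
    have h2 := (hideal (!k) i a haM' hi hip 1 0 h1M h01).1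
    have h3 := hs.card_eq_add k i p p
    rw [dA'] at h1
    rw [dB'] at h2
    have h4 : m * (1 + w - 2 * g) ≤ m * N := by linarith
    exact le_of_mul_le_mul_left h4 hm
  have hNup : N' ≤ 1 + w' + 2 * g := by
    have h1 := (hideal k j b hbM' hj hjp 1 0 h1M h01).2
    have h2 := (hideal (!k) j b hbM' hj hjp 1 0 h1M h01).2
    have h3 := hs.card_eq_add k j p p
    rw [dC'] at h1
    rw [dD'] at h2
    have h4 : m * N' ≤ m * (1 + w' + 2 * g) := by linarith
    exact le_of_mul_le_mul_left h4 hm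
  have hVN : V * N ≤ w / (1 + w) * μ ^ 2 + w * (c * ρ ^ 2 * q) + 2 * g := by
    have h1w : 0 < 1 + w := by linarith
    -- the mean of the ideal mixture
    set α := -(w / (1 + w) * μ) with hα
    have hαM : |α| ≤ M := by
      rw [hα, abs_neg, abs_mul, abs_of_nonneg (by positivity : 0 ≤ w / (1 + w))]
      have h2 : w / (1 + w) ≤ 1 := (div_le_one h1w).2 (by linarith)
      calc w / (1 + w) * |μ| ≤ 1 * ‖a‖ := by gcongr
        _ ≤ M := by linarith
    have h1 := inner_localCov_self_le (x := x) (i := i) zero_le_one p v α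
    rw [hs.sum_eq_add k, hNm] at h1
    have h2 := (hideal k i a haM' hi hip α v hαM hv.le).2
    have h3 := (hideal (!k) i a haM' hi hip α v hαM hv.le).2
    rw [dA] at h2
    rw [dB] at h3
    have h4 : α ^ 2 + w * (α + μ) ^ 2 = w / (1 + w) * μ ^ 2 := by
      rw [hα]; field_simp; ring
    have h5 : m * (V * N) ≤ m * (α ^ 2 + w * (α + μ) ^ 2 + w * (c * ρ ^ 2 * q) + 2 * g) := by
      linarith
    rw [h4] at h5
    exact le_of_mul_le_mul_left h5 hm
  have hVN' : w' / (1 + w') * μ ^ 2 + c * q - 2 * g ≤ V' * N' := by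
    have h1 := inner_localCov_self_eq (x := x) (i := j) zero_le_one p v
    rw [hs.sum_eq_add k, hNm'] at h1
    -- the actual mean is no better than that of the ideal mixture
    set α := ⟪p - sampleMean x (neighbors x 1 j), v⟫ with hα
    have hαM : |α| ≤ M := by
      have h2 := abs_real_inner_le_norm (p - sampleMean x (neighbors x 1 j)) v
      have h3 := norm_sub_le_norm_sub_add_norm_sub p (x j) (sampleMean x (neighbors x 1 j))
      have h4 := norm_sampleMean_sub_le (x := x) (i := j) zero_le_one
      have h5 := hs.noise j
      have h6 := norm_sub_le_norm_sub_add_norm_sub (x j) (s j) p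
      rw [norm_sub_rev (x j) p] at h6
      have h7 := hdist hj
      rw [hv, mul_one] at h2
      linarith
    have h2 := (hideal k j b hbM' hj hjp α v hαM hv.le).1
    have h3 := (hideal (!k) j b hbM' hj hjp α v hαM hv.le).1
    rw [dC] at h2
    rw [dD] at h3
    have h4 := div_mul_sq_le (hw0.trans hww') α μ
    have h5 : m * (w' * α ^ 2 + (α + μ) ^ 2 + c * q - 2 * g) ≤ m * (V' * N') := by linarith
    have h6 := le_of_mul_le_mul_left h5 hm
    linarith
  have hbound : ∀ i', ⟪localCov x 1 i' v, v⟫ ≤ 4 := by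
    intro i'
    have h1 := (le_abs_self _).trans (abs_real_inner_le_norm (localCov x 1 i' v) v)
    have h2 := (localCov x 1 i').le_opNorm v
    rw [hv, mul_one] at h1 h2
    exact h1.trans (h2.trans (norm_localCov_le x i'))
  have hfin := variance_gap hw0 hww' hw'1 hg0 (inner_localCov_self_nonneg x 1 i v) (hbound i)
    (inner_localCov_self_nonneg x 1 j v) (hbound j) (by positivity : 0 ≤ c * ρ ^ 2 * q) (by
      have : ρ ^ 2 ≤ 1 := hρt.trans (by linarith [sq_nonneg t])
      have h1 : c * ρ ^ 2 * q ≤ c * 1 * q := by gcongr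
      linarith) hNlow hNup hVN hVN'
  have hnorm : V' - V ≤ ‖localCov x 1 i - localCov x 1 j‖ := by
    have h1 := (neg_le_abs _).trans (abs_real_inner_le_norm ((localCov x 1 i - localCov x 1 j) v) v)
    have h2 := (localCov x 1 i - localCov x 1 j).le_opNorm v
    rw [hv, mul_one] at h1 h2
    rw [sub_apply, inner_sub_left] at h1
    rw [sub_apply] at h2
    linarith
  have hgap : c * q * t ^ 2 ≤ c * q - c * ρ ^ 2 * q := by
    have h1 : c * q * t ^ 2 ≤ c * q * (1 - ρ ^ 2) := by
      gcongr
      linarith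
    linarith
  linarith

end VarianceGap

/-! ### Points that see both surfaces -/

section MixedPoints

open Set Filter Metric Topology

set_option linter.unusedSectionVars false

variable {E : Type*} [NormedAddCommGroup E] [InnerProductSpace ℝ E] [FiniteDimensional ℝ E]
  {d n : ℕ} {c κ K M β l : ℝ} {S : Bool → Set E} {T : Bool → E → Submodule ℝ E}
  {s x : Fin n → E}

/-- A point of one surface close to the other is close to a crossing point. -/
theorem Crossing.exists_mem_inter_norm_le (h : Crossing d S T κ K) {k : Bool} {y z : E}
    (hy : y ∈ S k) (hz : z ∈ S (!k)) : ∃ p ∈ S true ∩ S false, ‖y - p‖ ≤ K * ‖y - z‖ := by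
  obtain ⟨p, hp, hyp⟩ :=
    ((h.isCompact true).inter (h.isCompact false)).exists_infDist_eq_dist h.meet y
  refine ⟨p, hp, ?_⟩
  rw [← dist_eq_norm, ← dist_eq_norm, ← hyp]
  refine (h.regular k y hy).trans ?_
  have := h.one_le
  gcongr
  exact infDist_le_dist_of_mem hz

/-- A unit normal to one tangent space at a crossing point that is not normal to the other: the
normal part of a transversal vector of the other tangent space. -/
theorem Crossing.exists_normal (h : Crossing d S T κ K) (k : Bool) {p : E}
    (hp : p ∈ S true ∩ S false) :
    ∃ v : E, ‖v‖ = 1 ∧ (T k p).starProjection v = 0 ∧ 1 ≤ K * ‖(T (!k) p).starProjection v‖ := by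
  obtain ⟨e, heT, he, hKe⟩ := h.angle (!k) p hp
  rw [Bool.not_not] at hKe
  have hK := h.one_le
  set P := (T k p).starProjection with hP
  set y := e - P e with hy
  have hy0 : 0 < ‖y‖ := by
    by_contra! hneg
    have : K * ‖y‖ ≤ 0 := mul_nonpos_of_nonneg_of_nonpos (by linarith) hneg
    linarith
  have hPy : P y = 0 := by
    rw [hy, map_sub, starProjection_of_mem ((T k p).starProjection_apply_mem e), sub_self]
  have hye : ⟪y, e⟫ = ‖y‖ ^ 2 := by
    have h1 : ⟪P e, y⟫ = 0 := by
      have := (T k p).starProjection_isSymmetric e y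
      simp only [ContinuousLinearMap.coe_coe] at this
      rw [← hP, hPy, inner_zero_right] at this
      exact this
    have h2 : e = y + P e := by rw [hy]; abel
    conv_lhs => rw [h2]
    rw [inner_add_right, real_inner_comm, real_inner_comm (P e) y, h1, add_zero,
      real_inner_self_eq_norm_sq]
  refine ⟨‖y‖⁻¹ • y, ?_, ?_, hKe.trans ?_⟩
  · rw [norm_smul, norm_inv, norm_norm, inv_mul_cancel₀ hy0.ne']
  · rw [map_smul, hPy, smul_zero]
  · refine mul_le_mul_of_nonneg_left ?_ (by linarith)
    rw [map_smul, norm_smul, norm_inv, norm_norm, le_inv_mul_iff₀ hy0, ← sq, ← hye,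
      ← inner_starProjection_of_mem y heT]
    refine (real_inner_le_norm _ _).trans ?_
    rw [he, mul_one]

/-- A sample point near a prescribed position in the tangent space of a crossing point. -/
theorem RegularSample.exists_near (hs : RegularSample d c S T M β l 1 s x)
    (h : Crossing d S T κ K) (k : Bool) {p : E} (hp : p ∈ S true ∩ S false) {w : E}
    (hw : w ∈ T k p) {L : ℝ} (hwL : ‖w‖ ≤ L) (hκL : κ * L ≤ 1) :
    ∃ j, s j ∈ S k ∧ ‖s j - p - w‖ ≤ l + 4 * κ * L ^ 2 := by
  have hκ := h.nonneg
  have hpk := Crossing.mem_of_mem_inter hp k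
  obtain ⟨y, hyS, hyw, hyn⟩ := h.lift k p hpk w hw
    ((mul_le_mul_of_nonneg_left hwL hκ).trans hκL)
  obtain ⟨j, hj, hjy⟩ := hs.cover k y hyS
  refine ⟨j, hj, ?_⟩
  have h1 := h.near k p hpk y hyS
  rw [hyw] at h1
  have h2 : κ * ‖y - p‖ ^ 2 ≤ 4 * κ * L ^ 2 := by
    calc κ * ‖y - p‖ ^ 2 ≤ κ * (2 * L) ^ 2 := by gcongr; linarith
      _ = _ := by ring
  have h3 : s j - p - w = (s j - y) + (y - p - w) := by abel
  rw [h3]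
  exact (norm_add_le _ _).trans (by linarith)

/-- Noise at most `b` changes distances by at most `2 * b`. -/
theorem norm_sub_le_of_noise {s s' x x' : E} {b : ℝ} (h : ‖x - s‖ ≤ b) (h' : ‖x' - s'‖ ≤ b) :
    ‖s - s'‖ ≤ ‖x - x'‖ + 2 * b ∧ ‖x - x'‖ ≤ ‖s - s'‖ + 2 * b := by
  constructor
  · have h2 : s - s' = -(x - s) + (x - x') + (x' - s') := by abel
    have h3 := norm_add₃_le (a := -(x - s)) (b := x - x') (c := x' - s')
    rw [← h2, norm_neg] at h3
    linarith
  · have h2 : x - x' = (x - s) + (s - s') + -(x' - s') := by abel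
    have h3 := norm_add₃_le (a := x - s) (b := s - s') (c := -(x' - s'))
    rw [← h2, norm_neg] at h3
    linarith

theorem RegularSample.norm_sub_le (hs : RegularSample d c S T M β l 1 s x) (i j : Fin n) :
    ‖s i - s j‖ ≤ ‖x i - x j‖ + 2 * β ∧ ‖x i - x j‖ ≤ ‖s i - s j‖ + 2 * β :=
  norm_sub_le_of_noise ((hs.noise i).trans_eq (mul_one β)) ((hs.noise j).trans_eq (mul_one β))

/-- A data point with neighbours from both surfaces has a neighbour with a substantially different
local covariance. If the point is far from the other surface, a point near its projection to the
other surface serves; otherwise such a pair is found among its neighbours after moving a little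
along its own surface, away from the other one. -/
theorem exists_mixed_bound (E : Type*) [NormedAddCommGroup E] [InnerProductSpace ℝ E]
    [FiniteDimensional ℝ E] (d : ℕ) {c K : ℝ} (hc : 0 < c) (hK : 1 ≤ K) :
    ∃ M l b : ℝ, 3 ≤ M ∧ 0 < l ∧ l ≤ 1 / 8 ∧ 0 < b ∧ ∀ {n : ℕ} {κ β : ℝ} {S : Bool → Set E}
      {T : Bool → E → Submodule ℝ E} {s x : Fin n → E}, Crossing d S T κ K →
      RegularSample d c S T M β l 1 s x → κ ≤ b → 0 ≤ β → β ≤ b → ∀ {k : Bool} {i j : Fin n},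
      s i ∈ S k → s j ∈ S (!k) → ‖x i - x j‖ ≤ 1 →
      ∃ j', ‖x i - x j'‖ ≤ 1 ∧ b < ‖localCov x 1 i - localCov x 1 j'‖ := by
  obtain ⟨t, ht⟩ : ∃ t : ℝ, t = 1 / (8 * K) := ⟨_, rfl⟩
  have ht0 : 0 < t := by rw [ht]; positivity
  have htK : t * K = 1 / 8 := by rw [ht]; field_simp
  have ht1 : t ≤ 1 / 8 := by
    rw [← htK]; exact le_mul_of_one_le_right ht0.le hK
  obtain ⟨g, hg⟩ : ∃ g : ℝ, g = c * (K⁻¹) ^ 2 * t ^ 2 / 2 := ⟨_, rfl⟩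
  have hg0 : 0 < g := by rw [hg]; positivity
  obtain ⟨δ', hδ', hmod'⟩ := exists_discMoment_modulus (E := E) d c (2 * K + 6)
    (by positivity : 0 < g / 80)
  obtain ⟨δ, hδ⟩ : ∃ δ, δ = min δ' (1 / 16) := ⟨_, rfl⟩
  have hδ0 : 0 < δ := by rw [hδ]; exact lt_min hδ' (by norm_num)
  have hδ16 : δ ≤ 1 / 16 := by rw [hδ]; exact min_le_right _ _
  have hδδ' : δ ≤ δ' := by rw [hδ]; exact min_le_left _ _
  have hmod : ∀ (T : Submodule ℝ E) (v v₀ : E) (R α : ℝ) (u : E), ‖v₀‖ ≤ 2 * K + 6 →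
      ‖v - v₀‖ ≤ δ → |R - 1| ≤ δ → |α| ≤ 2 * K + 6 → ‖u‖ ≤ 1 →
      |discMoment d c T v R α u - discMoment d c T v₀ 1 α u| ≤ g / 80 :=
    fun T v v₀ R α u h1 h2 h3 => hmod' T v v₀ R α u h1 (h2.trans hδδ') (h3.trans hδδ')
  have hδsq : δ ^ 2 ≤ δ / 16 := by
    calc δ ^ 2 = δ * δ := sq δ
      _ ≤ δ * (1 / 16) := by gcongr
      _ = δ / 16 := by ring
  obtain ⟨l, hl⟩ : ∃ l, l = δ ^ 2 / 48 := ⟨_, rfl⟩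
  have hl0 : 0 < l := by rw [hl]; positivity
  obtain ⟨b, hb⟩ : ∃ b, b = min (δ ^ 2 / (48 * (48 * K ^ 2))) (g / 80) := ⟨_, rfl⟩
  have hb0 : 0 < b := by rw [hb]; positivity
  have hbg : b ≤ g / 80 := by rw [hb]; exact min_le_right _ _
  have hbδ : 48 * K ^ 2 * b ≤ l := by
    have h1 : b ≤ δ ^ 2 / (48 * (48 * K ^ 2)) := by rw [hb]; exact min_le_left _ _
    rw [le_div_iff₀ (by positivity)] at h1
    rw [hl]; linarith
  have hK2 : 1 ≤ K ^ 2 := one_le_pow₀ hK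
  have hKK : K ≤ K ^ 2 := by rw [sq]; exact le_mul_of_one_le_left (by linarith) hK
  have hb1 : b ≤ δ := by
    have : 1 * b ≤ 48 * K ^ 2 * b := by gcongr; linarith
    linarith
  refine ⟨2 * K + 6, l, b, by linarith, hl0, by linarith, hb0, ?_⟩
  intro n κ β S T s x h hs hκb hβ0 hβb k i j hi hj hij
  have hκ := h.nonneg
  obtain ⟨ζ, hζ⟩ : ∃ ζ, ζ = 40 * K ^ 2 * κ := ⟨_, rfl⟩
  have hζ0 : 0 ≤ ζ := by rw [hζ]; positivity
  have hζb : ζ + 8 * β ≤ l := by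
    have h1 : ζ ≤ 40 * K ^ 2 * b := by rw [hζ]; gcongr
    have h2 : 8 * β ≤ 8 * K ^ 2 * b := by
      calc 8 * β ≤ 8 * b := by linarith
        _ = 8 * 1 * b := by ring
        _ ≤ 8 * K ^ 2 * b := by gcongr
    linarith
  have hβδ : β ≤ δ := hβb.trans hb1
  -- the crossing point next to `s i`
  have hsij := (hs.norm_sub_le i j).1
  obtain ⟨p, hp, hip⟩ := h.exists_mem_inter_norm_le hi hj
  have hip2 : ‖s i - p‖ ≤ 2 * K := by
    have h1 : K * ‖s i - s j‖ ≤ K * 2 := by gcongr; linarith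
    linarith
  set P₁ := (T k p).starProjection with hP₁
  set P₂ := (T (!k) p).starProjection with hP₂
  set a := P₁ (s i - p) with ha
  have haT : a ∈ T k p := (T k p).starProjection_apply_mem _
  have hpk := Crossing.mem_of_mem_inter hp k
  have hpk' := Crossing.mem_of_mem_inter hp (!k)
  have ha2 : ‖a‖ ≤ 2 * K := ((T k p).norm_starProjection_apply_le _).trans hip2
  have hia : ‖s i - p - a‖ ≤ ζ := by
    refine (h.near k p hpk (s i) hi).trans ?_
    calc κ * ‖s i - p‖ ^ 2 ≤ κ * (2 * K) ^ 2 := by gcongr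
      _ ≤ ζ := by rw [hζ]; linarith [mul_nonneg (sq_nonneg K) hκ]
  obtain ⟨v, hv, hPv, hKv⟩ := h.exists_normal k hp
  have hvsq : (K⁻¹) ^ 2 ≤ ‖P₂ v‖ ^ 2 := by
    have : K⁻¹ ≤ ‖P₂ v‖ := by
      rw [inv_le_iff_one_le_mul₀ (by linarith)]; linarith
    gcongr
  -- a pair of points as in the gap lemma has covariances at distance at least `g / 2`
  have hgap : ∀ {i' j' : Fin n} {a' : E}, a' ∈ T k p → ‖a'‖ ≤ 2 * K + 2 → ‖s i' - p - a'‖ ≤ δ →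
      ‖s j' - p - P₂ a'‖ ≤ δ → t ≤ ‖a' - P₂ a'‖ →
      g / 2 ≤ ‖localCov x 1 i' - localCov x 1 j'‖ := by
    intro i' j' a' ha' ha'2 hi' hj' hta'
    have h1 := hs.gap hc hmod hβ0 hβδ (by linarith) hp ha' (by linarith) hi' hj' hv hPv ht0.le
      (by linarith) hta'
    refine le_trans ?_ h1
    have h2 : g ≤ c * ‖P₂ v‖ ^ 2 * t ^ 2 / 2 := by rw [hg]; gcongr
    linarith
  have hnear : ∀ (k' : Bool) {w : E}, w ∈ T k' p → ‖w‖ ≤ 3 * K →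
      ∃ j', s j' ∈ S k' ∧ ‖s j' - p - w‖ ≤ l + ζ := by
    intro k' w hw hw3
    obtain ⟨j', hj', hj'w⟩ := hs.exists_near h k' hp hw hw3 (by
      have : κ * (3 * K) ≤ ζ := by
        rw [hζ]
        calc κ * (3 * K) ≤ κ * (3 * K ^ 2) := by gcongr
          _ ≤ 40 * K ^ 2 * κ := by linarith [mul_nonneg (sq_nonneg K) hκ]
      linarith)
    refine ⟨j', hj', hj'w.trans ?_⟩
    rw [hζ]
    linarith [mul_nonneg (sq_nonneg K) hκ]
  rcases le_or_gt t ‖a - P₂ a‖ with hta | hta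
  · -- it suffices to find a neighbour close to the projection
    suffices hex : ∃ j', ‖x i - x j'‖ ≤ 1 ∧ ‖s j' - p - P₂ a‖ ≤ δ by
      obtain ⟨j', hij', hj'⟩ := hex
      refine ⟨j', hij', lt_of_lt_of_le ?_ (hgap haT (by linarith) (hia.trans (by linarith)) hj' hta)⟩
      linarith
    have hPa : ‖P₂ a‖ ≤ ‖a‖ := (T (!k) p).norm_starProjection_apply_le a
    rcases le_or_gt ‖a - P₂ a‖ (1 - δ ^ 2 / 16) with hta1 | hta1
    · obtain ⟨j', -, hj'⟩ := hnear (!k) ((T (!k) p).starProjection_apply_mem a) (by linarith)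
      refine ⟨j', ?_, hj'.trans (by linarith)⟩
      have h1 := (hs.norm_sub_le i j').2
      have h2 : s i - s j' = (s i - p - a) + (a - P₂ a) + -(s j' - p - P₂ a) := by abel
      have h3 := norm_add₃_le (a := s i - p - a) (b := a - P₂ a) (c := -(s j' - p - P₂ a))
      rw [← h2, norm_neg] at h3
      linarith
    · -- the other surface barely meets the ball, close to the projection
      refine ⟨j, hij, ?_⟩
      set z := s j - p with hz
      have hz4 : ‖z‖ ≤ 4 * K := by
        have h2 : z = (s i - p) - (s i - s j) := by rw [hz]; abel
        have h3 := norm_sub_le (s i - p) (s i - s j)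
        rw [← h2] at h3
        linarith
      have hzP : ‖z - P₂ z‖ ≤ 16 / 40 * ζ := by
        refine (h.near (!k) p hpk' (s j) hj).trans ?_
        calc κ * ‖s j - p‖ ^ 2 ≤ κ * (4 * K) ^ 2 := by gcongr
          _ = 16 / 40 * ζ := by rw [hζ]; ring
      have hia' : ‖s i - p - a‖ ≤ 4 / 40 * ζ := by
        refine (h.near k p hpk (s i) hi).trans ?_
        calc κ * ‖s i - p‖ ^ 2 ≤ κ * (2 * K) ^ 2 := by gcongr
          _ = 4 / 40 * ζ := by rw [hζ]; ring
      have haz : ‖a - P₂ z‖ ≤ 1 + (ζ + 8 * β) := by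
        have h2 : a - P₂ z = -(s i - p - a) + (s i - s j) + (z - P₂ z) := by rw [hz]; abel
        have h3 := norm_add₃_le (a := -(s i - p - a)) (b := s i - s j) (c := z - P₂ z)
        rw [← h2, norm_neg] at h3
        linarith
      have hpyth := norm_sq_eq_norm_sq_starProjection_add (T (!k) p) (a - P₂ z)
      have hproj : P₂ (a - P₂ z) = P₂ a - P₂ z := by
        rw [map_sub P₂ a (P₂ z), hP₂,
          starProjection_of_mem ((T (!k) p).starProjection_apply_mem z)]
      rw [← hP₂, hproj, sub_sub_sub_cancel_right] at hpyth
      have h4 : ‖a - P₂ z‖ ^ 2 ≤ (1 + l) ^ 2 :=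
        pow_le_pow_left₀ (norm_nonneg _) (haz.trans (by linarith)) 2
      have h5 : (1 - δ ^ 2 / 16) ^ 2 ≤ ‖a - P₂ a‖ ^ 2 :=
        pow_le_pow_left₀ (by linarith) hta1.le 2
      have h6 : ‖P₂ a - P₂ z‖ ^ 2 ≤ (δ / 2) ^ 2 := by
        have h7 : l ^ 2 ≤ l := by rw [sq]; exact mul_le_of_le_one_left hl0.le (by linarith)
        have h8 := sq_nonneg (δ ^ 2 / 16)
        have h9 : l = δ ^ 2 / 48 := hl
        linarith
      have h7 : ‖P₂ a - P₂ z‖ ≤ δ / 2 := le_of_sq_le_sq h6 (by linarith)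
      have h8 : z - P₂ a = (z - P₂ z) - (P₂ a - P₂ z) := by abel
      rw [h8]
      exact (norm_sub_le _ _).trans (by linarith)
  · obtain ⟨e, heT, he, hKe⟩ := h.angle k p hp
    set a' := a + (1 / 4 : ℝ) • e with ha'
    have haa' : ‖a' - a‖ = 1 / 4 := by
      rw [ha', add_sub_cancel_left, norm_smul, he]; norm_num
    have ha'T : a' ∈ T k p := (T k p).add_mem haT ((T k p).smul_mem _ heT)
    have ha'2 : ‖a'‖ ≤ 2 * K + 1 / 4 := by
      have := norm_add_le (a' - a) a
      rw [sub_add_cancel] at this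
      linarith
    have hdec : a' - P₂ a' = (1 / 4 : ℝ) • (e - P₂ e) + (a - P₂ a) := by
      rw [ha', map_add, map_smul, smul_sub]; abel
    have hquart : ‖(1 / 4 : ℝ) • (e - P₂ e)‖ = 1 / 4 * ‖e - P₂ e‖ := by
      rw [norm_smul, Real.norm_of_nonneg (by norm_num)]
    have hlow : t ≤ ‖a' - P₂ a'‖ := by
      have h1 := norm_sub_norm_le ((1 / 4 : ℝ) • (e - P₂ e)) (-(a - P₂ a))
      rw [sub_neg_eq_add, ← hdec, norm_neg, hquart] at h1
      have h2 : 8 * t ≤ ‖e - P₂ e‖ := by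
        have h3 : 8 * t * K ≤ ‖e - P₂ e‖ * K := by linarith
        exact le_of_mul_le_mul_right h3 (by linarith)
      linarith
    have hup : ‖a' - P₂ a'‖ ≤ 1 / 2 := by
      have h1 := norm_add_le ((1 / 4 : ℝ) • (e - P₂ e)) (a - P₂ a)
      rw [← hdec, hquart] at h1
      have h2 := norm_sub_starProjection_le_norm (T (!k) p) e
      rw [he] at h2
      linarith
    have hPa' : ‖P₂ a'‖ ≤ ‖a'‖ := (T (!k) p).norm_starProjection_apply_le a'
    obtain ⟨i', -, hi'⟩ := hnear k ha'T (by linarith)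
    obtain ⟨j', -, hj'⟩ := hnear (!k) ((T (!k) p).starProjection_apply_mem a') (by linarith)
    have hii' : ‖x i - x i'‖ ≤ 1 := by
      have h1 := (hs.norm_sub_le i i').2
      have h2 : s i - s i' = (s i - p - a) + -(a' - a) + -(s i' - p - a') := by abel
      have h3 := norm_add₃_le (a := s i - p - a) (b := -(a' - a)) (c := -(s i' - p - a'))
      rw [← h2, norm_neg, norm_neg] at h3
      linarith
    have hij' : ‖x i - x j'‖ ≤ 1 := by
      have h1 := (hs.norm_sub_le i j').2
      have h2 : s i - s j' = ((s i - p - a) + -(a' - a) + (a' - P₂ a')) -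
        (s j' - p - P₂ a') := by abel
      have h3 := norm_add₃_le (a := s i - p - a) (b := -(a' - a)) (c := a' - P₂ a')
      have h4 := norm_sub_le ((s i - p - a) + -(a' - a) + (a' - P₂ a')) (s j' - p - P₂ a')
      rw [← h2] at h4
      rw [norm_neg] at h3
      linarith
    have hg2 := hgap ha'T (by linarith) (hi'.trans (by linarith)) (hj'.trans (by linarith)) hlow
    by_contra! hcon
    have h1 := hcon i' hii'
    have h2 := hcon j' hij'
    have h3 := norm_sub_le_norm_sub_add_norm_sub (localCov x 1 i') (localCov x 1 i)
      (localCov x 1 j')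
    rw [norm_sub_rev (localCov x 1 i') (localCov x 1 i)] at h3
    linarith

end MixedPoints

/-! ### The leading eigenspaces of the local covariances -/

section LeadingEigenspaces

variable {E : Type*} [NormedAddCommGroup E] [InnerProductSpace ℝ E] [FiniteDimensional ℝ E]

/-- If the quadratic form of `A` dominates a multiple of that of the projection to `T`, up to an
error, then `T` is close to the span of the eigenvectors with eigenvalue above the threshold. -/
theorem norm_sub_starProjection_spectralSubspace_le {A : E →L[ℝ] E}
    (hA : (A : E →ₗ[ℝ] E).IsSymmetric) {T : Submodule ℝ E} {a b t ω : ℝ} (ha : 0 < a)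
    (hω : 0 ≤ ω) (hle : ∀ u : E, ‖u‖ = 1 → a * ‖T.starProjection u‖ ^ 2 - b ≤ ⟪A u, u⟫)
    (hab : t + b ≤ a * ω ^ 2) {v : E} (hv : v ∈ T) :
    ‖v - (spectralSubspace A t).starProjection v‖ ≤ ω * ‖v‖ := by
  set V := spectralSubspace A t with hV
  obtain ⟨y, hy⟩ : ∃ y, y = v - V.starProjection v := ⟨_, rfl⟩
  rw [← hy]
  rcases eq_or_ne y 0 with h0 | h0
  · rw [h0, norm_zero]; positivity
  have hy0 : 0 < ‖y‖ := norm_pos_iff.2 h0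
  have hVy : V.starProjection y = 0 := by
    rw [hy, map_sub, starProjection_of_mem (V.starProjection_apply_mem v), sub_self]
  obtain ⟨u, hu⟩ : ∃ u, u = ‖y‖⁻¹ • y := ⟨_, rfl⟩
  have hu1 : ‖u‖ = 1 := by
    rw [hu, norm_smul, norm_inv, norm_norm, inv_mul_cancel₀ hy0.ne']
  have hVu : V.starProjection u = 0 := by rw [hu, map_smul, hVy, smul_zero]
  have h1 := inner_self_le_of_starProjection_spectralSubspace_eq_zero hA hVu
  rw [hu1, one_pow, mul_one] at h1
  have h2 := hle u hu1
  have h3 : ‖T.starProjection u‖ ≤ ω := by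
    refine le_of_sq_le_sq ?_ hω
    refine le_of_mul_le_mul_left (a := a) ?_ ha
    linarith
  have h4 : ⟪y, v⟫ = ‖y‖ ^ 2 := by
    have h5 : ⟪V.starProjection v, y⟫ = 0 := by
      rw [real_inner_comm, hy, Submodule.starProjection_inner_eq_zero _ _
        (V.starProjection_apply_mem v)]
    have h6 : v = y + V.starProjection v := by rw [hy]; abel
    conv_lhs => rw [h6]
    rw [inner_add_right, real_inner_self_eq_norm_sq, real_inner_comm, h5, add_zero]
  have h5 : ⟪u, v⟫ = ‖y‖ := by
    rw [hu, real_inner_smul_left, h4, sq, inv_mul_cancel_left₀ hy0.ne']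
  rw [← h5, ← inner_starProjection_of_mem u hv]
  exact (real_inner_le_norm _ _).trans (by gcongr)

theorem finrank_le_of_norm_sub_starProjection_le {U V : Submodule ℝ E} {ω : ℝ} (hω : ω < 1)
    (h : ∀ v ∈ U, ‖v - V.starProjection v‖ ≤ ω * ‖v‖) : finrank ℝ U ≤ finrank ℝ V := by
  by_contra! hlt
  obtain ⟨x, hxU, hx1, hxV⟩ := exists_unit_mem_starProjection_eq_zero hlt
  have := h x hxU
  rw [hxV, sub_zero, hx1] at this
  linarith

/-- If `A` is close to a multiple of the projection to `T`, then there are at most `dim T`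
eigenvalues above the threshold. -/
theorem finrank_spectralSubspace_le {A : E →L[ℝ] E} (hA : (A : E →ₗ[ℝ] E).IsSymmetric)
    {T : Submodule ℝ E} {c δ t : ℝ} (hAT : ‖A - c • T.starProjection‖ ≤ δ) (hδ : δ < t) :
    finrank ℝ (spectralSubspace A t) ≤ finrank ℝ T := by
  by_contra! hlt
  obtain ⟨u, huV, hu1, huT⟩ := exists_unit_mem_starProjection_eq_zero hlt
  have h1 := le_inner_self_of_mem_spectralSubspace hA huV
  rw [hu1, one_pow, mul_one] at h1
  have h2 : A u = (A - c • T.starProjection) u := by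
    rw [sub_apply, smul_apply, huT, smul_zero, sub_zero]
  rw [h2] at h1
  have h3 := real_inner_le_norm ((A - c • T.starProjection) u) u
  have h4 := (A - c • T.starProjection).le_opNorm u
  rw [hu1, mul_one] at h3 h4
  linarith

/-- A unit vector of `T` is stretched by at least `c - δ`. -/
theorem le_norm_of_norm_sub_smul_starProjection_le {A : E →L[ℝ] E} {T : Submodule ℝ E} {c δ : ℝ}
    (hc : 0 ≤ c) (hT : 1 ≤ finrank ℝ T) (hAT : ‖A - c • T.starProjection‖ ≤ δ) : c - δ ≤ ‖A‖ := by
  obtain ⟨u, huT, hu1, -⟩ := exists_unit_mem_starProjection_eq_zero (U := T) (V := ⊥)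
    (by rw [finrank_bot]; omega)
  have h1 : c • u = A u - (A - c • T.starProjection) u := by
    rw [sub_apply, smul_apply, starProjection_of_mem huT]; abel
  have h2 := norm_sub_le (A u) ((A - c • T.starProjection) u)
  rw [← h1, norm_smul, Real.norm_of_nonneg hc] at h2
  have h3 := A.le_opNorm u
  have h4 := (A - c • T.starProjection).le_opNorm u
  rw [hu1, mul_one] at h2 h3 h4
  linarith

/-- Two subspaces of the dimension of `T` cannot be close to each other if one is close to `T`
and the other contains nearly a unit vector `e` transversal to `T`: the first would contain
nearly `T` and `e`. -/
theorem norm_sub_starProjection_le_of_finrank_eq {T V : Submodule ℝ E}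
    (hTV : finrank ℝ T = finrank ℝ V) {ω : ℝ} (hω : ω ≤ 1 / 2)
    (hT : ∀ v ∈ T, ‖v - V.starProjection v‖ ≤ ω * ‖v‖) {e : E} (he : ‖e‖ = 1)
    (heV : ‖e - V.starProjection e‖ ≤ ω) : ‖e - T.starProjection e‖ ≤ 4 * ω := by
  have hω0 : 0 ≤ ω := (norm_nonneg _).trans heV
  let f : T →ₗ[ℝ] V := (V.orthogonalProjectionOnto : E →ₗ[ℝ] V) ∘ₗ T.subtype
  have hf : ∀ v : T, ((f v : V) : E) = V.starProjection (v : E) := fun v => rfl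
  have hinj : Function.Injective f := by
    refine (injective_iff_map_eq_zero f).2 fun v hv => ?_
    have h1 := hT v v.2
    rw [← hf v, hv, Submodule.coe_zero, sub_zero] at h1
    have h2 := norm_nonneg (v : E)
    have h3 : ω * ‖(v : E)‖ ≤ 1 / 2 * ‖(v : E)‖ := by gcongr
    have h4 : ‖(v : E)‖ = 0 := by linarith
    exact Subtype.ext (norm_eq_zero.1 h4)
  obtain ⟨v, hv⟩ := (LinearMap.injective_iff_surjective_of_finrank_eq_finrank hTV).1 hinj
    (V.orthogonalProjectionOnto e)
  have hv' : V.starProjection (v : E) = V.starProjection e := by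
    rw [← hf v, hv]; rfl
  have h1 := hT v v.2
  rw [hv'] at h1
  have h2 : e - (v : E) = (e - V.starProjection e) - ((v : E) - V.starProjection e) := by abel
  have h3 := norm_sub_le (e - V.starProjection e) ((v : E) - V.starProjection e)
  rw [← h2] at h3
  have h4 := norm_sub_norm_le (v : E) e
  rw [he, norm_sub_rev] at h4
  have h5 : ω * ‖(v : E)‖ ≤ ω * (1 + ‖e - (v : E)‖) := by gcongr; linarith
  have h6 : ω * ‖e - (v : E)‖ ≤ 1 / 2 * ‖e - (v : E)‖ := by gcongr
  exact (norm_sub_starProjection_le T e v.2).trans (by linarith)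

end LeadingEigenspaces

/-! ### Well-resolved samples -/

section ResolvedSamples

open Set Filter Metric Topology

variable {E : Type*} [NormedAddCommGroup E] [InnerProductSpace ℝ E] [FiniteDimensional ℝ E]

/-- All neighbours of the data point `x i`, at the scale `1`, come from points of `A`. -/
def Unmixed {n : ℕ} (A : Set E) (s x : Fin n → E) (i : Fin n) : Prop :=
  ∀ j ∈ neighbors x 1 i, s j ∈ A

theorem Unmixed.mem {n : ℕ} {A : Set E} {s x : Fin n → E} {i : Fin n} (hi : Unmixed A s x i) :
    s i ∈ A :=
  hi i (mem_neighbors.2 (by rw [sub_self, norm_zero]; exact zero_le_one))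

/-- What the analysis of the clusters uses about the data points `x` coming from `s`, at the scale
`r = 1`: the sample is dense; the local covariance at an unmixed point is a multiple of the
projection to the tangent space; a mixed point has a neighbour with a different local covariance;
the leading eigenspace always contains nearly the tangent space, and has the same dimension at
unmixed points. The scales are separated: `ε` is large, and `η` and `κ * ε` are small. -/
structure ResolvedSample (d : ℕ) (c : ℝ) (S : Bool → Set E) (T : Bool → E → Submodule ℝ E)
    (κ K ε η δ ω : ℝ) {n : ℕ} (s x : Fin n → E) : Prop where
  crossing : Crossing d S T κ K
  mem : ∀ i, ∃ k, s i ∈ S k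
  notMem_inter : ∀ i, s i ∉ S true ∩ S false
  noise : ∀ i, ‖x i - s i‖ ≤ 1 / 8
  cover : ∀ k, ∀ y ∈ S k, ∃ j, s j ∈ S k ∧ ‖s j - y‖ ≤ 1 / 8
  cov_close : ∀ k i, Unmixed (S k) s x i →
    ‖localCov x 1 i - c • (T k (s i)).starProjection‖ ≤ δ
  cov_mixed : ∀ k i j, s i ∈ S k → s j ∈ S (!k) → ‖x i - x j‖ ≤ 1 →
    ∃ j', ‖x i - x j'‖ ≤ 1 ∧ η < ‖localCov x 1 i - localCov x 1 j'‖
  proj_close : ∀ k i, s i ∈ S k → ∀ v ∈ T k (s i), ‖v - localProj x 1 η i v‖ ≤ ω * ‖v‖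
  finrank_eq : ∀ k i, Unmixed (S k) s x i →
    finrank ℝ (spectralSubspace (localCov x 1 i) (√η * ‖localCov x 1 i‖)) = d
  pos : 0 < c
  nonneg : 0 ≤ ω
  le_one : c ≤ 1
  le_scale : 64 * K ≤ ε
  curvature_le : 256 * K ^ 2 * κ ≤ 1
  eta_lt : η < 1
  same_lt : 2 * δ + 2 * κ * ε ≤ η
  cross_lt : η + 2 * δ + 6 * K * κ * ε < c / K
  proj_lt : ω + 4 * K * κ * ε + η ≤ 1 / (16 * K)

/-- Regular samples are well-resolved once the curvature, the error in the moments and the parameter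
`η` are small enough, and `ε` is large enough. -/
theorem exists_resolvedSample (E : Type*) [NormedAddCommGroup E] [InnerProductSpace ℝ E]
    [FiniteDimensional ℝ E] {d : ℕ} (hd : 1 ≤ d) {c K : ℝ} (hc : 0 < c) (hc1 : c ≤ 1)
    (hK : 1 ≤ K) :
    ∃ M l b : ℝ, 1 ≤ M ∧ 0 < l ∧ l ≤ 1 ∧ 0 < b ∧ ∀ {n : ℕ} {κ ε η : ℝ} {S : Bool → Set E}
      {T : Bool → E → Submodule ℝ E} {s x : Fin n → E}, Crossing d S T κ K →
      RegularSample d c S T M (b * η) l 1 s x → 0 < η → η ≤ b → κ * ε ≤ b * η → 64 * K ≤ ε →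
      ∃ δ ω, ResolvedSample d c S T κ K ε η δ ω s x := by
  obtain ⟨M, l, b₀, hM, hl, hl8, hb₀, hmix⟩ := exists_mixed_bound E d hc hK
  obtain ⟨A, hA⟩ : ∃ A : ℝ, A = 8 * 2 ^ (d + 2) := ⟨_, rfl⟩
  have hA8 : 8 ≤ A := by
    rw [hA]; have : (1 : ℝ) ≤ 2 ^ (d + 2) := one_le_pow₀ (by norm_num)
    linarith
  obtain ⟨ω, hω⟩ : ∃ ω : ℝ, ω = 1 / (64 * K) := ⟨_, rfl⟩
  have hω0 : 0 < ω := by rw [hω]; positivity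
  have hωK : ω * K = 1 / 64 := by rw [hω]; field_simp
  have hω64 : ω ≤ 1 / 64 := by rw [← hωK]; exact le_mul_of_one_le_right hω0.le hK
  -- `√η` is at most `q`, which controls the threshold for the eigenvalues
  obtain ⟨q, hq⟩ : ∃ q : ℝ, q = c * ω ^ 2 / 32 := ⟨_, rfl⟩
  have hq0 : 0 < q := by rw [hq]; positivity
  have hq1 : q ≤ 1 := by
    have : ω ^ 2 ≤ 1 := pow_le_one₀ hω0.le (by linarith)
    rw [hq]
    have := mul_le_one₀ hc1 (sq_nonneg ω) this
    linarith
  obtain ⟨b, hb⟩ : ∃ b : ℝ, b = min (min b₀ (q ^ 2)) (c * ω ^ 2 / (4 * A)) := ⟨_, rfl⟩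
  have hb0 : 0 < b := by rw [hb]; positivity
  have hbb₀ : b ≤ b₀ := by rw [hb]; exact (min_le_left _ _).trans (min_le_left _ _)
  have hbq : b ≤ q ^ 2 := by rw [hb]; exact (min_le_left _ _).trans (min_le_right _ _)
  have hbA : A * b ≤ c * ω ^ 2 / 4 := by
    have : b ≤ c * ω ^ 2 / (4 * A) := by rw [hb]; exact min_le_right _ _
    rw [le_div_iff₀ (by linarith)] at this
    linarith
  have hω2 : ω ^ 2 ≤ ω / 64 := by
    calc ω ^ 2 = ω * ω := sq ω
      _ ≤ ω * (1 / 64) := by gcongr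
      _ = ω / 64 := by ring
  have hcω : c * ω ^ 2 ≤ ω ^ 2 := mul_le_of_le_one_left (sq_nonneg _) hc1
  have hcω' : c * ω ^ 2 ≤ c * (ω / 64) := by gcongr
  have hcω'' : c * ω ≤ c * (1 / 64) := by gcongr
  have hAb : 8 * b ≤ A * b := by gcongr
  have hbω : b ≤ ω ^ 2 / 32 := by linarith
  have hb1 : b ≤ 1 := by linarith
  refine ⟨M, l, b, by linarith, hl, by linarith, hb0, ?_⟩
  intro n κ ε η S T s x h hs hη hηb hκε hε
  have hκ := h.nonneg
  have hε64 : 64 ≤ ε := by linarith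
  have hη1 : η ≤ 1 := hηb.trans hb1
  obtain ⟨β, hβ⟩ : ∃ β, β = b * η := ⟨_, rfl⟩
  rw [← hβ] at hs hκε
  have hβ0 : 0 ≤ β := by rw [hβ]; positivity
  have hβb : β ≤ b := by rw [hβ]; exact mul_le_of_le_one_right hb0.le hη1
  have hκβ : 64 * κ ≤ β := by
    have : κ * 64 ≤ κ * ε := by gcongr
    linarith
  have hAβ : A * β ≤ c * ω ^ 2 / 4 * η := by
    calc A * β = A * b * η := by rw [hβ]; ring
      _ ≤ _ := by gcongr
  have hη' : c * ω ^ 2 / 4 * η ≤ 1 / 4 * η := by gcongr; linarith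
  have hAβ8 : 8 * β ≤ A * β := by gcongr
  have hsmall : 2 ^ (d + 2) * β ≤ 1 / 8 := by
    have : A * β ≤ 1 := by linarith
    rw [hA] at this; linarith
  have hcl : ∀ k i, Unmixed (S k) s x i →
      ‖localCov x 1 i - c • (T k (s i)).starProjection‖ ≤ A * β := fun k i hi => by
    rw [hA]
    exact hs.norm_localCov_sub_le hc hc1 hM hβ0 hsmall hi.mem hi
  have hsq : √η ≤ q := by
    rw [Real.sqrt_le_left hq0.le]; exact hηb.trans hbq
  have hηsq : η ≤ √η := by
    rw [Real.le_sqrt hη.le hη.le, sq]; exact mul_le_of_le_one_left hη.le hη1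
  have hpc : ∀ k i, s i ∈ S k → ∀ v ∈ T k (s i), ‖v - localProj x 1 η i v‖ ≤ ω * ‖v‖ := by
    intro k i hi v hv
    refine norm_sub_starProjection_spectralSubspace_le (isSymmetric_localCov x 1 i)
      (a := c / 4) (b := 2 ^ (d + 2) * β) (by positivity) hω0.le
      (fun u hu => hs.le_inner_localCov hc hc1 hM hβ0 hsmall hi hu) ?_ hv
    have h1 : √η * ‖localCov x 1 i‖ ≤ q * 4 := by
      gcongr; exact norm_localCov_le x i
    have h2 : 8 * (2 ^ (d + 2) * β) = A * β := by rw [hA]; ring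
    have h3 : c * ω ^ 2 / 4 * η ≤ c * ω ^ 2 / 4 * 1 := by gcongr
    rw [hq] at h1
    linarith
  refine ⟨A * β, ω, h, hs.mem, hs.notMem_inter, fun i => ?_, fun k y hy => ?_, hcl, ?_, hpc, ?_,
    hc, hω0.le, hc1, hε, ?_, by linarith, by linarith, ?_, ?_⟩
  · have := hs.noise i
    linarith
  · obtain ⟨j, hj, hjy⟩ := hs.cover k y hy
    exact ⟨j, hj, by linarith⟩
  · intro k i j hi hj hij
    obtain ⟨j', h1, h2⟩ := hmix h hs (by linarith) hβ0 (by linarith) hi hj hij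
    exact ⟨j', h1, by linarith⟩
  · intro k i hi
    have hik : s i ∈ S k := hi.mem
    have hrank := h.finrank_eq k (s i) hik
    have hcl' := hcl k i hi
    refine le_antisymm ?_ ?_
    · rw [← hrank]
      refine finrank_spectralSubspace_le (isSymmetric_localCov x 1 i) hcl' ?_
      have h1 := le_norm_of_norm_sub_smul_starProjection_le hc.le (by omega) hcl'
      have h2 : c * ω ^ 2 / 4 * η ≤ c * ω ^ 2 / 4 * 1 := by gcongr
      have h3 : η * (c / 2) ≤ √η * ‖localCov x 1 i‖ := by
        gcongr; linarith
      have h4 : c * ω ^ 2 / 4 * η < c / 2 * η :=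
        mul_lt_mul_of_pos_right (by linarith) hη
      linarith
    · rw [← hrank]
      exact finrank_le_of_norm_sub_starProjection_le (by linarith) (hpc k i hik)
  · have h1 : 64 * K * (64 * K) * κ ≤ 64 * K * (64 * K) * (ω ^ 2 / 32) := by
      gcongr; linarith
    have h2 : 64 * K * (64 * K) * (ω ^ 2 / 32) = 64 * 64 * (ω * K) ^ 2 / 32 := by ring
    rw [h2, hωK] at h1
    linarith [mul_nonneg (sq_nonneg K) hκ]
  · have h1 : 6 * K * κ * ε = 6 * K * (κ * ε) := by ring
    have h2 : 6 * K * (κ * ε) ≤ 6 * K * b := by gcongr; linarith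
    have h3 : c / K = 64 * (c * ω) := by rw [hω]; field_simp
    have h4 : 6 * K * b ≤ 6 * K * (c * ω ^ 2 / 32) := by gcongr; linarith
    have h5 : 6 * K * (c * ω ^ 2 / 32) = 6 * c * ω * (ω * K) / 32 := by ring
    rw [hωK] at h5
    have h6 : 0 < c * ω := by positivity
    have h7 : c * ω ^ 2 ≤ c * ω := by
      calc c * ω ^ 2 = c * ω * ω := by ring
        _ ≤ c * ω * 1 := by gcongr; linarith
        _ = c * ω := mul_one _
    rw [h3, h1]
    linarith
  · have h1 : 4 * K * κ * ε = 4 * K * (κ * ε) := by ring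
    have h2 : 4 * K * (κ * ε) ≤ 4 * K * b := by gcongr; linarith
    have h3 : 1 / (16 * K) = 4 * ω := by rw [hω]; field_simp; norm_num
    have h4 : 4 * K * b ≤ 4 * K * (ω ^ 2 / 32) := by gcongr
    have h5 : 4 * K * (ω ^ 2 / 32) = ω * (ω * K) / 8 := by ring
    rw [hωK] at h5
    rw [h3, h1]
    linarith

end ResolvedSamples

/-! ### The groups found in a well-resolved sample -/

section Groups

open Set Filter Metric Topology

set_option linter.unusedSectionVars false

variable {E : Type*} [NormedAddCommGroup E] [InnerProductSpace ℝ E] [FiniteDimensional ℝ E]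

/-- Points which are `ρ`-dense in a preconnected set are connected in a graph joining all points
within distance `3 * ρ`. -/
theorem reachable_of_isPreconnected {V : Type*} {G : SimpleGraph V} {S : Set E}
    (hS : IsPreconnected S) {U : Set V} {f : V → E} {ρ : ℝ} (hρ : 0 < ρ) (hf : ∀ v ∈ U, f v ∈ S)
    (hcover : ∀ y ∈ S, ∃ v ∈ U, ‖f v - y‖ ≤ ρ)
    (hG : ∀ v ∈ U, ∀ w ∈ U, ‖f v - f w‖ ≤ 3 * ρ → G.Reachable v w) {v w : V} (hv : v ∈ U)
    (hw : w ∈ U) : G.Reachable v w := by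
  by_contra hvw
  let A : Set E := ⋃ a ∈ {a | a ∈ U ∧ G.Reachable v a}, ball (f a) (3 / 2 * ρ)
  let B : Set E := ⋃ a ∈ {a | a ∈ U ∧ ¬ G.Reachable v a}, ball (f a) (3 / 2 * ρ)
  obtain ⟨y, -, hyA, hyB⟩ := hS A B (isOpen_biUnion fun _ _ => isOpen_ball)
    (isOpen_biUnion fun _ _ => isOpen_ball) (fun y hy => by
      obtain ⟨a, ha, hay⟩ := hcover y hy
      have hya : y ∈ ball (f a) (3 / 2 * ρ) := by
        rw [mem_ball, dist_eq_norm, norm_sub_rev]; linarith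
      by_cases hva : G.Reachable v a
      · exact Or.inl (mem_biUnion (x := a) ⟨ha, hva⟩ hya)
      · exact Or.inr (mem_biUnion (x := a) ⟨ha, hva⟩ hya))
    ⟨f v, hf v hv, mem_biUnion (x := v) ⟨hv, .refl v⟩ (mem_ball_self (by positivity))⟩
    ⟨f w, hf w hw, mem_biUnion (x := w) ⟨hw, hvw⟩ (mem_ball_self (by positivity))⟩
  obtain ⟨a, ⟨ha, hva⟩, hya⟩ := mem_iUnion₂.1 hyA
  obtain ⟨b, ⟨hb, hvb⟩, hyb⟩ := mem_iUnion₂.1 hyB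
  rw [mem_ball, dist_eq_norm] at hya hyb
  refine hvb (hva.trans (hG a ha b hb ?_))
  have := norm_sub_le_norm_sub_add_norm_sub (f a) y (f b)
  rw [norm_sub_rev (f a) y] at this
  linarith

namespace ResolvedSample

variable {d n : ℕ} {c κ K ε η δ ω : ℝ} {S : Bool → Set E} {T : Bool → E → Submodule ℝ E}
  {s x : Fin n → E}

section

variable (h : ResolvedSample d c S T κ K ε η δ ω s x)
include h

theorem norm_sub_le (i j : Fin n) :
    ‖s i - s j‖ ≤ ‖x i - x j‖ + 1 / 4 ∧ ‖x i - x j‖ ≤ ‖s i - s j‖ + 1 / 4 := by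
  have := norm_sub_le_of_noise (h.noise i) (h.noise j)
  constructor <;> linarith

theorem mem_or (k : Bool) (i : Fin n) : s i ∈ S k ∨ s i ∈ S (!k) := by
  obtain ⟨k', hk'⟩ := h.mem i
  rcases Bool.eq_or_eq_not k' k with rfl | rfl
  · exact Or.inl hk'
  · exact Or.inr hk'

theorem notMem_of_mem {k : Bool} {i : Fin n} (hi : s i ∈ S k) : s i ∉ S (!k) := fun hi' =>
  h.notMem_inter i (by cases k; exacts [⟨hi', hi⟩, ⟨hi, hi'⟩])

theorem one_le_scale : 64 ≤ ε := by
  have := h.le_scale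
  have := h.crossing.one_le
  linarith

/-- Points at distance `3` from the other surface are unmixed, and so are their neighbours. -/
theorem unmixed_of_infDist {k : Bool} {i : Fin n} (hi : 3 ≤ infDist (s i) (S (!k)))
    {j : Fin n} (hij : ‖x i - x j‖ ≤ 1) : Unmixed (S k) s x j := by
  intro j' hj'
  rw [mem_neighbors] at hj'
  refine (h.mem_or k j').resolve_right fun hmem => ?_
  have h1 := infDist_le_dist_of_mem (x := s i) hmem
  rw [dist_eq_norm] at h1
  have h2 := (h.norm_sub_le i j').1
  have h3 := norm_sub_le_norm_sub_add_norm_sub (x i) (x j) (x j')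
  linarith

/-- Mixed points have been removed. -/
theorem unmixed_of_mem_survivors {k : Bool} {i : Fin n} (hi : i ∈ survivors x 1 η)
    (hik : s i ∈ S k) : Unmixed (S k) s x i := by
  intro j hj
  rw [mem_neighbors] at hj
  refine (h.mem_or k j).resolve_right fun hmem => ?_
  obtain ⟨j', hj', hcov⟩ := h.cov_mixed k i j hik hmem hj
  refine hi ⟨j', by rwa [norm_sub_rev], ?_⟩
  rwa [one_pow, mul_one, norm_sub_rev]

/-- Unmixed points of one surface within distance `ε` have nearly equal covariances. -/
theorem norm_localCov_sub_le {k : Bool} {i j : Fin n} (hi : Unmixed (S k) s x i)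
    (hj : Unmixed (S k) s x j) (hij : ‖x i - x j‖ ≤ ε) :
    ‖localCov x 1 i - localCov x 1 j‖ ≤ η := by
  have h1 := h.cov_close k i hi
  have h2 := h.cov_close k j hj
  have h3 : localCov x 1 i - localCov x 1 j = (localCov x 1 i - c • (T k (s i)).starProjection) +
      c • ((T k (s i)).starProjection - (T k (s j)).starProjection) +
      -(localCov x 1 j - c • (T k (s j)).starProjection) := by rw [smul_sub]; abel
  rw [h3]
  refine (norm_add₃_le).trans ?_
  rw [norm_smul, Real.norm_of_nonneg h.pos.le, norm_neg]
  have h4 : c * ‖(T k (s i)).starProjection - (T k (s j)).starProjection‖ ≤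
      1 * (κ * (2 * ε)) := by
    have h5 := h.crossing.nonneg
    have h6 := h.le_one
    refine mul_le_mul h6 ((h.crossing.lipschitz k _ hi.mem _ hj.mem).trans ?_) (norm_nonneg _)
      zero_le_one
    gcongr
    have := (h.norm_sub_le i j).1
    have := h.one_le_scale
    linarith
  have h7 := h.same_lt
  linarith

theorem mem_survivors_of_infDist {k : Bool} {i : Fin n} (hi : 3 ≤ infDist (s i) (S (!k))) :
    i ∈ survivors x 1 η := by
  rintro ⟨j, hj, hcov⟩
  rw [norm_sub_rev] at hj
  rw [one_pow, mul_one] at hcov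
  have := h.one_le_scale
  refine hcov.not_ge (h.norm_localCov_sub_le (h.unmixed_of_infDist hi hj)
    (h.unmixed_of_infDist hi (j := i) (by rw [sub_self, norm_zero]; exact zero_le_one)) ?_)
  rw [norm_sub_rev]
  linarith

/-- Data points far from the intersection of the surfaces are far from one of the surfaces. -/
theorem infDist_of_lt {k : Bool} {i : Fin n} (hik : s i ∈ S k)
    (hi : 64 * K < infDist (x i) (S true ∩ S false)) : 3 ≤ infDist (s i) (S (!k)) := by
  have hK := h.crossing.one_le
  have h1 := infDist_le_infDist_add_dist (s := S true ∩ S false) (x := x i) (y := s i)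
  rw [dist_eq_norm] at h1
  have h2 := h.noise i
  have h3 := h.crossing.regular k _ hik
  by_contra! hlt
  have h4 : K * infDist (s i) (S (!k)) ≤ K * 3 := by gcongr
  linarith

/-- Near any point of either surface there are data points far from the other surface. -/
theorem exists_infDist_ge {k : Bool} {y : E} (hy : y ∈ S k) :
    ∃ i, s i ∈ S k ∧ 3 ≤ infDist (s i) (S (!k)) ∧ ‖s i - y‖ ≤ 21 * K := by
  have hK := h.crossing.one_le
  -- a data point next to a point at distance `4` from the other surface
  have key : ∀ y' ∈ S k, (∀ z ∈ S (!k), 4 ≤ ‖z - y'‖) →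
      ∃ i, s i ∈ S k ∧ 3 ≤ infDist (s i) (S (!k)) ∧ ‖s i - y'‖ ≤ 1 := by
    intro y' hy' hfar
    obtain ⟨i, hi, hiy⟩ := h.cover k y' hy'
    refine ⟨i, hi, ?_, by linarith⟩
    rw [le_infDist (h.crossing.nonempty (!k))]
    intro z hz
    have h1 := hfar z hz
    have h2 := norm_sub_le_norm_sub_add_norm_sub z (s i) y'
    rw [dist_eq_norm, norm_sub_rev]
    linarith
  by_cases hfar : ∀ z ∈ S (!k), 4 ≤ ‖z - y‖
  · obtain ⟨i, hi, h3, hiy⟩ := key y hy hfar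
    exact ⟨i, hi, h3, by linarith⟩
  · push Not at hfar
    obtain ⟨z, hz, hzy⟩ := hfar
    obtain ⟨p, hp, hyp⟩ := h.crossing.exists_mem_inter_norm_le hy hz
    obtain ⟨y', hy', hy'p, hfar'⟩ := h.crossing.exists_far_point k hp (L := 8 * K)
      (by positivity) (by have := h.curvature_le; linarith)
    obtain ⟨i, hi, h3, hiy⟩ := key y' hy' fun z hz => by
      have := hfar' z hz
      have h8 : 8 * K / (2 * K) = 4 := by field_simp; norm_num
      linarith
    refine ⟨i, hi, h3, ?_⟩
    have h4 : K * ‖y - z‖ ≤ K * 4 := by rw [norm_sub_rev]; gcongr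
    have h5 : s i - y = (s i - y') + (y' - p) + -(y - p) := by abel
    have h6 := norm_add₃_le (a := s i - y') (b := y' - p) (c := -(y - p))
    rw [← h5, norm_neg] at h6
    linarith

/-- Close points from different surfaces have a crossing point nearby. -/
theorem exists_crossing_near {k : Bool} {i j : Fin n} (hi : s i ∈ S k) (hj : s j ∈ S (!k))
    (hij : ‖x i - x j‖ ≤ ε) : ∃ p ∈ S true ∩ S false,
      ‖(T k p).starProjection - (T k (s i)).starProjection‖ ≤ 2 * K * κ * ε ∧
      ‖(T (!k) p).starProjection - (T (!k) (s j)).starProjection‖ ≤ 4 * K * κ * ε := by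
  have hK := h.crossing.one_le
  have hκ := h.crossing.nonneg
  have hε := h.one_le_scale
  obtain ⟨p, hp, hip⟩ := h.crossing.exists_mem_inter_norm_le hi hj
  have h1 := (h.norm_sub_le i j).1
  have h2 : ‖p - s i‖ ≤ 2 * K * ε := by
    have : K * ‖s i - s j‖ ≤ K * (2 * ε) := by gcongr; linarith
    rw [norm_sub_rev]
    linarith
  have h3 : ‖p - s j‖ ≤ 4 * K * ε := by
    have := norm_sub_le_norm_sub_add_norm_sub p (s i) (s j)
    have h4 : 2 * ε ≤ 2 * K * ε := by gcongr; linarith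
    linarith
  refine ⟨p, hp, (h.crossing.lipschitz k _ (Crossing.mem_of_mem_inter hp k) _ hi).trans ?_,
    (h.crossing.lipschitz (!k) _ (Crossing.mem_of_mem_inter hp _) _ hj).trans ?_⟩
  · calc κ * ‖p - s i‖ ≤ κ * (2 * K * ε) := by gcongr
      _ = _ := by ring
  · calc κ * ‖p - s j‖ ≤ κ * (4 * K * ε) := by gcongr
      _ = _ := by ring

/-- Unmixed points of different surfaces are not joined by an edge: near a crossing point their
tangent spaces differ by the angle there. -/
theorem lt_norm_localCov_sub {k : Bool} {i j : Fin n} (hi : Unmixed (S k) s x i)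
    (hj : Unmixed (S (!k)) s x j) (hij : ‖x i - x j‖ ≤ ε) :
    η < ‖localCov x 1 i - localCov x 1 j‖ := by
  have hK := h.crossing.one_le
  have hc := h.pos
  by_contra! hle
  obtain ⟨p, hp, hpi, hpj⟩ := h.exists_crossing_near hi.mem hj.mem hij
  obtain ⟨e, heT, he, hKe⟩ := h.crossing.angle k p hp
  obtain ⟨P, hP⟩ : ∃ P, P = (T k (s i)).starProjection := ⟨_, rfl⟩
  obtain ⟨Q, hQ⟩ : ∃ Q, Q = (T (!k) (s j)).starProjection := ⟨_, rfl⟩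
  have h1 := h.cov_close k i hi
  have h2 := h.cov_close (!k) j hj
  rw [← hP] at hpi h1
  rw [← hQ] at hpj h2
  have h3 : c • (P - Q) = -(localCov x 1 i - c • P) + (localCov x 1 i - localCov x 1 j) +
      (localCov x 1 j - c • Q) := by rw [smul_sub]; abel
  have h4 := norm_add₃_le (a := -(localCov x 1 i - c • P))
    (b := localCov x 1 i - localCov x 1 j) (c := localCov x 1 j - c • Q)
  rw [← h3, norm_neg, norm_smul, Real.norm_of_nonneg hc.le] at h4
  have h5 : e - (T (!k) p).starProjection e =
      ((T k p).starProjection - P) e + (P - Q) e + -(((T (!k) p).starProjection - Q) e) := by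
    simp only [sub_apply]
    rw [starProjection_of_mem heT]
    abel
  have h6 := norm_add₃_le (a := ((T k p).starProjection - P) e) (b := (P - Q) e)
    (c := -(((T (!k) p).starProjection - Q) e))
  rw [← h5, norm_neg] at h6
  have h7 := ((T k p).starProjection - P).le_opNorm e
  have h8 := (P - Q).le_opNorm e
  have h9 := ((T (!k) p).starProjection - Q).le_opNorm e
  rw [he, mul_one] at h7 h8 h9
  have h10 : c / K ≤ c * ‖e - (T (!k) p).starProjection e‖ := by
    rw [div_le_iff₀ (by linarith)]
    calc c = c * 1 := (mul_one c).symm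
      _ ≤ c * (K * ‖e - (T (!k) p).starProjection e‖) := by gcongr
      _ = _ := by ring
  have h11 : c * ‖e - (T (!k) p).starProjection e‖ ≤
      c * (‖P - Q‖ + 6 * K * κ * ε) := by gcongr; linarith
  have h12 : c * (6 * K * κ * ε) ≤ 1 * (6 * K * κ * ε) := by
    have := h.crossing.nonneg
    have := h.one_le_scale
    gcongr
    exact h.le_one
  have h13 := h.cross_lt
  linarith

/-! ### Comparing covariances -/

/-- The survivors on one surface are connected with each other. -/
theorem reachable_of_mem {k : Bool} {i j : survivors x 1 η} (hi : s i ∈ S k) (hj : s j ∈ S k) :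
    ((covGraph x 1 ε η).induce (survivors x 1 η)).Reachable i j := by
  have hK := h.crossing.one_le
  refine reachable_of_isPreconnected (h.crossing.isPreconnected k) (U := {i : survivors x 1 η | s i ∈ S k})
    (f := fun i => s i) (ρ := 21 * K) (by positivity) (fun i hi => hi) ?_ ?_ hi hj
  · intro y hy
    obtain ⟨i, hi, h3, hiy⟩ := h.exists_infDist_ge hy
    exact ⟨⟨i, h.mem_survivors_of_infDist h3⟩, hi, hiy⟩
  · intro v hv w hw hvw
    rcases eq_or_ne v w with rfl | hne
    · exact .refl _
    refine SimpleGraph.Adj.reachable ?_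
    have h1 : ‖x v - x w‖ ≤ ε := by
      have := (h.norm_sub_le v w).2
      have := h.le_scale
      linarith
    refine ⟨fun heq => hne (Subtype.ext heq), h1, ?_⟩
    rw [one_pow, mul_one]
    exact h.norm_localCov_sub_le (h.unmixed_of_mem_survivors v.2 hv)
      (h.unmixed_of_mem_survivors w.2 hw) h1

/-- Paths between survivors stay on one surface. -/
theorem mem_of_reachable {k : Bool} {i j : survivors x 1 η}
    (hij : ((covGraph x 1 ε η).induce (survivors x 1 η)).Reachable i j) (hi : s i ∈ S k) :
    s j ∈ S k := by
  obtain ⟨w⟩ := hij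
  induction w with
  | nil => exact hi
  | @cons u v w huv _ ih =>
    refine ih ((h.mem_or k v).resolve_right fun hv => ?_)
    obtain ⟨-, hε, hη⟩ := huv
    rw [one_pow, mul_one] at hη
    exact hη.not_gt (h.lt_norm_localCov_sub (h.unmixed_of_mem_survivors u.2 hi)
      (h.unmixed_of_mem_survivors v.2 hv) hε)

theorem exists_survivor (k : Bool) : ∃ i : survivors x 1 η, s i ∈ S k := by
  obtain ⟨y, hy⟩ := h.crossing.nonempty k
  obtain ⟨i, hi, h3, -⟩ := h.exists_infDist_ge hy
  exact ⟨⟨i, h.mem_survivors_of_infDist h3⟩, hi⟩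

theorem exists_isCovOutput : ∃ R, IsCovOutput x 1 ε η R := by
  classical
  obtain ⟨i₀, -⟩ := h.exists_survivor true
  have hex : ∀ i, ∃ j : survivors x 1 η, ∀ k ∈ survivors x 1 η, ‖x i - x j‖ ≤ ‖x i - x k‖ := by
    intro i
    have : Nonempty (survivors x 1 η) := ⟨i₀⟩
    obtain ⟨j, hj⟩ := Finite.exists_min fun j : survivors x 1 η => ‖x i - x j‖
    exact ⟨j, fun k hk => hj ⟨k, hk⟩⟩
  choose q hq using hex
  let p : Fin n → survivors x 1 η := fun i => if hi : i ∈ survivors x 1 η then ⟨i, hi⟩ else q i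
  refine ⟨((covGraph x 1 ε η).induce (survivors x 1 η)).reachableSetoid.comap p, p,
    fun i hi => ?_, fun i hi => ?_, fun i j => Iff.rfl⟩
  · simp only [p, dif_pos hi]
  · simp only [p, dif_neg hi]
    exact hq i

theorem numGroups_of_isCovOutput {R : Setoid (Fin n)} (hR : IsCovOutput x 1 ε η R) :
    numGroups R = 2 := by
  obtain ⟨p, hp, -, hR⟩ := hR
  obtain ⟨i, hi⟩ := h.exists_survivor true
  obtain ⟨j, hj⟩ := h.exists_survivor false
  have hpi : p i = i := Subtype.ext (hp i i.2)
  have hpj : p j = j := Subtype.ext (hp j j.2)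
  rw [numGroups, Nat.card_eq_two_iff]
  refine ⟨Quotient.mk R i, Quotient.mk R j, fun heq => ?_, ?_⟩
  · have h1 := (hR i j).1 (Quotient.exact heq)
    rw [hpi, hpj] at h1
    exact h.notMem_of_mem hj (h.mem_of_reachable h1 hi)
  · refine eq_univ_of_forall fun a => ?_
    induction a using Quotient.inductionOn with
    | h a =>
      rcases h.mem_or true (p a) with ha | ha
      · refine Or.inl (Quotient.sound ((hR a i).2 ?_))
        rw [hpi]
        exact h.reachable_of_mem ha hi
      · refine Or.inr (Quotient.sound ((hR a j).2 ?_))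
        rw [hpj]
        exact h.reachable_of_mem ha hj

theorem separatesClusters_of_isCovOutput {R : Setoid (Fin n)} (hR : IsCovOutput x 1 ε η R) :
    SeparatesClusters (S true) (S false) s x (64 * K) R := by
  obtain ⟨p, hp, -, hR⟩ := hR
  intro i j hi hj hij
  by_contra! hfar
  have h1 := h.mem_survivors_of_infDist (h.infDist_of_lt hi hfar.1)
  have h2 := h.mem_survivors_of_infDist (h.infDist_of_lt hj hfar.2)
  have h3 := h.mem_of_reachable (k := true) ((hR i j).1 hij) (by rwa [hp i h1])
  rw [hp j h2] at h3
  exact h.notMem_inter j ⟨h3, hj⟩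

/-! ### Comparing projections -/

/-- The projections at close data points from different surfaces are far apart, if both have the
dimension of the surfaces. -/
theorem lt_norm_localProj_sub {k : Bool} {i j : Fin n} (hi : s i ∈ S k) (hj : s j ∈ S (!k))
    (hij : ‖x i - x j‖ ≤ ε)
    (hrank : finrank ℝ (spectralSubspace (localCov x 1 i) (√η * ‖localCov x 1 i‖)) = d) :
    η < ‖localProj x 1 η i - localProj x 1 η j‖ := by
  have hK := h.crossing.one_le
  by_contra! hle
  obtain ⟨p, hp, hpi, hpj⟩ := h.exists_crossing_near hi hj hij
  obtain ⟨e, heT, he, hKe⟩ := h.crossing.angle (!k) p hp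
  rw [Bool.not_not] at hKe
  -- vectors tangent at the crossing point, to either surface, are almost fixed
  have hfix : ∀ (k' : Bool) (i' : Fin n), s i' ∈ S k' → ∀ {t : ℝ},
      ‖(T k' p).starProjection - (T k' (s i')).starProjection‖ ≤ t → ∀ v ∈ T k' p,
      ‖v - localProj x 1 η i' v‖ ≤ (t + ω) * ‖v‖ := by
    intro k' i' hi' t ht v hv
    have h1 := h.proj_close k' i' hi' _ ((T k' (s i')).starProjection_apply_mem v)
    have h2 : ‖v - (T k' (s i')).starProjection v‖ ≤ t * ‖v‖ := by
      have h3 := ((T k' p).starProjection - (T k' (s i')).starProjection).le_opNorm v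
      rw [sub_apply, starProjection_of_mem hv] at h3
      exact h3.trans (by gcongr)
    have hω : 0 ≤ ω * ‖(T k' (s i')).starProjection v‖ := (norm_nonneg _).trans h1
    have h4 := norm_sub_starProjection_le
      (spectralSubspace (localCov x 1 i') (√η * ‖localCov x 1 i'‖)) v
      (w := localProj x 1 η i' ((T k' (s i')).starProjection v))
      (Submodule.starProjection_apply_mem _ _)
    refine h4.trans ?_
    have h5 := norm_sub_le_norm_sub_add_norm_sub v ((T k' (s i')).starProjection v)
      (localProj x 1 η i' ((T k' (s i')).starProjection v))
    have h6 := (T k' (s i')).norm_starProjection_apply_le v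
    have h7 : ω * ‖(T k' (s i')).starProjection v‖ ≤ ω * ‖v‖ :=
      mul_le_mul_of_nonneg_left h6 h.nonneg
    linarith
  have hω := h.nonneg
  have hκ : 0 ≤ K * κ * ε := by
    have := h.crossing.nonneg
    have := h.one_le_scale
    positivity
  have hη : 0 ≤ η := (norm_nonneg _).trans hle
  obtain ⟨ω', hω'⟩ : ∃ ω', ω' = ω + 4 * K * κ * ε + η := ⟨_, rfl⟩
  have hlt := h.proj_lt
  rw [← hω', le_div_iff₀ (by positivity)] at hlt
  have hωK : ω' ≤ ω' * K := le_mul_of_one_le_right (by rw [hω']; linarith) hK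
  have h1 := norm_sub_starProjection_le_of_finrank_eq (T := T k p) (ω := ω') (e := e)
    ((h.crossing.finrank_eq k p (Crossing.mem_of_mem_inter hp k)).trans hrank.symm) (by linarith)
    (fun v hv => (hfix k i hi hpi v hv).trans (by gcongr; linarith)) he (by
      have h2 := hfix (!k) j hj hpj e heT
      have h3 := (localProj x 1 η i - localProj x 1 η j).le_opNorm e
      have h4 : e - localProj x 1 η i e =
        (e - localProj x 1 η j e) - (localProj x 1 η i - localProj x 1 η j) e := by
        rw [sub_apply]; abel
      have h5 := _root_.norm_sub_le (e - localProj x 1 η j e)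
        ((localProj x 1 η i - localProj x 1 η j) e)
      rw [← h4] at h5
      rw [he, mul_one] at h2 h3
      exact h5.trans (by linarith))
  have h6 : K * ‖e - (T k p).starProjection e‖ ≤ K * (4 * ω') := by gcongr
  linarith

/-- Groups cannot pass from one surface to the other at data points whose projections have the
dimension of the surfaces, and this dimension is constant in each group. -/
theorem not_reachable_projGraph {k : Bool} {i j : Fin n} (hi : s i ∈ S k) (hj : s j ∈ S (!k))
    (hrank : finrank ℝ (spectralSubspace (localCov x 1 i) (√η * ‖localCov x 1 i‖)) = d) :
    ¬ (projGraph x 1 ε η).Reachable i j := by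
  rintro ⟨w⟩
  induction w with
  | nil => exact h.notMem_of_mem hi hj
  | @cons u v w huv _ ih =>
    obtain ⟨-, hε, hη⟩ := huv
    refine ih ((h.mem_or k v).resolve_right fun hv => ?_) hj ?_
    · exact hη.not_gt (h.lt_norm_localProj_sub hi hv hε hrank)
    · rw [← hrank]
      refine finrank_eq_of_norm_starProjection_sub_lt ?_
      rw [norm_sub_rev]
      exact hη.trans_lt h.eta_lt

theorem two_le_numGroups_projOutput : 2 ≤ numGroups (projOutput x 1 ε η) := by
  have key : ∀ k, ∃ i, s i ∈ S k ∧ Unmixed (S k) s x i := by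
    intro k
    obtain ⟨y, hy⟩ := h.crossing.nonempty k
    obtain ⟨i, hi, h3, -⟩ := h.exists_infDist_ge hy
    exact ⟨i, hi, h.unmixed_of_infDist h3 (by rw [sub_self, norm_zero]; exact zero_le_one)⟩
  obtain ⟨i, hi, hiu⟩ := key true
  obtain ⟨j, hj, -⟩ := key false
  have : Nontrivial (Quotient (projOutput x 1 ε η)) :=
    ⟨Quotient.mk _ i, Quotient.mk _ j, fun heq =>
      h.not_reachable_projGraph hi hj (h.finrank_eq true i hiu) (Quotient.exact heq)⟩
  exact Finite.one_lt_card

theorem separatesClusters_projOutput :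
    SeparatesClusters (S true) (S false) s x (64 * K) (projOutput x 1 ε η) := by
  intro i j hi hj hij
  by_contra! hfar
  refine h.not_reachable_projGraph hi hj (h.finrank_eq true i ?_) hij
  exact h.unmixed_of_infDist (h.infDist_of_lt hi hfar.1)
    (by rw [sub_self, norm_zero]; exact zero_le_one)

end

end ResolvedSample

end Groups

/-! ### Change of scale -/

section Rescaling

open Set Filter Metric Topology
open scoped Pointwise

set_option linter.unusedSectionVars false

variable {E : Type*} [NormedAddCommGroup E] [InnerProductSpace ℝ E] [FiniteDimensional ℝ E]
  {d n : ℕ} {r : ℝ}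

theorem norm_smul_sub_smul_of_pos (hr : 0 < r) (x y : E) : ‖r • x - r • y‖ = r * ‖x - y‖ := by
  rw [← smul_sub, norm_smul, Real.norm_of_nonneg hr.le]

theorem neighbors_smul (hr : 0 < r) (x : Fin n → E) (i : Fin n) :
    neighbors (r • x) r i = neighbors x 1 i := by
  ext j
  rw [mem_neighbors, mem_neighbors, Pi.smul_apply, Pi.smul_apply, norm_smul_sub_smul_of_pos hr,
    mul_le_iff_le_one_right hr]

theorem sampleMean_smul (x : Fin n → E) (J : Finset (Fin n)) :
    sampleMean (r • x) J = r • sampleMean x J := by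
  simp only [sampleMean, Pi.smul_apply, ← Finset.smul_sum]
  rw [smul_comm]

theorem localCov_smul (hr : 0 < r) (x : Fin n → E) (i : Fin n) :
    localCov (r • x) r i = r ^ 2 • localCov x 1 i := by
  simp only [localCov, neighbors_smul hr, sampleMean_smul, Pi.smul_apply, ← smul_sub]
  rw [smul_comm, Finset.smul_sum (r := r ^ 2)]
  congr 1
  refine Finset.sum_congr rfl fun j _ => ?_
  ext v
  simp only [InnerProductSpace.rankOne_apply, smul_apply, real_inner_smul_left, smul_smul]
  ring_nf

theorem norm_localCov_smul_sub (hr : 0 < r) (x : Fin n → E) (i j : Fin n) :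
    ‖localCov (r • x) r i - localCov (r • x) r j‖ =
      r ^ 2 * ‖localCov x 1 i - localCov x 1 j‖ := by
  rw [localCov_smul hr, localCov_smul hr, ← smul_sub, norm_smul,
    Real.norm_of_nonneg (sq_nonneg r)]

/-- Rescaling an operator together with the threshold leaves its spectral subspace unchanged. -/
theorem spectralSubspace_smul {a : ℝ} (ha : 0 < a) (A : E →L[ℝ] E) (t : ℝ) :
    spectralSubspace (a • A) (a * t) = spectralSubspace A t := by
  have key : ∀ (a : ℝ), 0 < a → ∀ (A : E →L[ℝ] E) (t : ℝ),
      spectralSubspace (a • A) (a * t) ≤ spectralSubspace A t := by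
    intro a ha A t
    refine iSup₂_le fun β hβ => ?_
    have hβ' : t < β / a := by rwa [lt_div_iff₀ ha, mul_comm]
    refine le_trans (fun v hv => ?_) (le_iSup₂ (β / a) hβ')
    rw [End.mem_eigenspace_iff, ContinuousLinearMap.coe_coe] at hv ⊢
    rw [smul_apply] at hv
    rw [div_eq_inv_mul, ← smul_smul, ← hv, inv_smul_smul₀ ha.ne']
  refine le_antisymm (key a ha A t) ?_
  have := key a⁻¹ (inv_pos.2 ha) (a • A) (a * t)
  rwa [inv_smul_smul₀ ha.ne', inv_mul_cancel_left₀ ha.ne'] at this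

theorem localProj_smul (hr : 0 < r) (x : Fin n → E) (η : ℝ) (i : Fin n) :
    localProj (r • x) r η i = localProj x 1 η i := by
  change (spectralSubspace (localCov (r • x) r i) (√η * ‖localCov (r • x) r i‖)).starProjection =
    (spectralSubspace (localCov x 1 i) (√η * ‖localCov x 1 i‖)).starProjection
  have h : √η * ‖localCov (r • x) r i‖ = r ^ 2 * (√η * ‖localCov x 1 i‖) := by
    rw [localCov_smul hr, norm_smul, Real.norm_of_nonneg (sq_nonneg r)]; ring
  have h2 : spectralSubspace (localCov (r • x) r i) (√η * ‖localCov (r • x) r i‖) =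
      spectralSubspace (localCov x 1 i) (√η * ‖localCov x 1 i‖) := by
    rw [h, localCov_smul hr, spectralSubspace_smul (pow_pos hr 2)]
  simp only [h2]

theorem covGraph_smul (hr : 0 < r) (x : Fin n → E) (ε η : ℝ) :
    covGraph (r • x) r (r * ε) η = covGraph x 1 ε η := by
  ext i j
  change (i ≠ j ∧ ‖(r • x) i - (r • x) j‖ ≤ r * ε ∧
    ‖localCov (r • x) r i - localCov (r • x) r j‖ ≤ η * r ^ 2) ↔ (i ≠ j ∧ ‖x i - x j‖ ≤ ε ∧
    ‖localCov x 1 i - localCov x 1 j‖ ≤ η * 1 ^ 2)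
  rw [norm_localCov_smul_sub hr, Pi.smul_apply, Pi.smul_apply, norm_smul_sub_smul_of_pos hr,
    mul_le_mul_iff_right₀ hr, mul_comm η, mul_le_mul_iff_right₀ (pow_pos hr 2), one_pow, mul_one]

theorem survivors_smul (hr : 0 < r) (x : Fin n → E) (η : ℝ) :
    survivors (r • x) r η = survivors x 1 η := by
  ext i
  refine not_congr (exists_congr fun j => ?_)
  rw [norm_localCov_smul_sub hr, Pi.smul_apply, Pi.smul_apply, norm_smul_sub_smul_of_pos hr,
    mul_le_iff_le_one_right hr, mul_comm η, mul_lt_mul_iff_right₀ (pow_pos hr 2), one_pow, mul_one]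

/-- The groupings found by comparing covariances are unchanged when data and parameters are rescaled. -/
theorem isCovOutput_smul_iff (hr : 0 < r) (x : Fin n → E) (ε η : ℝ) (R : Setoid (Fin n)) :
    IsCovOutput (r • x) r (r * ε) η R ↔ IsCovOutput x 1 ε η R := by
  unfold IsCovOutput
  rw [covGraph_smul hr, survivors_smul hr]
  simp only [Pi.smul_apply, norm_smul_sub_smul_of_pos hr, mul_le_mul_iff_right₀ hr]

theorem projOutput_smul (hr : 0 < r) (x : Fin n → E) (ε η : ℝ) :
    projOutput (r • x) r (r * ε) η = projOutput x 1 ε η := by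
  have h : projGraph (r • x) r (r * ε) η = projGraph x 1 ε η := by
    ext i j
    change (i ≠ j ∧ ‖(r • x) i - (r • x) j‖ ≤ r * ε ∧
      ‖localProj (r • x) r η i - localProj (r • x) r η j‖ ≤ η) ↔ (i ≠ j ∧ ‖x i - x j‖ ≤ ε ∧
      ‖localProj x 1 η i - localProj x 1 η j‖ ≤ η)
    rw [localProj_smul hr, localProj_smul hr, Pi.smul_apply, Pi.smul_apply,
      norm_smul_sub_smul_of_pos hr, mul_le_mul_iff_right₀ hr]
  rw [projOutput, projOutput, h]

theorem infDist_preimage_smul (hr : 0 < r) (A : Set E) (y : E) :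
    infDist (r • y) A = r * infDist y ((r • ·) ⁻¹' A) := by
  have h := infDist_smul₀ hr.ne' ((r • ·) ⁻¹' A) y
  rw [preimage_smul₀ hr.ne', smul_inv_smul₀ hr.ne', Real.norm_of_nonneg hr.le] at h
  rw [h, preimage_smul₀ hr.ne']

theorem SeparatesClusters.smul (hr : 0 < r) {A B : Set E} {s x : Fin n → E} {δ : ℝ}
    {R : Setoid (Fin n)}
    (h : SeparatesClusters ((r • ·) ⁻¹' A) ((r • ·) ⁻¹' B) s x δ R) :
    SeparatesClusters A B (r • s) (r • x) (δ * r) R := by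
  intro i j hi hj hij
  rw [Pi.smul_apply, Pi.smul_apply, infDist_preimage_smul hr, infDist_preimage_smul hr,
    mul_comm δ, mul_le_mul_iff_right₀ hr, mul_le_mul_iff_right₀ hr]
  exact h i j hi hj hij

/-- Dividing lengths by `r` multiplies the curvature by `r` and preserves the angle and the linear
separation. -/
theorem Crossing.rescale {S : Bool → Set E} {T : Bool → E → Submodule ℝ E} {κ K : ℝ}
    (h : Crossing d S T κ K) (hr : 0 < r) :
    Crossing d (fun k => (r • ·) ⁻¹' S k) (fun k y => T k (r • y)) (κ * r) K where
  isCompact k := by rw [preimage_smul₀ hr.ne']; exact (h.isCompact k).smul _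
  isPreconnected k := by
    rw [preimage_smul₀ hr.ne']
    exact (h.isPreconnected k).image _ (continuous_const_smul _).continuousOn
  meet := by
    obtain ⟨p, hp⟩ := h.meet
    exact ⟨r⁻¹ • p, by rw [← preimage_inter, mem_preimage, smul_inv_smul₀ hr.ne']; exact hp⟩
  one_le := h.one_le
  nonneg := mul_nonneg h.nonneg hr.le
  finrank_eq k s hs := h.finrank_eq k _ hs
  near k s hs y hy := by
    have h1 := h.near k _ hs _ hy
    rw [← smul_sub, map_smul, ← smul_sub, norm_smul, norm_smul, Real.norm_of_nonneg hr.le] at h1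
    refine le_of_mul_le_mul_left (a := r) (h1.trans_eq (by ring)) hr
  lipschitz k s hs y hy := by
    have h1 := h.lipschitz k _ hs _ hy
    rwa [norm_smul_sub_smul_of_pos hr, ← mul_assoc] at h1
  lift k s hs w hw hκ := by
    obtain ⟨y, hy, hyw, hyn⟩ := h.lift k _ hs (r • w) ((T k (r • s)).smul_mem _ hw) (by
      rwa [norm_smul, Real.norm_of_nonneg hr.le, ← mul_assoc])
    have hy' : y - r • s = r • (r⁻¹ • y - s) := by rw [smul_sub, smul_inv_smul₀ hr.ne']
    rw [hy'] at hyw hyn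
    refine ⟨r⁻¹ • y, by rw [mem_preimage, smul_inv_smul₀ hr.ne']; exact hy, ?_, ?_⟩
    · rw [map_smul] at hyw
      exact smul_right_injective E hr.ne' hyw
    · rw [norm_smul, norm_smul, Real.norm_of_nonneg hr.le] at hyn
      exact le_of_mul_le_mul_left (a := r) (hyn.trans_eq (by ring)) hr
  regular k s hs := by
    have h1 := h.regular k _ hs
    rw [infDist_preimage_smul hr, infDist_preimage_smul hr] at h1
    exact le_of_mul_le_mul_left (a := r) (h1.trans_eq (by ring)) hr
  angle k p hp := h.angle k _ hp

theorem discMoment_smul (c : ℝ) (T : Submodule ℝ E) (v : E) (R α : ℝ) (u : E) (hr : 0 < r) :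
    discMoment d c T (r • v) (R * r) α (r⁻¹ • u) = r ^ d * discMoment d c T v R α u := by
  have h1 : discRadius T (r • v) (R * r) = r * discRadius T v R := by
    have h2 : (R * r) ^ 2 - ‖r • v - T.starProjection (r • v)‖ ^ 2 =
        r ^ 2 * (R ^ 2 - ‖v - T.starProjection v‖ ^ 2) := by
      rw [map_smul, norm_smul_sub_smul_of_pos hr]; ring
    rw [discRadius, h2, Real.sqrt_mul (sq_nonneg r), Real.sqrt_sq hr.le, discRadius]
  rw [discMoment, discMoment, h1, map_smul, map_smul, real_inner_smul_left, real_inner_smul_right,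
    mul_inv_cancel_left₀ hr.ne', norm_smul, norm_inv, Real.norm_of_nonneg hr.le]
  field_simp
  ring

/-- Regularity at scale `r` is regularity at scale `1` of the rescaled points. -/
theorem RegularSample.rescale {c M β l : ℝ} {S : Bool → Set E} {T : Bool → E → Submodule ℝ E}
    {s x : Fin n → E} (h : RegularSample d c S T M β l r (r • s) (r • x)) (hr : 0 < r) :
    RegularSample d c (fun k => (r • ·) ⁻¹' S k) (fun k y => T k (r • y)) M β l 1 s x where
  mem := h.mem
  notMem_inter := h.notMem_inter
  noise i := by
    have h1 := h.noise i
    rw [Pi.smul_apply, Pi.smul_apply, norm_smul_sub_smul_of_pos hr] at h1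
    exact le_of_mul_le_mul_left (a := r) (h1.trans_eq (by ring)) hr
  cover k y hy := by
    obtain ⟨j, hj, hjy⟩ := h.cover k _ hy
    rw [Pi.smul_apply, norm_smul_sub_smul_of_pos hr] at hjy
    exact ⟨j, hj, le_of_mul_le_mul_left (a := r) (hjy.trans_eq (by ring)) hr⟩
  moments := by
    obtain ⟨m, hm, hmom⟩ := h.moments
    have hrd := pow_pos hr d
    refine ⟨m * r ^ d, by positivity, fun k i p hp hip α u hα hu => ?_⟩
    have h1 := hmom k i _ hp (by
      rw [Pi.smul_apply, norm_smul_sub_smul_of_pos hr, mul_comm M]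
      rw [mul_one] at hip
      gcongr) α (r⁻¹ • u) hα (by
      rw [norm_smul, norm_inv, Real.norm_of_nonneg hr.le, mul_comm, mul_inv_cancel_left₀ hr.ne']
      rwa [mul_one] at hu)
    have h2 : ∀ j, ⟪r • x j - r • p, r⁻¹ • u⟫ = ⟪x j - p, u⟫ := fun j => by
      rw [← smul_sub, real_inner_smul_left, real_inner_smul_right, mul_inv_cancel_left₀ hr.ne']
    rw [neighbors_smul hr] at h1
    simp only [Pi.smul_apply, ← smul_sub, discMoment_smul _ _ _ _ _ _ hr] at h1
    simp only [smul_sub, h2] at h1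
    rw [mul_one, mul_one, one_pow, mul_one]
    have h3 : ∀ Z : ℝ, m⁻¹ * Z = r ^ d * ((m * r ^ d)⁻¹ * Z) := fun Z => by
      field_simp
    rw [h3, mul_comm β, ← mul_sub, ← mul_add, mul_le_mul_iff_right₀ hrd,
      mul_le_mul_iff_right₀ hrd] at h1
    exact h1

end Rescaling

/-! ### The groups returned by the two algorithms -/

theorem theorem1 {D d : ℕ} (hd : 1 ≤ d)
    (S₁ S₂ : Set (EuclideanSpace ℝ (Fin D)))
    (hS₁ : IsClosedSurface d S₁) (hS₂ : IsClosedSurface d S₂)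
    (hmeet : (S₁ ∩ S₂).Nonempty)
    (hangle : 0 < incidenceAngle S₁ S₂)
    (hreach : 0 < reach (S₁ ∩ S₂))
    (htangent : ∀ s ∈ S₁ ∩ S₂,
      posTangentConeAt (S₁ ∩ S₂) s =
        (tangentSubspace S₁ s ⊓ tangentSubspace S₂ s : Submodule ℝ (EuclideanSpace ℝ (Fin D)))) :
    ∃ C₀ : ℝ, 0 < C₀ ∧ ∀ C : ℝ, C₀ ≤ C →
      ∀ (n : ℕ) (r ε η τ : ℝ), 1 ≤ n → 0 < r → 0 < ε → 0 < η → 0 ≤ τ →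
        τ ≤ r * η / C → r ≤ ε / C → ε ≤ η / C → η ≤ 1 / C →
      ∀ {Ω : Type*} [MeasurableSpace Ω] (P : Measure Ω) [IsProbabilityMeasure P]
        (s z : Fin n → Ω → EuclideanSpace ℝ (Fin D)), IsNoisySample P d S₁ S₂ τ s z →
      ∃ G : Set Ω, MeasurableSet G ∧
        1 - C * n * Real.exp (-(n * r ^ d * η ^ 2 / C)) ≤ P.real G ∧
        ∀ ω ∈ G,
          ((∃ R, IsCovOutput (fun i => s i ω + z i ω) r ε η R) ∧
            ∀ R, IsCovOutput (fun i => s i ω + z i ω) r ε η R →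
              numGroups R = 2 ∧
              SeparatesClusters S₁ S₂ (fun i => s i ω) (fun i => s i ω + z i ω) (C * r) R) ∧
          2 ≤ numGroups (projOutput (fun i => s i ω + z i ω) r ε η) ∧
          SeparatesClusters S₁ S₂ (fun i => s i ω) (fun i => s i ω + z i ω) (C * r)
            (projOutput (fun i => s i ω + z i ω) r ε η) := by
  obtain ⟨K, hcross⟩ := exists_crossing hS₁ hS₂ hmeet hangle hreach htangent
  obtain ⟨v, c, hv⟩ := exists_discFormula (EuclideanSpace ℝ (Fin D)) hd
  have hK := hcross.one_le
  obtain ⟨M, l, b, hM, hl, hl1, hb, hres⟩ := exists_resolvedSample (EuclideanSpace ℝ (Fin D)) hd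
    hv.var_pos hv.var_le_one hK
  obtain ⟨C₁, hC₁, hsample⟩ := hcross.exists_regularSample hv hM hl hl1 hb
  refine ⟨max (max C₁ (64 * K)) (max (K / b) (1 / b)), by positivity, ?_⟩
  intro C hC n r ε η τ hn hr hε hη hτ hτC hrC hεC hηC Ω _ P _ s z hsz
  have hCC₁ : C₁ ≤ C := (le_max_left _ _).trans ((le_max_left _ _).trans hC)
  have hCK : 64 * K ≤ C := (le_max_right _ _).trans ((le_max_left _ _).trans hC)
  have hCKb : K / b ≤ C := (le_max_left _ _).trans ((le_max_right _ _).trans hC)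
  have hCb : 1 / b ≤ C := (le_max_right _ _).trans ((le_max_right _ _).trans hC)
  have hC0 : 0 < C := by linarith
  have hrε : C * r ≤ ε := by rwa [le_div_iff₀' hC0] at hrC
  have hεη : C * ε ≤ η := by rwa [le_div_iff₀' hC0] at hεC
  have hrη : r * C ≤ η := by
    have h1 : 1 * ε ≤ C * ε := by gcongr; linarith
    linarith
  -- a larger constant strengthens the conditions on the parameters and weakens the conclusion
  obtain ⟨G, hGm, hGP, hG⟩ := hsample n r η τ hn hr hη (hτC.trans (by gcongr))
    (by rw [le_div_iff₀ (by linarith)]; exact (by gcongr : r * C₁ ≤ r * C).trans hrη)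
    (hηC.trans (by gcongr)) P s z hsz.measurable_surface hsz.measurable_noise
    (hsz.indep.comp (fun _ => Prod.fst) fun _ => measurable_fst) hsz.uniform hsz.noise_le
  refine ⟨G, hGm, le_trans ?_ hGP, fun ω hω => ?_⟩
  · gcongr
  -- on the good event, pass to the scale `1`
  obtain ⟨s', hs'⟩ : ∃ s' : Fin n → EuclideanSpace ℝ (Fin D), (fun i => s i ω) = r • s' :=
    ⟨r⁻¹ • fun i => s i ω, (smul_inv_smul₀ hr.ne' _).symm⟩
  obtain ⟨x', hx'⟩ : ∃ x' : Fin n → EuclideanSpace ℝ (Fin D),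
      (fun i => s i ω + z i ω) = r • x' :=
    ⟨r⁻¹ • fun i => s i ω + z i ω, (smul_inv_smul₀ hr.ne' _).symm⟩
  have hreg := hG ω hω
  rw [hs', hx'] at hreg ⊢
  obtain ⟨ε', hε'⟩ : ∃ ε', ε = r * ε' := ⟨r⁻¹ * ε, (mul_inv_cancel_left₀ hr.ne' _).symm⟩
  obtain ⟨δ, ω', h⟩ := hres (ε := ε') (hcross.rescale hr) (hreg.rescale hr) hη (by
      refine hηC.trans ?_
      rw [div_le_iff₀ hC0]
      rwa [div_le_iff₀ hb, mul_comm] at hCb) (by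
      rw [mul_assoc, ← hε']
      rw [div_le_iff₀ hb] at hCKb
      calc K * ε ≤ C * b * ε := by gcongr
        _ = b * (C * ε) := by ring
        _ ≤ b * η := by gcongr) (by
      refine le_of_mul_le_mul_left (a := r) ?_ hr
      rw [← hε']
      exact le_trans (by rw [mul_comm]; gcongr) hrε)
  have hmono : ∀ R, SeparatesClusters S₁ S₂ (r • s') (r • x') (64 * K * r) R →
      SeparatesClusters S₁ S₂ (r • s') (r • x') (C * r) R := fun R hR i j hi hj hij =>
    (hR i j hi hj hij).imp (fun h => h.trans (by gcongr)) fun h => h.trans (by gcongr)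
  rw [hε', projOutput_smul hr]
  simp only [isCovOutput_smul_iff hr]
  exact ⟨⟨h.exists_isCovOutput, fun R hR => ⟨h.numGroups_of_isCovOutput hR,
    hmono R ((h.separatesClusters_of_isCovOutput hR).smul hr)⟩⟩,
    h.two_le_numGroups_projOutput, hmono _ (h.separatesClusters_projOutput.smul hr)⟩
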